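/- **Proposition 3.3 (modified Maxwell equations).** Let $M>0$ and $|a|\le M$, and put $r_\pm=M\pm\sqrt{M^2-a^2}$, $\Delta=(r-r_+)(r-r_-)$, $\Sigma=r^2+a^2\cos^2\theta$. Let $(\mathcal M,g)$ be the Kerr exterior manifold $\mathcal M=\mathbb R_{\bar t}\times[r_+,\infty)_{r}\times\mathbb S^2_{(\theta,\bar\phi)}$ (including the event horizon $r=r_+$) with the metric $$g=-\Big(1-\frac{2Mr}{\Sigma}\Big)d\bar t^2+2\,d\bar t\,dr+\Sigma\,d\theta^2+\frac{(r^2+a^2)^2-\Delta a^2\sin^2\theta}{\Sigma}\sin^2\theta\,d\bar\phi^2-2a\sin^2\theta\,dr\,d\bar\phi-\frac{4aMr}{\Sigma}\sin^2\theta\,d\bar t\,d\bar\phi ,$$ extended smoothly across the axis, and let $\nabla$ be its Levi-Civita connection. Let $$e_3=-\partial_r,\qquad e_4=\frac{2(r^2+a^2)}{\Sigma}\partial_{\bar t}+\frac{\Delta}{\Sigma}\partial_r+\frac{2a}{\Sigma}\partial_{\bar\phi}$$ be the algebraically special null vector fields (in the coordinates $(\bar t,r,\theta,\bar\phi)$),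 so that $g(e_3,e_4)=-2$, and let $\mathfrak D=\langle e_3,e_4\rangle^\perp$ be the horizontal distribution, with induced metric $\slashed g$ and induced volume form $\slashed\varepsilon(X,Y)=\frac12\mathrm{vol}_g(X,Y,e_3,e_4)$, where $\mathcal M$ is oriented by $d\bar t\wedge dr\wedge d\theta\wedge d\bar\phi$. Capital indices $A,B,C$ refer to a local frame of $\mathfrak D$, and horizontal indices are raised with $\slashed g^{-1}$. Let $\slashed\nabla$ be the connection on $\mathfrak D$ induced by $\nabla$ (horizontal projection); on functions, $\slashed\nabla_3=e_3$, $\slashed\nabla_4=e_4$ and $\slashed\nabla f=df|_{\mathfrak D}$. For $\mathfrak D$ one-forms $\varsigma$ put $\slashed{\mathrm{div}}\,\varsigma=\slashed g^{AB}(\slashed\nabla_A\varsigma)_B$, $\slashed{\mathrm{curl}}\,\varsigma=\slashed\varepsilon^{AB}(\slashed\nabla_A\varsigma)_B$, ${}^\star\varsigma_A=\slashed\varepsilon_{AC}\slashed g^{CB}\varsigma_B$. Let $\chi_{AB}=g(\nabla_{e_A}e_4,e_B)$, $\underline\chi_{AB}=g(\nabla_{e_A}e_3,e_B)$, $\hat\omega=\frac12g(\nabla_{e_4}e_3,e_4)$,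 $\mathrm{tr}\underline\chi=\slashed g^{AB}\underline\chi_{AB}$, $(\slashed\varepsilon\cdot\underline\chi)=\slashed\varepsilon^{AB}\underline\chi_{AB}$, and $(\chi^{\sharp_2}\cdot\varsigma)_A=\slashed g^{BC}\chi_{AC}\varsigma_B$, similarly for $\underline\chi$. Let $F$ be a smooth two-form on $\mathcal M$, with components $\alpha(e_A)=F(e_A,e_4)$, $\underline\alpha(e_A)=F(e_A,e_3)$, $\rho=\frac12F(e_3,e_4)$, $\sigma=\frac12\slashed\varepsilon^{AB}F(e_A,e_B)$, and set $$\widehat\rho=(r^2-a^2\cos^2\theta)\rho-2ar\cos\theta\,\sigma,\qquad \widehat\sigma=2ar\cos\theta\,\rho+(r^2-a^2\cos^2\theta)\sigma,$$ $$\mathfrak T(\alpha)=\tfrac12\Sigma(\slashed\nabla_3\alpha+\underline\chi^{\sharp_2}\cdot\alpha),\qquad \underline{\mathfrak T}(\underline\alpha)=\tfrac12\Sigma(\slashed\nabla_4\underline\alpha+\chi^{\sharp_2}\cdot\underline\alpha+\hat\omega\,\underline\alpha).$$ Then, on $\mathcal M$, $$\widehat\rho=\tfrac14\Sigma[(\mathrm{tr}\underline\chi)^2-(\slashed\varepsilon\cdot\underline\chi)^2]\Sigma\rho+\tfrac12\Sigma(\slashed\varepsilon\cdot\underline\chi)(\mathrm{tr}\underline\chi)\Sigma\sigma,\qquad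 \widehat\sigma=-\tfrac12\Sigma(\slashed\varepsilon\cdot\underline\chi)(\mathrm{tr}\underline\chi)\Sigma\rho+\tfrac14\Sigma[(\mathrm{tr}\underline\chi)^2-(\slashed\varepsilon\cdot\underline\chi)^2]\Sigma\sigma,$$ and $F$ satisfies the source-free Maxwell equations $\nabla_{[I}F_{JK]}=0$, $g^{JK}(\nabla_JF)_{KI}=0$ on $\mathcal M$ if and only if the following identities hold on $\mathcal M$: \begin{align*} \slashed\nabla_3\widehat\sigma&=\tfrac12\Sigma^2(\slashed\varepsilon\cdot\underline\chi)(\mathrm{tr}\underline\chi)\,\slashed{\mathrm{div}}\,\underline\alpha-\tfrac14\Sigma^2[(\mathrm{tr}\underline\chi)^2-(\slashed\varepsilon\cdot\underline\chi)^2]\,\slashed{\mathrm{curl}}\,\underline\alpha,\\ \slashed\nabla_3\widehat\rho&=-\tfrac14\Sigma^2[(\mathrm{tr}\underline\chi)^2-(\slashed\varepsilon\cdot\underline\chi)^2]\,\slashed{\mathrm{div}}\,\underline\alpha-\tfrac12\Sigma^2(\slashed\varepsilon\cdot\underline\chi)(\mathrm{tr}\underline\chi)\,\slashed{\mathrm{curl}}\,\underline\alpha,\\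 \slashed\nabla_4\widehat\sigma&=-\tfrac12\Sigma(\slashed\varepsilon\cdot\underline\chi)(\mathrm{tr}\underline\chi)\,\slashed{\mathrm{div}}(\Sigma\alpha)-\tfrac14\Sigma[(\mathrm{tr}\underline\chi)^2-(\slashed\varepsilon\cdot\underline\chi)^2]\,\slashed{\mathrm{curl}}(\Sigma\alpha),\\ \slashed\nabla_4\widehat\rho&=\tfrac14\Sigma[(\mathrm{tr}\underline\chi)^2-(\slashed\varepsilon\cdot\underline\chi)^2]\,\slashed{\mathrm{div}}(\Sigma\alpha)-\tfrac12\Sigma(\slashed\varepsilon\cdot\underline\chi)(\mathrm{tr}\underline\chi)\,\slashed{\mathrm{curl}}(\Sigma\alpha),\\ \slashed\nabla\widehat\sigma&=-\tfrac12\Sigma(\slashed\varepsilon\cdot\underline\chi)(\mathrm{tr}\underline\chi)\,(\mathfrak T(\alpha)-\underline{\mathfrak T}(\underline\alpha))-\tfrac14\Sigma[(\mathrm{tr}\underline\chi)^2-(\slashed\varepsilon\cdot\underline\chi)^2]\,({}^\star\mathfrak T(\alpha)+{}^\star\underline{\mathfrak T}(\underline\alpha)),\\ \slashed\nabla\widehat\rho&=\tfrac14\Sigma[(\mathrm{tr}\underline\chi)^2-(\slashed\varepsilon\cdot\underline\chi)^2]\,(\mathfrak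 T(\alpha)-\underline{\mathfrak T}(\underline\alpha))-\tfrac12\Sigma(\slashed\varepsilon\cdot\underline\chi)(\mathrm{tr}\underline\chi)\,({}^\star\mathfrak T(\alpha)+{}^\star\underline{\mathfrak T}(\underline\alpha)). \end{align*} In particular, all first derivatives of $\widehat\rho$ and of $\widehat\sigma$ are given solely by $\alpha$, $\underline\alpha$ and their first derivatives, and the equations for $\widehat\rho$ and for $\widehat\sigma$ are decoupled from each other. -/

import Mathlib

open scoped ContDiff

/-! The Kerr exterior `ℝ × [r₊, ∞) × S²` is covered by the single global chart
`(t̄, r̄, ω) ↦ (t̄, x) = (t̄, r̄ ω) ∈ ℝ × ℝ³`, with image `{(t̄, x) : r₊ ≤ |x|}`; here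
`(t̄, r̄, θ̄, φ̄)` are (ingoing) Kerr coordinates. All tensors are written through their components
in this chart, which is regular on the axis and at the event horizon. Tensors over the horizontal
distribution `𝔇 = ⟨e₃, e₄⟩^⊥` are represented by their canonical extensions to spacetime tensors,
which vanish as soon as `e₃` or `e₄` is inserted in one of the slots. -/

noncomputable section

namespace Kerr

/-- A point `(t̄, x¹, x², x³)`. -/
abbrev Point := Fin 4 → ℝ

/-- Components, in the global chart, of a field of vectors or covectors. -/
abbrev Field₁ := Point → Fin 4 → ℝ

/-- Components, in the global chart, of a field of two-tensors. -/
abbrev Field₂ := Point → Matrix (Fin 4) (Fin 4) ℝ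

/-! ### The Kerr exterior manifold -/

/-- The radial coordinate `r = |x|`. -/
def rad (p : Point) : ℝ := √(p 1 ^ 2 + p 2 ^ 2 + p 3 ^ 2)

/-- The function `cos θ`. -/
def cosθ (p : Point) : ℝ := p 3 / rad p

/-- The radius of the event horizon. -/
def rPlus (M a : ℝ) : ℝ := M + √(M ^ 2 - a ^ 2)

/-- The constant `r₋`. -/
def rMinus (M a : ℝ) : ℝ := M - √(M ^ 2 - a ^ 2)

/-- The function `Δ`. -/
def Del (M a : ℝ) (p : Point) : ℝ := (rad p - rPlus M a) * (rad p - rMinus M a)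

/-- The function `Σ = r² + a² cos² θ`. -/
def Sig (a : ℝ) (p : Point) : ℝ := rad p ^ 2 + a ^ 2 * cosθ p ^ 2

/-- The Kerr exterior, including its boundary, the event horizon. -/
def exterior (M a : ℝ) : Set Point := {p | rPlus M a ≤ rad p}

/-- The one-form `dt̄`. -/
def dt : Field₁ := fun _ => ![1, 0, 0, 0]

/-- The one-form `dr`. -/
def dr : Field₁ := fun p => ![0, p 1 / rad p, p 2 / rad p, p 3 / rad p]

/-- The one-form `sin² θ dφ̄`. -/
def sinSqdφ : Field₁ := fun p => ![0, -p 2 / rad p ^ 2, p 1 / rad p ^ 2, 0]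

/-- The round metric `dθ² + sin² θ dφ̄²` of the unit sphere, which is `(|dx|² - dr²) / r²`. -/
def roundMetric : Field₂ := fun p =>
  Matrix.of fun μ ν => ((if μ = ν ∧ μ ≠ 0 then 1 else 0) - dr p μ * dr p ν) / rad p ^ 2

/-- The Kerr metric. In Kerr coordinates it is
`-(1 - 2Mr/Σ) dt² + 2 dt dr + Σ dθ² + ((r²+a²)² - Δ a² sin²θ)/Σ sin²θ dφ² - 2a sin²θ dr dφ
  - 4aMr/Σ sin²θ dt dφ`, see `metric_kerr_coordinates`. -/
def metric (M a : ℝ) : Field₂ := fun p => Matrix.of fun μ ν =>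
  -(1 - 2 * M * rad p / Sig a p) * (dt p μ * dt p ν)
    + (dt p μ * dr p ν + dr p μ * dt p ν)
    + Sig a p * roundMetric p μ ν
    + a ^ 2 * (1 + 2 * M * rad p / Sig a p) * (sinSqdφ p μ * sinSqdφ p ν)
    - a * (dr p μ * sinSqdφ p ν + sinSqdφ p μ * dr p ν)
    - 2 * a * M * rad p / Sig a p * (dt p μ * sinSqdφ p ν + sinSqdφ p μ * dt p ν)

/-- The point with Kerr coordinates `(t, r, θ, φ)`. -/
def kerrPoint (t r θ φ : ℝ) : Point :=
  ![t, r * Real.sin θ * Real.cos φ, r * Real.sin θ * Real.sin φ, r * Real.cos θ]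

/-- The vector `t' ∂_t + r' ∂_r + θ' ∂_θ + φ' ∂_φ` at the point with coordinates `(t, r, θ, φ)`. -/
def kerrVector (r θ φ t' r' θ' φ' : ℝ) : Fin 4 → ℝ :=
  ![t',
    r' * Real.sin θ * Real.cos φ + θ' * r * Real.cos θ * Real.cos φ
      - φ' * r * Real.sin θ * Real.sin φ,
    r' * Real.sin θ * Real.sin φ + θ' * r * Real.cos θ * Real.sin φ
      + φ' * r * Real.sin θ * Real.cos φ,
    r' * Real.cos θ - θ' * r * Real.sin θ]

/-- The metric in Kerr coordinates. -/
theorem metric_kerr_coordinates (M a t r θ φ t' r' θ' φ' : ℝ) (ha : |a| ≤ M) (hr : 0 < r) :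
    (∑ μ, ∑ ν, metric M a (kerrPoint t r θ φ) μ ν
        * kerrVector r θ φ t' r' θ' φ' μ * kerrVector r θ φ t' r' θ' φ' ν) =
      -(1 - 2 * M * r / (r ^ 2 + a ^ 2 * Real.cos θ ^ 2)) * t' ^ 2 + 2 * t' * r'
        + (r ^ 2 + a ^ 2 * Real.cos θ ^ 2) * θ' ^ 2
        + ((r ^ 2 + a ^ 2) ^ 2
              - (r - rPlus M a) * (r - rMinus M a) * a ^ 2 * Real.sin θ ^ 2)
            / (r ^ 2 + a ^ 2 * Real.cos θ ^ 2) * Real.sin θ ^ 2 * φ' ^ 2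
        - 2 * a * Real.sin θ ^ 2 * r' * φ'
        - 4 * a * M * r / (r ^ 2 + a ^ 2 * Real.cos θ ^ 2) * Real.sin θ ^ 2 * t' * φ' := by
  have hrad : rad (kerrPoint t r θ φ) = r := by
    have h : (r * Real.sin θ * Real.cos φ) ^ 2 + (r * Real.sin θ * Real.sin φ) ^ 2
        + (r * Real.cos θ) ^ 2 = r ^ 2 := by
      linear_combination (r ^ 2 * Real.sin θ ^ 2) * Real.sin_sq_add_cos_sq φ
        + r ^ 2 * Real.sin_sq_add_cos_sq θ
    simp only [rad, kerrPoint, Matrix.cons_val]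
    rw [h, Real.sqrt_sq hr.le]
  have hcos : cosθ (kerrPoint t r θ φ) = Real.cos θ := by
    rw [cosθ, hrad]
    simp only [kerrPoint, Matrix.cons_val]
    field_simp
  have hD : (r - rPlus M a) * (r - rMinus M a) = r ^ 2 - 2 * M * r + a ^ 2 := by
    have h0 : 0 ≤ M ^ 2 - a ^ 2 := by nlinarith [abs_nonneg a, sq_abs a]
    have := Real.sq_sqrt h0
    simp only [rPlus, rMinus]
    linear_combination -this
  have hS : Sig a (kerrPoint t r θ φ) = r ^ 2 + a ^ 2 * Real.cos θ ^ 2 := by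
    rw [Sig, hrad, hcos]
  have hS0 : 0 < r ^ 2 + a ^ 2 * Real.cos θ ^ 2 := by positivity
  set S := r ^ 2 + a ^ 2 * Real.cos θ ^ 2 with hSdef
  set V := kerrVector r θ φ t' r' θ' φ' with hV
  have hr0 : r ≠ 0 := hr.ne'
  have s1 := Real.sin_sq_add_cos_sq θ
  have s2 := Real.sin_sq_add_cos_sq φ
  have d1 : ∑ μ, dt (kerrPoint t r θ φ) μ * V μ = t' := by
    simp [Fin.sum_univ_four, dt, hV, kerrVector]
  have d2 : ∑ μ, dr (kerrPoint t r θ φ) μ * V μ = r' := by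
    simp only [dr, hrad]
    simp only [Fin.sum_univ_four, hV, kerrVector, kerrPoint, Matrix.cons_val]
    field_simp
    linear_combination (r' * Real.sin θ ^ 2 + θ' * r * Real.sin θ * Real.cos θ) * s2 + r' * s1
  have d3 : ∑ μ, sinSqdφ (kerrPoint t r θ φ) μ * V μ = Real.sin θ ^ 2 * φ' := by
    simp only [sinSqdφ, hrad]
    simp only [Fin.sum_univ_four, hV, kerrVector, kerrPoint, Matrix.cons_val]
    field_simp
    linear_combination (r * φ' * Real.sin θ ^ 2) * s2
  have d4 : V 1 ^ 2 + V 2 ^ 2 + V 3 ^ 2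
      = r' ^ 2 + r ^ 2 * θ' ^ 2 + r ^ 2 * Real.sin θ ^ 2 * φ' ^ 2 := by
    simp only [hV, kerrVector, Matrix.cons_val]
    linear_combination ((r' * Real.sin θ + θ' * r * Real.cos θ) ^ 2
      + φ' ^ 2 * r ^ 2 * Real.sin θ ^ 2) * s2 + (r' ^ 2 + θ' ^ 2 * r ^ 2) * s1
  have key : (∑ μ, ∑ ν, metric M a (kerrPoint t r θ φ) μ ν * V μ * V ν) =
      -(1 - 2 * M * r / S) * (∑ μ, dt (kerrPoint t r θ φ) μ * V μ) ^ 2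
      + 2 * (∑ μ, dt (kerrPoint t r θ φ) μ * V μ) * (∑ μ, dr (kerrPoint t r θ φ) μ * V μ)
      + S * ((V 1 ^ 2 + V 2 ^ 2 + V 3 ^ 2
          - (∑ μ, dr (kerrPoint t r θ φ) μ * V μ) ^ 2) / r ^ 2)
      + a ^ 2 * (1 + 2 * M * r / S) * (∑ μ, sinSqdφ (kerrPoint t r θ φ) μ * V μ) ^ 2
      - 2 * a * (∑ μ, dr (kerrPoint t r θ φ) μ * V μ)
        * (∑ μ, sinSqdφ (kerrPoint t r θ φ) μ * V μ)
      - 4 * a * M * r / S * (∑ μ, dt (kerrPoint t r θ φ) μ * V μ)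
        * (∑ μ, sinSqdφ (kerrPoint t r θ φ) μ * V μ) := by
    simp only [metric, roundMetric, Matrix.of_apply, hrad, hS, Fin.sum_univ_four]
    simp
    ring
  rw [key, d1, d2, d3, d4, hD]
  have hsin : Real.sin θ ^ 2 = 1 - Real.cos θ ^ 2 := by linear_combination s1
  rw [hsin]
  clear_value V
  clear key d1 d2 d3 d4 hsin
  field_simp
  rw [hSdef]
  ring

/-- Lowering an index with the metric. -/
def lower (M a : ℝ) (X : Field₁) : Field₁ := fun p μ => ∑ ν, metric M a p μ ν * X p ν

/-- The inverse metric. -/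
def metricInv (M a : ℝ) : Field₂ := fun p => (metric M a p)⁻¹

/-- The partial derivative `∂_μ f` on the exterior (one-sided at the event horizon). -/
def pd (M a : ℝ) (f : Point → ℝ) (μ : Fin 4) (p : Point) : ℝ :=
  fderivWithin ℝ f (exterior M a) p (Pi.single μ 1)

/-! ### The Levi-Civita connection -/

/-- The Christoffel symbol `Γ^κ_{μν}` of the Kerr metric. -/
def christoffel (M a : ℝ) (p : Point) (κ μ ν : Fin 4) : ℝ :=
  1 / 2 * ∑ l, metricInv M a p κ l *
    (pd M a (fun q => metric M a q l ν) μ p + pd M a (fun q => metric M a q l μ) ν p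
      - pd M a (fun q => metric M a q μ ν) l p)

/-- The component `(∇_μ Y)^ν` for a vector field `Y`. -/
def covVector (M a : ℝ) (Y : Field₁) (p : Point) (μ ν : Fin 4) : ℝ :=
  pd M a (fun q => Y q ν) μ p + ∑ κ, christoffel M a p ν μ κ * Y p κ

/-- The component `(∇_μ ς)_ν` for a one-form `ς`. -/
def covForm (M a : ℝ) (s : Field₁) (p : Point) (μ ν : Fin 4) : ℝ :=
  pd M a (fun q => s q ν) μ p - ∑ κ, christoffel M a p κ μ ν * s p κ

/-- The component `(∇_μ F)_{νl}` for a covariant two-tensor `F`. -/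
def covTwo (M a : ℝ) (F : Field₂) (p : Point) (μ ν l : Fin 4) : ℝ :=
  pd M a (fun q => F q ν l) μ p
    - ∑ κ, (christoffel M a p κ μ ν * F p κ l + christoffel M a p κ μ l * F p ν κ)

/-! ### The algebraically special frame and the horizontal distribution -/

/-- The null vector field `e₃`. In Boyer–Lindquist coordinates it is
`(r²+a²)/Δ ∂_t - ∂_r + a/Δ ∂_φ`; since the Boyer–Lindquist `∂_r` is
`∂_r̄ + (r²+a²)/Δ ∂_t̄ + a/Δ ∂_φ̄` in Kerr coordinates, this is `-∂_r̄`. -/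
def e3 : Field₁ := fun p => ![0, -(p 1 / rad p), -(p 2 / rad p), -(p 3 / rad p)]

/-- The null vector field `e₄`. In Boyer–Lindquist coordinates it is
`(r²+a²)/Σ ∂_t + Δ/Σ ∂_r + a/Σ ∂_φ`, hence
`2(r²+a²)/Σ ∂_t̄ + Δ/Σ ∂_r̄ + 2a/Σ ∂_φ̄` in Kerr coordinates. -/
def e4 (M a : ℝ) : Field₁ := fun p =>
  (2 * (rad p ^ 2 + a ^ 2) / Sig a p) • ![1, 0, 0, 0]
    + (Del M a p / Sig a p) • ![0, p 1 / rad p, p 2 / rad p, p 3 / rad p]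
    + (2 * a / Sig a p) • ![0, -p 2, p 1, 0]

/-- The `g`-orthogonal projection `X ↦ X + ½ g(X, e₄) e₃ + ½ g(X, e₃) e₄` onto the horizontal
distribution; `proj M a p μ ν` has upper index `μ` and lower index `ν`. -/
def proj (M a : ℝ) : Field₂ := fun p => Matrix.of fun μ ν =>
  (if μ = ν then 1 else 0)
    + 1 / 2 * (e3 p μ * lower M a (e4 M a) p ν + e4 M a p μ * lower M a e3 p ν)

/-- The inverse induced metric on the horizontal distribution, with upper indices. -/
def hInv (M a : ℝ) : Field₂ := fun p => Matrix.of fun μ ν =>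
  metricInv M a p μ ν + 1 / 2 * (e3 p μ * e4 M a p ν + e4 M a p μ * e3 p ν)

/-- The horizontal volume form `ε(X, Y) = ½ vol_g(X, Y, e₃, e₄)`, where `vol_g` is the volume form
of the Kerr metric for the orientation `dt̄ ∧ dx¹ ∧ dx² ∧ dx³`; lower indices. -/
def hVol (M a : ℝ) : Field₂ := fun p => Matrix.of fun μ ν =>
  1 / 2 * (√|(metric M a p).det| *
    (Matrix.of ![Pi.single μ 1, Pi.single ν 1, e3 p, e4 M a p]).det)

/-- The horizontal volume form with upper indices. -/
def hVolUp (M a : ℝ) : Field₂ := fun p => Matrix.of fun μ ν =>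
  ∑ κ, ∑ l, hInv M a p μ κ * hInv M a p ν l * hVol M a p κ l

/-! ### Connection coefficients -/

/-- The second fundamental form `(X, Y) ↦ g(∇_X e, Y)`, with `X`, `Y` horizontal. -/
def secondForm (M a : ℝ) (e : Field₁) : Field₂ := fun p => Matrix.of fun μ ν =>
  ∑ κ, ∑ l, ∑ i, proj M a p κ μ * proj M a p l ν * metric M a p l i * covVector M a e p κ i

/-- `χ(X, Y) = g(∇_X e₄, Y)`. -/
def chi (M a : ℝ) : Field₂ := secondForm M a (e4 M a)

/-- `χ̲(X, Y) = g(∇_X e₃, Y)`. -/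
def chiBar (M a : ℝ) : Field₂ := secondForm M a e3

/-- The trace of a horizontal covariant two-tensor. -/
def hTr (M a : ℝ) (T : Field₂) (p : Point) : ℝ := ∑ μ, ∑ ν, hInv M a p μ ν * T p μ ν

/-- The antitrace `ε · T = ε^{AB} T_{AB}` of a horizontal covariant two-tensor. -/
def hAtr (M a : ℝ) (T : Field₂) (p : Point) : ℝ := ∑ μ, ∑ ν, hVolUp M a p μ ν * T p μ ν

/-- `tr χ̲`. -/
def trChiBar (M a : ℝ) (p : Point) : ℝ := hTr M a (chiBar M a) p

/-- `ε · χ̲`. -/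
def atrChiBar (M a : ℝ) (p : Point) : ℝ := hAtr M a (chiBar M a) p

/-- `ω̂ = ½ g(∇_{e₄} e₃, e₄)`. -/
def omegaHat (M a : ℝ) (p : Point) : ℝ :=
  1 / 2 * ∑ μ, ∑ ν, e4 M a p μ * covVector M a e3 p μ ν * lower M a (e4 M a) p ν

/-! ### Horizontal operators -/

/-- The derivative of a scalar function along a vector field. -/
def along (M a : ℝ) (e : Field₁) (f : Point → ℝ) (p : Point) : ℝ := ∑ μ, e p μ * pd M a f μ p

/-- The horizontal gradient of a scalar function. -/
def hGrad (M a : ℝ) (f : Point → ℝ) : Field₁ := fun p ν => ∑ μ, proj M a p μ ν * pd M a f μ p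

/-- The induced connection on horizontal one-forms: the component along `ν` of the horizontal part
of `∇_μ ς`. -/
def hCov (M a : ℝ) (s : Field₁) : Field₂ := fun p => Matrix.of fun μ ν =>
  ∑ l, proj M a p l ν * covForm M a s p μ l

/-- The induced connection on horizontal one-forms along a vector field. -/
def hCovAlong (M a : ℝ) (e : Field₁) (s : Field₁) : Field₁ := fun p ν =>
  ∑ μ, e p μ * hCov M a s p μ ν

/-- The horizontal divergence of a horizontal one-form. -/
def hDiv (M a : ℝ) (s : Field₁) (p : Point) : ℝ := hTr M a (hCov M a s) p

/-- The horizontal curl of a horizontal one-form. -/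
def hCurl (M a : ℝ) (s : Field₁) (p : Point) : ℝ := hAtr M a (hCov M a s) p

/-- The horizontal Hodge dual `(⋆ς)_A = ε_{AC} g^{CB} ς_B`. -/
def hStar (M a : ℝ) (s : Field₁) : Field₁ := fun p ν =>
  ∑ l, ∑ κ, hVol M a p ν l * hInv M a p l κ * s p κ

/-- The product `(T^{♯₂} · ς)_A = g^{BC} T_{AC} ς_B`. -/
def sharpDot (M a : ℝ) (T : Field₂) (s : Field₁) : Field₁ := fun p μ =>
  ∑ κ, ∑ l, hInv M a p κ l * T p μ l * s p κ

/-! ### Maxwell fields -/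

/-- A smooth two-form on the Kerr exterior. -/
def IsTwoForm (M a : ℝ) (F : Field₂) : Prop :=
  (∀ μ ν, ContDiffOn ℝ ∞ (fun p => F p μ ν) (exterior M a)) ∧
    ∀ p ∈ exterior M a, ∀ μ ν, F p μ ν = -F p ν μ

/-- The source-free Maxwell equations on the Kerr exterior. -/
def IsMaxwell (M a : ℝ) (F : Field₂) : Prop :=
  ∀ p ∈ exterior M a,
    (∀ i j k, covTwo M a F p i j k + covTwo M a F p j k i + covTwo M a F p k i j = 0) ∧
    ∀ i, ∑ j, ∑ k, metricInv M a p j k * covTwo M a F p j k i = 0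

/-- `α(X) = F(X, e₄)` for horizontal `X`. -/
def alpha (M a : ℝ) (F : Field₂) : Field₁ := fun p ν =>
  ∑ μ, ∑ l, proj M a p μ ν * F p μ l * e4 M a p l

/-- `α̲(X) = F(X, e₃)` for horizontal `X`. -/
def alphaBar (M a : ℝ) (F : Field₂) : Field₁ := fun p ν =>
  ∑ μ, ∑ l, proj M a p μ ν * F p μ l * e3 p l

/-- `ρ = ½ F(e₃, e₄)`. -/
def rho (M a : ℝ) (F : Field₂) (p : Point) : ℝ :=
  1 / 2 * ∑ μ, ∑ ν, F p μ ν * e3 p μ * e4 M a p ν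

/-- `σ = ½ ε^{AB} F_{AB}`. -/
def sigma (M a : ℝ) (F : Field₂) (p : Point) : ℝ := 1 / 2 * hAtr M a F p

/-- `ρ̂ = (r² - a² cos² θ) ρ - 2 a r cos θ σ`. -/
def rhoHat (M a : ℝ) (F : Field₂) (p : Point) : ℝ :=
  (rad p ^ 2 - a ^ 2 * cosθ p ^ 2) * rho M a F p - 2 * a * rad p * cosθ p * sigma M a F p

/-- `σ̂ = 2 a r cos θ ρ + (r² - a² cos² θ) σ`. -/
def sigmaHat (M a : ℝ) (F : Field₂) (p : Point) : ℝ :=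
  2 * a * rad p * cosθ p * rho M a F p + (rad p ^ 2 - a ^ 2 * cosθ p ^ 2) * sigma M a F p

/-- `𝔗(α) = ½ Σ (∇₃ α + χ̲^{♯₂} · α)`. -/
def frakT (M a : ℝ) (s : Field₁) : Field₁ := fun p ν =>
  1 / 2 * Sig a p * (hCovAlong M a e3 s p ν + sharpDot M a (chiBar M a) s p ν)

/-- `𝔗̲(α̲) = ½ Σ (∇₄ α̲ + χ^{♯₂} · α̲ + ω̂ α̲)`. -/
def frakTBar (M a : ℝ) (s : Field₁) : Field₁ := fun p ν =>
  1 / 2 * Sig a p * (hCovAlong M a (e4 M a) s p ν + sharpDot M a (chi M a) s p ν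
    + omegaHat M a p * s p ν)

end Kerr

end

open Kerr

/-! Put ζ = r + i a cos θ, so |ζ|² = Σ. By definition ρ̂ + iσ̂ = ζ²(ρ + iσ). The second fundamental
form of e₃ has tr χ̲ = -2r/Σ and ε·χ̲ = 2a cos θ/Σ, hence ζ = -½Σ(tr χ̲ - i ε·χ̲). The coefficients
in the statement are therefore the real and imaginary parts of ζ², up to signs and powers of Σ
(`trChiBar_sq_sub`, `atrChiBar_mul`). This settles the two algebraic identities.

For the equivalence, fix a point and a null frame e₃, e₄, X, Y. The Maxwell equations become four
cyclic and four divergence equations (`maxwell_iff`), which pair up into four complex ones. Each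
contains the derivative of ρ + iσ along one frame vector, a first-order term in α and α̲, and a
multiple of ρ + iσ (`maxwell_components`). In Kerr this multiple is exactly the logarithmic
derivative of ζ² along that frame vector, so multiplication by ζ² absorbs it and leaves the
derivative of ρ̂ + iσ̂. As ζ ≠ 0, the multiplication can be undone (`rotation_eq_zero`), which gives
both directions at once (`along_e3_iff`, `along_e4_iff`, `hGrad_iff`).

The sphere carries no continuous tangent frame, so X and Y are merely vectors at one point. Only
globally defined fields are differentiated: e₃, e₄, α, α̲, ρ, σ and the horizontal volume form, from
which F is rebuilt (`decompose`, `cov₂_eq`). The connection coefficients come without expanding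
Christoffel symbols: their antisymmetric parts are exterior derivatives of the lowered null vectors,
their symmetric parts are Lie derivatives of the metric, and the bracket [e₃, e₄] supplies the rest.
-/

namespace Kerr

variable {M a : ℝ} {p : Point} {X Y U V : Fin 4 → ℝ} {F : Field₂} {e s : Field₁}

/-! ### The exterior as a domain for calculus -/

lemma rPlus_pos (hM : 0 < M) : 0 < rPlus M a := by
  unfold rPlus; positivity

lemma rad_pos (hM : 0 < M) (hp : p ∈ exterior M a) : 0 < rad p :=
  lt_of_lt_of_le (rPlus_pos hM) hp

lemma rad_sq (p : Point) : rad p ^ 2 = p 1 ^ 2 + p 2 ^ 2 + p 3 ^ 2 :=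
  Real.sq_sqrt (by positivity)

/-- The exterior is not convex, but it contains the half-space bounded by the hyperplane tangent at
p to the cylinder of radius |p|: if p·q ≥ |p|², then 0 ≤ |q - p|² gives |q| ≥ |p|. Uniqueness of
one-sided derivatives is inherited from this convex subset. It covers the horizon and interior
points alike. -/
lemma uniqueDiffWithinAt_exterior (hM : 0 < M) (hp : p ∈ exterior M a) :
    UniqueDiffWithinAt ℝ (exterior M a) p := by
  have hr := rad_pos hM hp
  let L : Point →L[ℝ] ℝ := p 1 • ContinuousLinearMap.proj 1 + p 2 • ContinuousLinearMap.proj 2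
    + p 3 • ContinuousLinearMap.proj 3
  have hL : ∀ q : Point, L q = p 1 * q 1 + p 2 * q 2 + p 3 * q 3 := fun q => by simp [L]
  have hLp : L p = rad p ^ 2 := by rw [hL, rad_sq]; ring
  have hsub : {q | L p ≤ L q} ⊆ exterior M a := by
    intro q hq
    refine le_trans hp (Real.sqrt_le_sqrt ?_)
    have h : L p ≤ L q := hq
    rw [hL, hL] at h
    nlinarith [sq_nonneg (q 1 - p 1), sq_nonneg (q 2 - p 2), sq_nonneg (q 3 - p 3)]
  refine UniqueDiffWithinAt.mono (uniqueDiffWithinAt_convex ?_ ?_ ?_) hsub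
  · exact convex_halfSpace_ge L.toLinearMap.isLinear _
  · refine ⟨(2 : ℝ) • p, mem_interior.2 ⟨{q | L p < L q}, fun q (hq : L p < L q) => hq.le,
      isOpen_lt continuous_const L.continuous, ?_⟩⟩
    have : 0 < L p := by rw [hLp]; positivity
    simp only [Set.mem_ofPred_eq, map_smul, smul_eq_mul]
    linarith
  · exact subset_closure (le_refl (L p))

/-- The derivative at `p` of a function on the exterior, in the direction `Z`. -/
noncomputable def der (M a : ℝ) (p : Point) (f : Point → ℝ) (Z : Fin 4 → ℝ) : ℝ :=
  fderivWithin ℝ f (exterior M a) p Z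

/-- Differentiability at `p` of a function on the exterior. -/
def DiffAt (M a : ℝ) (p : Point) (f : Point → ℝ) : Prop :=
  DifferentiableWithinAt ℝ f (exterior M a) p

lemma sum_mul_pd (f : Point → ℝ) (Z : Fin 4 → ℝ) :
    ∑ μ, Z μ * pd M a f μ p = der M a p f Z := by
  have h := (fderivWithin ℝ f (exterior M a) p).toLinearMap.pi_apply_eq_sum_univ Z
  simp only [ContinuousLinearMap.coe_coe, smul_eq_mul] at h
  rw [der, h]
  refine Finset.sum_congr rfl fun μ _ => ?_
  rw [pd]
  congr 2
  ext ν
  simp [Pi.single_apply, eq_comm]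

lemma der_congr {f g : Point → ℝ} (h : ∀ q ∈ exterior M a, f q = g q) (hp : p ∈ exterior M a)
    (Z : Fin 4 → ℝ) : der M a p f Z = der M a p g Z := by
  rw [der, fderivWithin_congr h (h p hp), der]

lemma DiffAt.congr {f g : Point → ℝ} (hf : DiffAt M a p f)
    (h : ∀ q ∈ exterior M a, g q = f q) (hp : p ∈ exterior M a) : DiffAt M a p g :=
  DifferentiableWithinAt.congr hf h (h p hp)

lemma diffAt_const (c : ℝ) : DiffAt M a p fun _ => c := differentiableWithinAt_const c

lemma diffAt_coord (μ : Fin 4) : DiffAt M a p fun q => q μ :=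
  (ContinuousLinearMap.proj (R := ℝ) (φ := fun _ : Fin 4 => ℝ) μ).differentiableWithinAt

lemma DiffAt.add {f g : Point → ℝ} (hf : DiffAt M a p f) (hg : DiffAt M a p g) :
    DiffAt M a p fun q => f q + g q := DifferentiableWithinAt.add hf hg

lemma DiffAt.sub {f g : Point → ℝ} (hf : DiffAt M a p f) (hg : DiffAt M a p g) :
    DiffAt M a p fun q => f q - g q := DifferentiableWithinAt.sub hf hg

lemma DiffAt.neg {f : Point → ℝ} (hf : DiffAt M a p f) :
    DiffAt M a p fun q => -f q := DifferentiableWithinAt.neg hf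

lemma DiffAt.mul {f g : Point → ℝ} (hf : DiffAt M a p f) (hg : DiffAt M a p g) :
    DiffAt M a p fun q => f q * g q := DifferentiableWithinAt.mul hf hg

lemma DiffAt.div {f g : Point → ℝ} (hf : DiffAt M a p f) (hg : DiffAt M a p g) (h : g p ≠ 0) :
    DiffAt M a p fun q => f q / g q := by
  simp only [div_eq_mul_inv]
  exact hf.mul (DifferentiableWithinAt.inv hg h)

lemma DiffAt.pow {f : Point → ℝ} (hf : DiffAt M a p f) (n : ℕ) :
    DiffAt M a p fun q => f q ^ n := DifferentiableWithinAt.pow hf n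

lemma DiffAt.sum {ι : Type*} {s : Finset ι} {f : ι → Point → ℝ}
    (hf : ∀ i ∈ s, DiffAt M a p (f i)) : DiffAt M a p fun q => ∑ i ∈ s, f i q :=
  DifferentiableWithinAt.fun_sum hf

lemma DiffAt.prod {ι : Type*} {s : Finset ι} {f : ι → Point → ℝ}
    (hf : ∀ i ∈ s, DiffAt M a p (f i)) : DiffAt M a p fun q => ∏ i ∈ s, f i q := by
  classical
  induction s using Finset.induction_on with
  | empty => simpa using diffAt_const 1
  | insert i s hi ih =>
    simp only [Finset.prod_insert hi]
    exact (hf i (Finset.mem_insert_self i s)).mul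
      (ih fun j hj => hf j (Finset.mem_insert_of_mem hj))

lemma DiffAt.dot {s t : Field₁} (hs : ∀ ν, DiffAt M a p fun q => s q ν)
    (ht : ∀ ν, DiffAt M a p fun q => t q ν) : DiffAt M a p fun q => s q ⬝ᵥ t q :=
  DiffAt.sum fun ν _ => (hs ν).mul (ht ν)

lemma DiffAt.dot_const {s : Field₁} (hs : ∀ ν, DiffAt M a p fun q => s q ν) (V : Fin 4 → ℝ) :
    DiffAt M a p fun q => s q ⬝ᵥ V := DiffAt.dot hs fun _ => diffAt_const _

/-! ### Rules for directional derivatives on the exterior. -/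

variable {f g : Point → ℝ}

lemma der_const (Z : Fin 4 → ℝ) (c : ℝ) : der M a p (fun _ => c) Z = 0 := by
  simp [der]

lemma der_coord (hu : UniqueDiffWithinAt ℝ (exterior M a) p) (Z : Fin 4 → ℝ) (μ : Fin 4) :
    der M a p (fun q => q μ) Z = Z μ := by
  exact congrArg (fun L : Point →L[ℝ] ℝ => L Z)
    ((ContinuousLinearMap.proj (R := ℝ) (φ := fun _ : Fin 4 => ℝ) μ).fderivWithin hu)

lemma der_add (hu : UniqueDiffWithinAt ℝ (exterior M a) p) (Z : Fin 4 → ℝ) (hf : DiffAt M a p f)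
    (hg : DiffAt M a p g) :
    der M a p (fun q => f q + g q) Z = der M a p f Z + der M a p g Z := by
  rw [der, fderivWithin_fun_add hu hf hg]; rfl

lemma der_sub (hu : UniqueDiffWithinAt ℝ (exterior M a) p) (Z : Fin 4 → ℝ) (hf : DiffAt M a p f)
    (hg : DiffAt M a p g) :
    der M a p (fun q => f q - g q) Z = der M a p f Z - der M a p g Z := by
  rw [der, fderivWithin_fun_sub hu hf hg]; rfl

lemma der_neg (hu : UniqueDiffWithinAt ℝ (exterior M a) p) (Z : Fin 4 → ℝ) :
    der M a p (fun q => -f q) Z = -der M a p f Z := by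
  rw [der, fderivWithin_fun_neg hu]; rfl

lemma der_mul (hu : UniqueDiffWithinAt ℝ (exterior M a) p) (Z : Fin 4 → ℝ) (hf : DiffAt M a p f)
    (hg : DiffAt M a p g) :
    der M a p (fun q => f q * g q) Z = f p * der M a p g Z + g p * der M a p f Z := by
  rw [der, fderivWithin_fun_mul hu hf hg]; rfl

lemma der_const_mul (hu : UniqueDiffWithinAt ℝ (exterior M a) p) (Z : Fin 4 → ℝ) (c : ℝ)
    (hf : DiffAt M a p f) :
    der M a p (fun q => c * f q) Z = c * der M a p f Z := by
  rw [der_mul hu Z (diffAt_const c) hf, der_const]; ring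

lemma der_sq (hu : UniqueDiffWithinAt ℝ (exterior M a) p) (Z : Fin 4 → ℝ) (hf : DiffAt M a p f) :
    der M a p (fun q => f q ^ 2) Z = 2 * f p * der M a p f Z := by
  simp only [pow_two]
  rw [der_mul hu Z hf hf]; ring

lemma der_div (hu : UniqueDiffWithinAt ℝ (exterior M a) p) (Z : Fin 4 → ℝ) (hf : DiffAt M a p f)
    (hg : DiffAt M a p g) (h : g p ≠ 0) :
    der M a p (fun q => f q / g q) Z
      = (der M a p f Z * g p - f p * der M a p g Z) / g p ^ 2 := by
  -- The quotient rule is read off from the product rule for f = (f / g) · g, which is valid near p,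
  -- where g does not vanish.
  have h1 : der M a p f Z = der M a p (fun q => (f q / g q) * g q) Z := by
    have hne : ∀ᶠ q in nhdsWithin p (exterior M a), g q ≠ 0 :=
      (DifferentiableWithinAt.continuousWithinAt hg).eventually_ne h
    rw [der, der]
    congr 1
    refine Filter.EventuallyEq.fderivWithin_eq ?_ ?_
    · filter_upwards [hne] with q hq
      field_simp
    · field_simp
  rw [h1, der_mul hu Z (hf.div hg h) hg]
  field_simp
  ring

lemma der_sum (hu : UniqueDiffWithinAt ℝ (exterior M a) p) (Z : Fin 4 → ℝ)
    {ι : Type*} {s : Finset ι} {f : ι → Point → ℝ}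
    (hf : ∀ i ∈ s, DiffAt M a p (f i)) :
    der M a p (fun q => ∑ i ∈ s, f i q) Z = ∑ i ∈ s, der M a p (f i) Z := by
  rw [der, fderivWithin_fun_sum hu hf]
  simp [der]

/-- Product rule for the pairing of two fields. -/
lemma der_dot (hu : UniqueDiffWithinAt ℝ (exterior M a) p) (Z : Fin 4 → ℝ)
    {s t : Field₁} (hs : ∀ ν, DiffAt M a p fun q => s q ν)
    (ht : ∀ ν, DiffAt M a p fun q => t q ν) :
    der M a p (fun q => s q ⬝ᵥ t q) Z
      = der M a p (fun q => s q ⬝ᵥ t p) Z + s p ⬝ᵥ fun ν => der M a p (fun q => t q ν) Z := by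
  simp only [dotProduct]
  rw [der_sum hu Z fun ν _ => (hs ν).mul (ht ν),
    der_sum hu Z fun ν _ => (hs ν).mul (diffAt_const _), ← Finset.sum_add_distrib]
  refine Finset.sum_congr rfl fun ν _ => ?_
  rw [der_mul hu Z (hs ν) (ht ν), der_mul hu Z (hs ν) (diffAt_const _), der_const]
  ring

lemma der_dot_const (hu : UniqueDiffWithinAt ℝ (exterior M a) p) (Z : Fin 4 → ℝ)
    {s : Field₁} (hs : ∀ ν, DiffAt M a p fun q => s q ν) (V : Fin 4 → ℝ) :
    der M a p (fun q => s q ⬝ᵥ V) Z = ∑ ν, der M a p (fun q => s q ν) Z * V ν := by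
  simp only [dotProduct]
  rw [der_sum hu Z fun ν _ => (hs ν).mul (diffAt_const _)]
  refine Finset.sum_congr rfl fun ν _ => ?_
  rw [der_mul hu Z (hs ν) (diffAt_const _), der_const]
  ring

/-! ### Scalar functions and one-forms of the Kerr exterior -/

lemma Sig_pos (a : ℝ) (hr : 0 < rad p) : 0 < Sig a p := by
  unfold Sig; positivity

/-- The condition |a| ≤ M enters through r₊r₋ = a²: beyond it the real square root would be
truncated to 0. -/
lemma Del_eq (ha : |a| ≤ M) (p : Point) : Del M a p = rad p ^ 2 - 2 * M * rad p + a ^ 2 := by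
  have h0 : 0 ≤ M ^ 2 - a ^ 2 := by nlinarith [abs_nonneg a, sq_abs a]
  have := Real.sq_sqrt h0
  simp only [Del, rPlus, rMinus]
  linear_combination -this

lemma cosθ_mul_rad (hr : 0 < rad p) : cosθ p * rad p = p 3 := by
  unfold cosθ; field_simp

/-- The one-form `dt̄ - a sin² θ dφ̄`. -/
noncomputable def theta (a : ℝ) : Field₁ := fun p μ => dt p μ - a * sinSqdφ p μ

/-- The differential of `cos θ`. -/
noncomputable def dcos : Field₁ := fun p =>
  ![0, -(p 3 * p 1) / rad p ^ 3, -(p 3 * p 2) / rad p ^ 3, 1 / rad p - p 3 * p 3 / rad p ^ 3]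

lemma dt_dot (V : Fin 4 → ℝ) : dt p ⬝ᵥ V = V 0 := by
  simp [dt, dotProduct, Fin.sum_univ_four]

lemma dr_dot (V : Fin 4 → ℝ) : dr p ⬝ᵥ V = (p 1 * V 1 + p 2 * V 2 + p 3 * V 3) / rad p := by
  simp [dr, dotProduct, Fin.sum_univ_four]; ring

lemma sinSqdφ_dot (V : Fin 4 → ℝ) :
    sinSqdφ p ⬝ᵥ V = (p 1 * V 2 - p 2 * V 1) / rad p ^ 2 := by
  simp [sinSqdφ, dotProduct, Fin.sum_univ_four]; ring

lemma theta_dot (V : Fin 4 → ℝ) : theta a p ⬝ᵥ V = V 0 - a * (sinSqdφ p ⬝ᵥ V) := by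
  simp only [theta, dotProduct, sub_mul, Finset.sum_sub_distrib, mul_assoc, ← Finset.mul_sum]
  rw [← dotProduct, dt_dot]

lemma diffAt_rad (hr : 0 < rad p) : DiffAt M a p rad := by
  have h : p 1 ^ 2 + p 2 ^ 2 + p 3 ^ 2 ≠ 0 := by rw [← rad_sq]; positivity
  exact DifferentiableWithinAt.sqrt
    ((((diffAt_coord 1).pow 2).add ((diffAt_coord 2).pow 2)).add ((diffAt_coord 3).pow 2)) h

lemma der_rad (hu : UniqueDiffWithinAt ℝ (exterior M a) p) (hr : 0 < rad p) (Z : Fin 4 → ℝ) :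
    der M a p rad Z = dr p ⬝ᵥ Z := by
  -- Differentiate r² = x² + y² + z² instead of the square root.
  have h1 := der_sq hu Z (diffAt_rad (M := M) (a := a) hr)
  simp only [rad_sq] at h1
  rw [der_add hu Z (((diffAt_coord 1).pow 2).add ((diffAt_coord 2).pow 2)) ((diffAt_coord 3).pow 2),
    der_add hu Z ((diffAt_coord 1).pow 2) ((diffAt_coord 2).pow 2),
    der_sq hu Z (diffAt_coord 1), der_sq hu Z (diffAt_coord 2), der_sq hu Z (diffAt_coord 3),
    der_coord hu, der_coord hu, der_coord hu] at h1
  rw [dr_dot]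
  field_simp
  linarith

lemma diffAt_cosθ (hr : 0 < rad p) : DiffAt M a p cosθ :=
  (diffAt_coord 3).div (diffAt_rad hr) hr.ne'

lemma dcos_dot (hr : 0 < rad p) (V : Fin 4 → ℝ) :
    dcos p ⬝ᵥ V = V 3 / rad p - p 3 * (dr p ⬝ᵥ V) / rad p ^ 2 := by
  rw [dr_dot]
  simp [dcos, dotProduct, Fin.sum_univ_four]
  field_simp
  ring

lemma der_cosθ (hu : UniqueDiffWithinAt ℝ (exterior M a) p) (hr : 0 < rad p) (Z : Fin 4 → ℝ) :
    der M a p cosθ Z = dcos p ⬝ᵥ Z := by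
  rw [dcos_dot hr]
  unfold cosθ
  rw [der_div hu Z (diffAt_coord 3) (diffAt_rad hr) hr.ne', der_coord hu, der_rad hu hr]
  field_simp

lemma diffAt_Sig (hr : 0 < rad p) : DiffAt M a p (Sig a) :=
  ((diffAt_rad hr).pow 2).add ((diffAt_const (a ^ 2)).mul ((diffAt_cosθ hr).pow 2))

lemma der_Sig (hu : UniqueDiffWithinAt ℝ (exterior M a) p) (hr : 0 < rad p) (Z : Fin 4 → ℝ) :
    der M a p (Sig a) Z
      = 2 * rad p * (dr p ⬝ᵥ Z) + 2 * a ^ 2 * cosθ p * (dcos p ⬝ᵥ Z) := by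
  unfold Sig
  rw [der_add hu Z ((diffAt_rad hr).pow 2) ((diffAt_const (a ^ 2)).mul ((diffAt_cosθ hr).pow 2)),
    der_sq hu Z (diffAt_rad hr), der_const_mul hu Z _ ((diffAt_cosθ hr).pow 2),
    der_sq hu Z (diffAt_cosθ hr), der_rad hu hr, der_cosθ hu hr]
  ring

lemma diffAt_Del (hr : 0 < rad p) : DiffAt M a p (Del M a) :=
  ((diffAt_rad hr).sub (diffAt_const _)).mul ((diffAt_rad hr).sub (diffAt_const _))

/-- The function `Δ / Σ`. -/
noncomputable def quot (M a : ℝ) (p : Point) : ℝ := Del M a p / Sig a p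

lemma diffAt_quot (hr : 0 < rad p) : DiffAt M a p (quot M a) :=
  (diffAt_Del hr).div (diffAt_Sig hr) (Sig_pos a hr).ne'

/-- The partial derivative `∂_r (Δ / Σ)`. -/
noncomputable def quotR (M a : ℝ) (p : Point) : ℝ :=
  (2 * rad p - 2 * M - 2 * rad p * quot M a p) / Sig a p

lemma der_quot (hu : UniqueDiffWithinAt ℝ (exterior M a) p) (hr : 0 < rad p) (Z : Fin 4 → ℝ) :
    der M a p (quot M a) Z = quotR M a p * (dr p ⬝ᵥ Z)
      - 2 * a ^ 2 * cosθ p * quot M a p / Sig a p * (dcos p ⬝ᵥ Z) := by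
  have hS := (Sig_pos a hr).ne'
  have h1 : der M a p (Del M a) Z = (2 * rad p - 2 * M) * (dr p ⬝ᵥ Z) := by
    unfold Del
    rw [der_mul hu Z ((diffAt_rad hr).sub (diffAt_const _)) ((diffAt_rad hr).sub (diffAt_const _)),
      der_sub hu Z (diffAt_rad hr) (diffAt_const _), der_sub hu Z (diffAt_rad hr) (diffAt_const _),
      der_const, der_const, der_rad hu hr, rPlus, rMinus]
    ring
  unfold quotR quot
  rw [der_div hu Z (diffAt_Del hr) (diffAt_Sig hr) hS, h1, der_Sig hu hr]
  field_simp
  ring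

lemma diffAt_dt (μ : Fin 4) : DiffAt M a p fun q => dt q μ := diffAt_const _

lemma diffAt_dr (hr : 0 < rad p) (μ : Fin 4) : DiffAt M a p fun q => dr q μ := by
  fin_cases μ
  · exact diffAt_const _
  · exact (diffAt_coord 1).div (diffAt_rad hr) hr.ne'
  · exact (diffAt_coord 2).div (diffAt_rad hr) hr.ne'
  · exact (diffAt_coord 3).div (diffAt_rad hr) hr.ne'

lemma diffAt_sinSqdφ (hr : 0 < rad p) (μ : Fin 4) : DiffAt M a p fun q => sinSqdφ q μ := by
  have h : rad p ^ 2 ≠ 0 := by positivity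
  fin_cases μ
  · exact diffAt_const _
  · exact (diffAt_coord 2).neg.div ((diffAt_rad hr).pow 2) h
  · exact (diffAt_coord 1).div ((diffAt_rad hr).pow 2) h
  · exact diffAt_const _

lemma diffAt_theta (hr : 0 < rad p) (μ : Fin 4) : DiffAt M a p fun q => theta a q μ :=
  (diffAt_dt μ).sub ((diffAt_const a).mul (diffAt_sinSqdφ hr μ))

lemma diffAt_e3 (hr : 0 < rad p) (μ : Fin 4) : DiffAt M a p fun q => e3 q μ := by
  fin_cases μ
  · exact diffAt_const _
  · exact ((diffAt_coord 1).div (diffAt_rad hr) hr.ne').neg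
  · exact ((diffAt_coord 2).div (diffAt_rad hr) hr.ne').neg
  · exact ((diffAt_coord 3).div (diffAt_rad hr) hr.ne').neg

lemma e3_eq (p : Point) (μ : Fin 4) : e3 p μ = -dr p μ := by
  fin_cases μ <;> simp [e3, dr]

/-- The axial Killing field `∂_φ̄`. -/
def axial : Field₁ := fun p => ![0, -p 2, p 1, 0]

lemma e4_eq (p : Point) (μ : Fin 4) : e4 M a p μ =
    2 * (rad p ^ 2 + a ^ 2) / Sig a p * dt p μ + quot M a p * dr p μ
      + 2 * a / Sig a p * axial p μ := by
  fin_cases μ <;> simp [e4, dr, dt, axial, quot]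

lemma diffAt_axial (μ : Fin 4) : DiffAt M a p fun q => axial q μ := by
  fin_cases μ
  · exact diffAt_const _
  · exact (diffAt_coord 2).neg
  · exact diffAt_coord 1
  · exact diffAt_const _

lemma diffAt_e4 (hr : 0 < rad p) (μ : Fin 4) : DiffAt M a p fun q => e4 M a q μ := by
  simp only [e4_eq]
  have hS := (Sig_pos a hr).ne'
  have hS1 := diffAt_Sig (M := M) (a := a) hr
  exact ((((diffAt_const 2).mul (((diffAt_rad hr).pow 2).add (diffAt_const _))).div hS1 hS).mul
    (diffAt_dt μ)).add ((diffAt_quot hr).mul (diffAt_dr hr μ)) |>.add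
    (((diffAt_const (2 * a)).div hS1 hS).mul (diffAt_axial μ))

lemma diffAt_roundMetric (hr : 0 < rad p) (μ ν : Fin 4) :
    DiffAt M a p fun q => roundMetric q μ ν :=
  ((diffAt_const _).sub ((diffAt_dr hr μ).mul (diffAt_dr hr ν))).div
    ((diffAt_rad hr).pow 2) (by positivity)

/-! ### The metric -/

/-- This form is adapted to the horizontal distribution, the common kernel of `theta` and `dr`: on
it only the Σ-multiple of the round metric survives, that is Σ/r² times the Euclidean product of
spatial parts. -/
lemma metric_eq (ha : |a| ≤ M) (hr : 0 < rad p) (μ ν : Fin 4) : metric M a p μ ν =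
    Sig a p * roundMetric p μ ν
      - a * (sinSqdφ p μ * theta a p ν + theta a p μ * sinSqdφ p ν)
      + (a ^ 2 * (1 - cosθ p ^ 2) / Sig a p - quot M a p) * (theta a p μ * theta a p ν)
      + (theta a p μ * dr p ν + dr p μ * theta a p ν) := by
  have hS := (Sig_pos a hr).ne'
  have h1 : a ^ 2 * (1 - cosθ p ^ 2) / Sig a p - quot M a p = 2 * M * rad p / Sig a p - 1 := by
    rw [quot, Del_eq ha]
    field_simp
    unfold Sig
    ring
  rw [h1]
  simp only [metric, Matrix.of_apply, theta]
  ring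

lemma diffAt_metric (ha : |a| ≤ M) (hM : 0 < M) (hp : p ∈ exterior M a) (μ ν : Fin 4) :
    DiffAt M a p fun q => metric M a q μ ν := by
  have hr := rad_pos hM hp
  have hS1 := diffAt_Sig (M := M) (a := a) hr
  have hS := (Sig_pos a hr).ne'
  have ht := fun κ => diffAt_theta (M := M) (a := a) hr κ
  have hs := fun κ => diffAt_sinSqdφ (M := M) (a := a) hr κ
  have hd := fun κ => diffAt_dr (M := M) (a := a) hr κ
  refine DiffAt.congr ?_ (fun q hq => metric_eq ha (rad_pos hM hq) μ ν) hp
  exact (((hS1.mul (diffAt_roundMetric hr μ ν)).sub ((diffAt_const a).mul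
    (((hs μ).mul (ht ν)).add ((ht μ).mul (hs ν))))).add
    (((((diffAt_const (a ^ 2)).mul ((diffAt_const 1).sub ((diffAt_cosθ hr).pow 2))).div hS1 hS).sub
      (diffAt_quot hr)).mul ((ht μ).mul (ht ν)))).add
    (((ht μ).mul (hd ν)).add ((hd μ).mul (ht ν)))

lemma metric_symm (p : Point) (μ ν : Fin 4) : metric M a p μ ν = metric M a p ν μ := by
  simp only [metric, roundMetric, Matrix.of_apply]
  have : (μ = ν ∧ μ ≠ 0) ↔ (ν = μ ∧ ν ≠ 0) := by
    constructor <;> rintro ⟨rfl, h⟩ <;> exact ⟨rfl, h⟩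
  simp only [this]
  ring

/-- The spatial part of a vector. -/
def spatial (V : Fin 4 → ℝ) : Fin 4 → ℝ := ![0, V 1, V 2, V 3]

lemma roundMetric_mulVec (V : Fin 4 → ℝ) (μ : Fin 4) :
    (roundMetric p).mulVec V μ = (spatial V μ - dr p μ * (dr p ⬝ᵥ V)) / rad p ^ 2 := by
  have h : ∀ ν, (if μ = ν ∧ μ ≠ 0 then 1 else 0 : ℝ) * V ν = if μ = ν then spatial V ν else 0 := by
    intro ν
    fin_cases μ <;> fin_cases ν <;> simp [spatial]
  simp only [Matrix.mulVec, dotProduct, roundMetric, Matrix.of_apply, div_mul_eq_mul_div, sub_mul,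
    ← Finset.sum_div, Finset.sum_sub_distrib, h, mul_assoc, ← Finset.mul_sum]
  simp

lemma metric_mulVec (ha : |a| ≤ M) (hr : 0 < rad p) (V : Fin 4 → ℝ) (μ : Fin 4) :
    (metric M a p).mulVec V μ =
    Sig a p * ((spatial V μ - dr p μ * (dr p ⬝ᵥ V)) / rad p ^ 2)
      - a * (sinSqdφ p μ * (theta a p ⬝ᵥ V) + theta a p μ * (sinSqdφ p ⬝ᵥ V))
      + (a ^ 2 * (1 - cosθ p ^ 2) / Sig a p - quot M a p) * (theta a p μ * (theta a p ⬝ᵥ V))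
      + (theta a p μ * (dr p ⬝ᵥ V) + dr p μ * (theta a p ⬝ᵥ V)) := by
  rw [← roundMetric_mulVec]
  simp only [Matrix.mulVec, dotProduct, metric_eq ha hr, Fin.sum_univ_four]
  ring

lemma dr_dot_dr (hr : 0 < rad p) : dr p ⬝ᵥ dr p = 1 := by
  rw [dr_dot]
  simp only [dr, Matrix.cons_val]
  field_simp
  rw [rad_sq]

lemma sinSqdφ_dot_dr : sinSqdφ p ⬝ᵥ dr p = 0 := by
  rw [sinSqdφ_dot]
  simp only [dr, Matrix.cons_val]
  ring

lemma dr_dot_e3 (hr : 0 < rad p) : dr p ⬝ᵥ e3 p = -1 := by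
  rw [show e3 p = -dr p from funext (e3_eq p), dotProduct_neg, dr_dot_dr hr]

lemma sinSqdφ_dot_e3 : sinSqdφ p ⬝ᵥ e3 p = 0 := by
  rw [show e3 p = -dr p from funext (e3_eq p), dotProduct_neg, sinSqdφ_dot_dr, neg_zero]

lemma theta_dot_e3 : theta a p ⬝ᵥ e3 p = 0 := by
  rw [theta_dot, sinSqdφ_dot_e3]; simp [e3]

lemma dcos_dot_e3 (hr : 0 < rad p) : dcos p ⬝ᵥ e3 p = 0 := by
  rw [dcos_dot hr, dr_dot_e3 hr]
  simp only [e3, Matrix.cons_val]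
  field_simp
  ring

lemma sin_sq_eq (hr : 0 < rad p) : (p 1 ^ 2 + p 2 ^ 2) / rad p ^ 2 = 1 - cosθ p ^ 2 := by
  unfold cosθ
  field_simp
  rw [rad_sq]; ring

lemma dr_dot_e4 (hr : 0 < rad p) : dr p ⬝ᵥ e4 M a p = quot M a p := by
  rw [dr_dot]
  simp only [e4_eq, dt, dr, axial, Matrix.cons_val]
  have := rad_sq p
  field_simp
  linear_combination -quot M a p * this

lemma sinSqdφ_dot_e4 (hr : 0 < rad p) :
    sinSqdφ p ⬝ᵥ e4 M a p = 2 * a / Sig a p * (1 - cosθ p ^ 2) := by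
  rw [sinSqdφ_dot, ← sin_sq_eq hr]
  simp only [e4_eq, dt, dr, axial, Matrix.cons_val]
  ring

lemma theta_dot_e4 (hr : 0 < rad p) : theta a p ⬝ᵥ e4 M a p = 2 := by
  have hS := (Sig_pos a hr).ne'
  rw [theta_dot, sinSqdφ_dot_e4 hr, e4_eq]
  simp only [dt, dr, axial, Matrix.cons_val]
  field_simp
  unfold Sig
  ring

lemma dcos_dot_e4 (hr : 0 < rad p) : dcos p ⬝ᵥ e4 M a p = 0 := by
  rw [dcos_dot hr, dr_dot_e4 hr, e4_eq]
  simp only [dt, dr, axial, Matrix.cons_val]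
  field_simp
  ring

/-- Together with `lower_e4` this identifies vectors orthogonal to e₃ and e₄ with the common kernel
of `theta` and `dr`, the description used in `IsFrame` and `IsHor`. -/
lemma lower_e3 (ha : |a| ≤ M) (hr : 0 < rad p) (μ : Fin 4) : lower M a e3 p μ = -theta a p μ := by
  change (metric M a p).mulVec (e3 p) μ = _
  rw [metric_mulVec ha hr, theta_dot_e3, sinSqdφ_dot_e3, dr_dot_e3 hr]
  have : spatial (e3 p) μ = -dr p μ := by fin_cases μ <;> simp [spatial, e3, dr]
  rw [this]
  ring

lemma lower_e4 (ha : |a| ≤ M) (hr : 0 < rad p) (μ : Fin 4) :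
    lower M a (e4 M a) p μ = 2 * dr p μ - quot M a p * theta a p μ := by
  have hS := (Sig_pos a hr).ne'
  change (metric M a p).mulVec (e4 M a p) μ = _
  rw [metric_mulVec ha hr, theta_dot_e4 hr, sinSqdφ_dot_e4 hr, dr_dot_e4 hr]
  have : spatial (e4 M a p) μ =
      quot M a p * dr p μ + 2 * a / Sig a p * rad p ^ 2 * sinSqdφ p μ := by
    fin_cases μ <;> simp [spatial, e4_eq, dr, dt, axial, sinSqdφ] <;> field_simp
  rw [this]
  field_simp
  ring

/-! ### Orthonormal horizontal frames at a point -/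

/-- `X`, `Y` is a positively oriented orthonormal basis of the horizontal space at `p`. -/
structure IsFrame (a : ℝ) (p : Point) (X Y : Fin 4 → ℝ) : Prop where
  theta_X : theta a p ⬝ᵥ X = 0
  theta_Y : theta a p ⬝ᵥ Y = 0
  dr_X : dr p ⬝ᵥ X = 0
  dr_Y : dr p ⬝ᵥ Y = 0
  norm_X : X 1 ^ 2 + X 2 ^ 2 + X 3 ^ 2 = rad p ^ 2 / Sig a p
  norm_Y : Y 1 ^ 2 + Y 2 ^ 2 + Y 3 ^ 2 = rad p ^ 2 / Sig a p
  inner_XY : X 1 * Y 1 + X 2 * Y 2 + X 3 * Y 3 = 0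
  cross_one : X 2 * Y 3 - X 3 * Y 2 = rad p / Sig a p * p 1
  cross_two : X 3 * Y 1 - X 1 * Y 3 = rad p / Sig a p * p 2
  cross_three : X 1 * Y 2 - X 2 * Y 1 = rad p / Sig a p * p 3
  sinSqdφ_X : sinSqdφ p ⬝ᵥ X = Y 3 / rad p
  sinSqdφ_Y : sinSqdφ p ⬝ᵥ Y = -(X 3 / rad p)
  third : X 3 ^ 2 + Y 3 ^ 2 = rad p ^ 2 / Sig a p * (1 - cosθ p ^ 2)

/-- The choice is made point by point, with a case distinction on the axis; a continuous choice over
the sphere is impossible and is not needed. -/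
lemma exists_unit_orthogonal (x y z : ℝ) :
    ∃ u v w : ℝ, u ^ 2 + v ^ 2 + w ^ 2 = 1 ∧ x * u + y * v + z * w = 0 := by
  by_cases h : x ^ 2 + y ^ 2 = 0
  · have hx : x = 0 := by nlinarith [sq_nonneg x, sq_nonneg y]
    exact ⟨1, 0, 0, by norm_num, by simp [hx]⟩
  · have h0 : 0 < x ^ 2 + y ^ 2 := lt_of_le_of_ne (by positivity) (Ne.symm h)
    have hq : 0 < √(x ^ 2 + y ^ 2) := Real.sqrt_pos.2 h0
    have hsq := Real.sq_sqrt h0.le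
    refine ⟨-y / √(x ^ 2 + y ^ 2), x / √(x ^ 2 + y ^ 2), 0, ?_, ?_⟩
    · field_simp
      rw [hsq]; ring
    · field_simp
      ring

/-- On horizontal vectors g is Σ/r² times the Euclidean product, so X and Y have Euclidean length
r/√Σ. Their spatial cross product is a positive multiple of x, which fixes the orientation. The
fields on `sinSqdφ` say that sin² θ dφ̄ is d cos θ rotated by a right angle, and `third` is the
squared length of the horizontal part of d cos θ. -/
lemma exists_isFrame (hr : 0 < rad p) : ∃ X Y, IsFrame a p X Y := by
  obtain ⟨u, v, w, h1, h0⟩ := exists_unit_orthogonal (p 1) (p 2) (p 3)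
  have hS := Sig_pos a hr
  have hr2 := rad_sq p
  -- The factor that turns a Euclidean unit tangent vector of the sphere into a g-unit vector.
  set k : ℝ := rad p / √(Sig a p) with hk
  have hk2 : k ^ 2 = rad p ^ 2 / Sig a p := by rw [hk, div_pow, Real.sq_sqrt hS.le]
  have hN : (k * u) ^ 2 + (k * v) ^ 2 + (k * w) ^ 2 = rad p ^ 2 / Sig a p := by
    rw [← hk2]; linear_combination k ^ 2 * h1
  have hD : p 1 * (k * u) + p 2 * (k * v) + p 3 * (k * w) = 0 := by linear_combination k * h0
  generalize k * u = x at hN hD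
  generalize k * v = y at hN hD
  generalize k * w = z at hN hD
  clear_value k
  obtain ⟨N, hNdef⟩ : ∃ N, N = rad p ^ 2 / Sig a p := ⟨_, rfl⟩
  rw [← hNdef] at hN
  have hNr : rad p / Sig a p = N / rad p := by rw [hNdef]; field_simp
  have hc : cosθ p ^ 2 = p 3 ^ 2 / rad p ^ 2 := by rw [cosθ, div_pow]
  -- Y is spatially the cross product of x/|x| with X; the time components are forced by the
  -- vanishing of `theta`.
  refine ⟨![a * ((p 1 * y - p 2 * x) / rad p ^ 2), x, y, z],
    ![-(a * (z / rad p)), (p 2 * z - p 3 * y) / rad p, (p 3 * x - p 1 * z) / rad p,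
      (p 1 * y - p 2 * x) / rad p], ?_⟩
  constructor
  · rw [theta_dot, sinSqdφ_dot]; simp
  · rw [theta_dot, sinSqdφ_dot]; simp
    field_simp
    linear_combination -a * p 3 * hD - a * z * hr2
  · rw [dr_dot]; simp [hD]
  · rw [dr_dot]; simp; left; ring
  · simp [hN, hNdef]
  · simp only [Matrix.cons_val, ← hNdef]
    field_simp
    rw [← hN, hr2]
    linear_combination (-(p 1 * x + p 2 * y + p 3 * z)) * hD
  · simp only [Matrix.cons_val]
    field_simp
    ring
  · simp only [Matrix.cons_val, hNr]
    field_simp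
    rw [← hN]; linear_combination -x * hD
  · simp only [Matrix.cons_val, hNr]
    field_simp
    rw [← hN]; linear_combination -y * hD
  · simp only [Matrix.cons_val, hNr]
    field_simp
    rw [← hN]; linear_combination -z * hD
  · rw [sinSqdφ_dot]; simp only [Matrix.cons_val]; field_simp
  · rw [sinSqdφ_dot]; simp only [Matrix.cons_val]; field_simp
    linear_combination p 3 * hD + z * hr2
  · simp only [Matrix.cons_val, hc, ← hNdef]
    field_simp
    rw [← hN, hr2]
    linear_combination (p 3 * z - p 1 * x - p 2 * y) * hD

lemma IsFrame.dcos_X (h : IsFrame a p X Y) (hr : 0 < rad p) : dcos p ⬝ᵥ X = X 3 / rad p := by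
  rw [dcos_dot hr, h.dr_X]; ring

lemma IsFrame.dcos_Y (h : IsFrame a p X Y) (hr : 0 < rad p) : dcos p ⬝ᵥ Y = Y 3 / rad p := by
  rw [dcos_dot hr, h.dr_Y]; ring

/-- The one-form metrically equivalent to a vector at `p`. -/
noncomputable def flat (M a : ℝ) (p : Point) (V : Fin 4 → ℝ) : Fin 4 → ℝ :=
  (metric M a p).mulVec V

lemma flat_eq_lower (e : Field₁) : flat M a p (e p) = lower M a e p := rfl

lemma flat_dot_symm (V W : Fin 4 → ℝ) : flat M a p V ⬝ᵥ W = flat M a p W ⬝ᵥ V := by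
  have hT : (metric M a p).transpose = metric M a p := by
    ext μ ν; exact metric_symm p ν μ
  rw [flat, flat, dotProduct_comm, Matrix.dotProduct_mulVec, ← Matrix.mulVec_transpose, hT]

lemma flat_e3_dot (ha : |a| ≤ M) (hr : 0 < rad p) (V : Fin 4 → ℝ) :
    flat M a p (e3 p) ⬝ᵥ V = -(theta a p ⬝ᵥ V) := by
  rw [← neg_dotProduct]
  congr 1
  funext μ; exact lower_e3 ha hr μ

lemma flat_e4_dot (ha : |a| ≤ M) (hr : 0 < rad p) (V : Fin 4 → ℝ) :
    flat M a p (e4 M a p) ⬝ᵥ V = 2 * (dr p ⬝ᵥ V) - quot M a p * (theta a p ⬝ᵥ V) := by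
  rw [← smul_eq_mul, ← smul_eq_mul, ← smul_dotProduct, ← smul_dotProduct, ← sub_dotProduct]
  congr 1
  funext μ; exact lower_e4 ha hr μ

lemma flat_horizontal_dot (ha : |a| ≤ M) (hr : 0 < rad p) {U : Fin 4 → ℝ}
    (h1 : theta a p ⬝ᵥ U = 0) (h2 : dr p ⬝ᵥ U = 0) (V : Fin 4 → ℝ) :
    flat M a p U ⬝ᵥ V = Sig a p / rad p ^ 2 * (U 1 * V 1 + U 2 * V 2 + U 3 * V 3)
      - a * (sinSqdφ p ⬝ᵥ U) * (theta a p ⬝ᵥ V) := by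
  have : flat M a p U = (Sig a p / rad p ^ 2) • spatial U
      - (a * (sinSqdφ p ⬝ᵥ U)) • theta a p := by
    funext μ
    rw [flat, metric_mulVec ha hr, h1, h2]
    simp only [Pi.sub_apply, Pi.smul_apply, smul_eq_mul]
    ring
  rw [this, sub_dotProduct, smul_dotProduct, smul_dotProduct]
  simp [spatial, dotProduct, Fin.sum_univ_four]

/-- The components of the metric in a null frame `e₃, e₄, X, Y`. -/
structure IsNullFrame (M a : ℝ) (p : Point) (X Y : Fin 4 → ℝ) : Prop where
  f33 : flat M a p (e3 p) ⬝ᵥ e3 p = 0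
  f34 : flat M a p (e3 p) ⬝ᵥ e4 M a p = -2
  f3X : flat M a p (e3 p) ⬝ᵥ X = 0
  f3Y : flat M a p (e3 p) ⬝ᵥ Y = 0
  f43 : flat M a p (e4 M a p) ⬝ᵥ e3 p = -2
  f44 : flat M a p (e4 M a p) ⬝ᵥ e4 M a p = 0
  f4X : flat M a p (e4 M a p) ⬝ᵥ X = 0
  f4Y : flat M a p (e4 M a p) ⬝ᵥ Y = 0
  fX3 : flat M a p X ⬝ᵥ e3 p = 0
  fX4 : flat M a p X ⬝ᵥ e4 M a p = 0
  fXX : flat M a p X ⬝ᵥ X = 1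
  fXY : flat M a p X ⬝ᵥ Y = 0
  fY3 : flat M a p Y ⬝ᵥ e3 p = 0
  fY4 : flat M a p Y ⬝ᵥ e4 M a p = 0
  fYX : flat M a p Y ⬝ᵥ X = 0
  fYY : flat M a p Y ⬝ᵥ Y = 1

lemma IsFrame.isNullFrame (h : IsFrame a p X Y) (ha : |a| ≤ M) (hr : 0 < rad p) :
    IsNullFrame M a p X Y := by
  have hS := (Sig_pos a hr).ne'
  have f3X : flat M a p (e3 p) ⬝ᵥ X = 0 := by rw [flat_e3_dot ha hr, h.theta_X, neg_zero]
  have f3Y : flat M a p (e3 p) ⬝ᵥ Y = 0 := by rw [flat_e3_dot ha hr, h.theta_Y, neg_zero]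
  have f4X : flat M a p (e4 M a p) ⬝ᵥ X = 0 := by
    rw [flat_e4_dot ha hr, h.theta_X, h.dr_X]; ring
  have f4Y : flat M a p (e4 M a p) ⬝ᵥ Y = 0 := by
    rw [flat_e4_dot ha hr, h.theta_Y, h.dr_Y]; ring
  have f34 : flat M a p (e3 p) ⬝ᵥ e4 M a p = -2 := by rw [flat_e3_dot ha hr, theta_dot_e4 hr]
  have fXY : flat M a p X ⬝ᵥ Y = 0 := by
    rw [flat_horizontal_dot ha hr h.theta_X h.dr_X, h.theta_Y, h.inner_XY]; ring
  exact
  { f33 := by rw [flat_e3_dot ha hr, theta_dot_e3, neg_zero]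
    f34 := f34
    f3X := f3X
    f3Y := f3Y
    f43 := by rw [flat_dot_symm, f34]
    f44 := by rw [flat_e4_dot ha hr, theta_dot_e4 hr, dr_dot_e4 hr]; ring
    f4X := f4X
    f4Y := f4Y
    fX3 := by rw [flat_dot_symm, f3X]
    fX4 := by rw [flat_dot_symm, f4X]
    fXX := by
      rw [flat_horizontal_dot ha hr h.theta_X h.dr_X, h.theta_X]
      have := h.norm_X
      field_simp at this ⊢
      linear_combination this
    fXY := fXY
    fY3 := by rw [flat_dot_symm, f3Y]
    fY4 := by rw [flat_dot_symm, f4Y]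
    fYX := by rw [flat_dot_symm, fXY]
    fYY := by
      rw [flat_horizontal_dot ha hr h.theta_Y h.dr_Y, h.theta_Y]
      have := h.norm_Y
      field_simp at this ⊢
      linear_combination this }

/-- The matrix whose rows are the vectors of a null frame. -/
noncomputable def frameMatrix (M a : ℝ) (p : Point) (X Y : Fin 4 → ℝ) : Matrix (Fin 4) (Fin 4) ℝ :=
  Matrix.of ![X, Y, e3 p, e4 M a p]

/-- The inverse of the matrix of metric components in a null frame. -/
noncomputable def frameInv : Matrix (Fin 4) (Fin 4) ℝ :=
  !![1, 0, 0, 0; 0, 1, 0, 0; 0, 0, 0, -(1 / 2); 0, 0, -(1 / 2), 0]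

namespace IsNullFrame

lemma gram (h : IsNullFrame M a p X Y) :
    frameMatrix M a p X Y * metric M a p * (frameMatrix M a p X Y).transpose
      = !![1, 0, 0, 0; 0, 1, 0, 0; 0, 0, 0, -2; 0, 0, -2, 0] := by
  have hv : ∀ i j, (frameMatrix M a p X Y * metric M a p * (frameMatrix M a p X Y).transpose) i j
      = flat M a p (![X, Y, e3 p, e4 M a p] j) ⬝ᵥ (![X, Y, e3 p, e4 M a p] i) := by
    intro i j
    rw [Matrix.mul_assoc, Matrix.mul_apply, dotProduct_comm]
    rfl
  ext i j
  rw [hv]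
  fin_cases i <;> fin_cases j <;>
    simp [h.f33, h.f34, h.f3X, h.f3Y, h.f43, h.f44, h.f4X, h.f4Y, h.fX3, h.fX4, h.fXX,
      h.fXY, h.fY3, h.fY4, h.fYX, h.fYY]

/-- With A the frame matrix and G the Gram matrix, A g Aᵀ = G gives A (g Aᵀ G⁻¹) = 1. One-sided
inverses of square matrices are two-sided, so g (Aᵀ G⁻¹ A) = 1, which shows that g is invertible and
exhibits its inverse. -/
lemma metric_mul (h : IsNullFrame M a p X Y) :
    metric M a p * ((frameMatrix M a p X Y).transpose * frameInv * frameMatrix M a p X Y) = 1 := by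
  have h1 : frameMatrix M a p X Y * (metric M a p * (frameMatrix M a p X Y).transpose * frameInv)
      = 1 := by
    rw [← Matrix.mul_assoc, ← Matrix.mul_assoc, h.gram, frameInv]
    ext i j
    fin_cases i <;> fin_cases j <;> simp [Matrix.mul_apply, Fin.sum_univ_four]
  rw [← mul_eq_one_comm.1 h1]
  simp only [Matrix.mul_assoc]

lemma metricInv_eq_mul (h : IsNullFrame M a p X Y) :
    metricInv M a p = (frameMatrix M a p X Y).transpose * frameInv * frameMatrix M a p X Y :=
  Matrix.inv_eq_right_inv h.metric_mul

lemma metric_mul_metricInv (h : IsNullFrame M a p X Y) : metric M a p * metricInv M a p = 1 := by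
  rw [h.metricInv_eq_mul, h.metric_mul]

lemma det_metric (h : IsNullFrame M a p X Y) :
    (metric M a p).det * (frameMatrix M a p X Y).det ^ 2 = -4 := by
  have := congrArg Matrix.det h.gram
  rw [Matrix.det_mul, Matrix.det_mul, Matrix.det_transpose] at this
  rw [pow_two, ← mul_assoc, mul_comm (metric M a p).det, this]
  simp [Matrix.det_succ_row_zero, Fin.sum_univ_succ, Fin.succAbove]
  norm_num

lemma metricInv_apply (h : IsNullFrame M a p X Y) (μ ν : Fin 4) :
    metricInv M a p μ ν = X μ * X ν + Y μ * Y ν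
      - 1 / 2 * (e3 p μ * e4 M a p ν + e4 M a p μ * e3 p ν) := by
  rw [h.metricInv_eq_mul]
  simp [Matrix.mul_apply, Fin.sum_univ_four, frameMatrix, frameInv]
  ring

lemma hInv_apply (h : IsNullFrame M a p X Y) (μ ν : Fin 4) :
    hInv M a p μ ν = X μ * X ν + Y μ * Y ν := by
  rw [hInv, Matrix.of_apply, h.metricInv_apply]; ring

/-- Expansion of the identity in a null frame. -/
lemma one_apply (h : IsNullFrame M a p X Y) (μ ν : Fin 4) : (if μ = ν then 1 else 0 : ℝ) =
    X μ * flat M a p X ν + Y μ * flat M a p Y ν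
      - 1 / 2 * (e3 p μ * flat M a p (e4 M a p) ν + e4 M a p μ * flat M a p (e3 p) ν) := by
  have h1 := congrFun (congrFun h.metric_mul_metricInv ν) μ
  rw [Matrix.one_apply, Matrix.mul_apply] at h1
  simp only [eq_comm (a := μ)]
  rw [← h1]
  simp only [h.metricInv_apply, flat, Matrix.mulVec, dotProduct, Fin.sum_univ_four]
  ring

lemma proj_apply (h : IsNullFrame M a p X Y) (μ ν : Fin 4) :
    proj M a p μ ν = X μ * flat M a p X ν + Y μ * flat M a p Y ν := by
  rw [proj, Matrix.of_apply, h.one_apply, ← flat_eq_lower, ← flat_eq_lower]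
  ring

/-- Expansion of a one-form in a null frame. -/
lemma form_expand (h : IsNullFrame M a p X Y) (s : Fin 4 → ℝ) (ν : Fin 4) :
    s ν = (s ⬝ᵥ X) * flat M a p X ν + (s ⬝ᵥ Y) * flat M a p Y ν
      - 1 / 2 * ((s ⬝ᵥ e3 p) * flat M a p (e4 M a p) ν
        + (s ⬝ᵥ e4 M a p) * flat M a p (e3 p) ν) := by
  have h1 : s ν = ∑ μ, s μ * (if μ = ν then 1 else 0 : ℝ) := by simp
  rw [h1]
  simp only [h.one_apply, dotProduct, Fin.sum_univ_four]
  ring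

/-- Expansion of a vector in a null frame. -/
lemma vector_expand (h : IsNullFrame M a p X Y) (V : Fin 4 → ℝ) :
    V = (flat M a p X ⬝ᵥ V) • X + (flat M a p Y ⬝ᵥ V) • Y
      + (-(1 / 2) * (flat M a p (e4 M a p) ⬝ᵥ V)) • e3 p
      + (-(1 / 2) * (flat M a p (e3 p) ⬝ᵥ V)) • e4 M a p := by
  funext μ
  have h1 : V μ = ∑ ν, (if μ = ν then 1 else 0 : ℝ) * V ν := by simp
  rw [h1]
  simp only [h.one_apply, dotProduct, Fin.sum_univ_four, Pi.add_apply, Pi.smul_apply, smul_eq_mul]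
  ring

end IsNullFrame

/-- `IsFrame.hVol_apply` uses this only for the sign, which says that X, Y, e₃, e₄ is positively
oriented; the size of det g already follows from the Gram matrix. -/
lemma IsFrame.det_frameMatrix (h : IsFrame a p X Y) (hr : 0 < rad p) :
    (frameMatrix M a p X Y).det = 2 * rad p ^ 2 / Sig a p := by
  have hS := (Sig_pos a hr).ne'
  have hX0 : X 0 = a * (Y 3 / rad p) := by
    have := h.theta_X
    rw [theta_dot, h.sinSqdφ_X] at this
    linarith
  have hY0 : Y 0 = -(a * (X 3 / rad p)) := by
    have := h.theta_Y
    rw [theta_dot, h.sinSqdφ_Y] at this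
    linarith
  have hX := h.dr_X
  have hY := h.dr_Y
  rw [dr_dot, div_eq_zero_iff, or_iff_left hr.ne'] at hX hY
  have h1 : (frameMatrix M a p X Y).det =
      e4 M a p 0 / rad p * (p 1 * (X 2 * Y 3 - X 3 * Y 2) + p 2 * (X 3 * Y 1 - X 1 * Y 3)
        + p 3 * (X 1 * Y 2 - X 2 * Y 1))
      - 2 * a / Sig a p / rad p *
        (X 0 * (rad p ^ 2 * Y 3 - p 3 * (p 1 * Y 1 + p 2 * Y 2 + p 3 * Y 3))
        - Y 0 * (rad p ^ 2 * X 3 - p 3 * (p 1 * X 1 + p 2 * X 2 + p 3 * X 3))) := by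
    simp only [frameMatrix, e3, rad_sq]
    simp [Matrix.det_succ_row_zero, Fin.sum_univ_succ, Fin.succAbove, e4_eq, dr, dt, axial, rad_sq]
    ring
  rw [h1, h.cross_one, h.cross_two, h.cross_three, hX, hY, hX0, hY0]
  have h2 : e4 M a p 0 = 2 * (rad p ^ 2 + a ^ 2) / Sig a p := by
    simp [e4_eq, dr, dt, axial]
  rw [h2]
  have hr2 := rad_sq p
  have h3 := h.third
  have hS1 : Sig a p = rad p ^ 2 + a ^ 2 * cosθ p ^ 2 := rfl
  field_simp at h3 ⊢
  linear_combination (-(rad p ^ 2 + a ^ 2)) * rad p ^ 2 * hr2 - a ^ 2 * rad p ^ 2 * h3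
    - rad p ^ 4 * hS1

/-- Expand the two coordinate vectors in the null frame. The determinant then factors into a 2 × 2
minor of coefficients and the frame determinant, and `det_metric` turns √|det g| times the latter
into 2, which cancels the factor ½. -/
lemma IsFrame.hVol_apply (h : IsFrame a p X Y) (ha : |a| ≤ M) (hr : 0 < rad p) (μ ν : Fin 4) :
    hVol M a p μ ν = flat M a p X μ * flat M a p Y ν - flat M a p X ν * flat M a p Y μ := by
  have hN := h.isNullFrame ha hr
  have hd := h.det_frameMatrix (M := M) hr
  have hdpos : 0 < (frameMatrix M a p X Y).det := by
    rw [hd]; have := Sig_pos a hr; positivity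
  have hsq : √|(metric M a p).det| = 2 / (frameMatrix M a p X Y).det := by
    rw [Real.sqrt_eq_iff_mul_self_eq (abs_nonneg _) (by positivity)]
    have h4 : (metric M a p).det = -4 / (frameMatrix M a p X Y).det ^ 2 := by
      rw [eq_div_iff (by positivity), hN.det_metric]
    rw [h4, abs_div, abs_of_pos (a := _ ^ 2) (by positivity)]
    norm_num
    field_simp
    norm_num
  have hmul : (Matrix.of ![Pi.single μ 1, Pi.single ν 1, e3 p, e4 M a p] : Matrix _ _ ℝ) =
      !![flat M a p X μ, flat M a p Y μ, -(1 / 2) * flat M a p (e4 M a p) μ,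
          -(1 / 2) * flat M a p (e3 p) μ;
        flat M a p X ν, flat M a p Y ν, -(1 / 2) * flat M a p (e4 M a p) ν,
          -(1 / 2) * flat M a p (e3 p) ν;
        0, 0, 1, 0; 0, 0, 0, 1] * frameMatrix M a p X Y := by
    have hs : ∀ κ l : Fin 4, (Pi.single κ (1 : ℝ) : Fin 4 → ℝ) l = if l = κ then 1 else 0 := by
      intro κ l; simp [Pi.single_apply]
    ext i j
    fin_cases i
    · simp [Matrix.mul_apply, Fin.sum_univ_four, frameMatrix, hs, hN.one_apply]; ring
    · simp [Matrix.mul_apply, Fin.sum_univ_four, frameMatrix, hs, hN.one_apply]; ring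
    · simp [Matrix.mul_apply, Fin.sum_univ_four, frameMatrix]
    · simp [Matrix.mul_apply, Fin.sum_univ_four, frameMatrix]
  rw [hVol, Matrix.of_apply, hmul, Matrix.det_mul, hsq]
  generalize (frameMatrix M a p X Y).det = d at *
  simp [Matrix.det_succ_row_zero, Fin.sum_univ_succ, Fin.succAbove]
  field_simp
  ring

/-! ### The Levi-Civita connection evaluated on vectors -/

/-- The vector `Γ(Z, V)` given by the Christoffel symbols. -/
noncomputable def Gam (M a : ℝ) (p : Point) (Z V : Fin 4 → ℝ) : Fin 4 → ℝ := fun κ =>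
  ∑ μ, ∑ ν, Z μ * (V ν * christoffel M a p κ μ ν)

/-- The derivative of a vector field, or of a one-form, in the direction `Z`. -/
noncomputable def derField (M a : ℝ) (p : Point) (e : Field₁) (Z : Fin 4 → ℝ) : Fin 4 → ℝ :=
  fun ν => der M a p (fun q => e q ν) Z

/-- The vector `∇_Z e`. -/
noncomputable def nab (M a : ℝ) (p : Point) (e : Field₁) (Z : Fin 4 → ℝ) : Fin 4 → ℝ :=
  derField M a p e Z + Gam M a p Z (e p)

/-- The connection coefficient `g(∇_Z e, V)`. -/
noncomputable def conn (M a : ℝ) (p : Point) (e : Field₁) (Z V : Fin 4 → ℝ) : ℝ :=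
  flat M a p V ⬝ᵥ nab M a p e Z

/-- The derivative in the direction `Z` of the metric, evaluated on `V`, `W`. -/
noncomputable def derMetric (M a : ℝ) (p : Point) (Z V W : Fin 4 → ℝ) : ℝ :=
  der M a p (fun q => flat M a q V ⬝ᵥ W) Z

/-- The covariant derivative `(∇_Z s)(V)` of a one-form. -/
noncomputable def cov₁ (M a : ℝ) (p : Point) (s : Field₁) (Z V : Fin 4 → ℝ) : ℝ :=
  der M a p (fun q => s q ⬝ᵥ V) Z - s p ⬝ᵥ Gam M a p Z V

/-- The covariant derivative `(∇_Z F)(V, W)` of a two-tensor. -/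
noncomputable def cov₂ (M a : ℝ) (p : Point) (F : Field₂) (Z V W : Fin 4 → ℝ) : ℝ :=
  der M a p (fun q => V ⬝ᵥ (F q).mulVec W) Z - Gam M a p Z V ⬝ᵥ (F p).mulVec W
    - V ⬝ᵥ (F p).mulVec (Gam M a p Z W)

lemma sum_mul_covVector (e : Field₁) (Z : Fin 4 → ℝ) (ν : Fin 4) :
    ∑ μ, Z μ * covVector M a e p μ ν = nab M a p e Z ν := by
  simp only [covVector, mul_add, Finset.sum_add_distrib, sum_mul_pd, nab, Pi.add_apply, derField,
    Gam, Finset.mul_sum]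
  congr 1
  refine Finset.sum_congr rfl fun μ _ => Finset.sum_congr rfl fun κ _ => by ring

lemma sum_mul_covForm (hu : UniqueDiffWithinAt ℝ (exterior M a) p) {s : Field₁}
    (hs : ∀ ν, DiffAt M a p fun q => s q ν) (Z V : Fin 4 → ℝ) :
    ∑ μ, ∑ ν, Z μ * V ν * covForm M a s p μ ν = cov₁ M a p s Z V := by
  rw [cov₁, der_dot_const hu Z hs]
  simp only [← sum_mul_pd, covForm, Gam, dotProduct, Fin.sum_univ_four]
  ring

lemma sum_mul_covTwo (hu : UniqueDiffWithinAt ℝ (exterior M a) p) {F : Field₂}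
    (hF : ∀ μ ν, DiffAt M a p fun q => F q μ ν) (Z V W : Fin 4 → ℝ) :
    ∑ μ, ∑ ν, ∑ l, Z μ * V ν * W l * covTwo M a F p μ ν l = cov₂ M a p F Z V W := by
  have h1 : der M a p (fun q => V ⬝ᵥ (F q).mulVec W) Z
      = ∑ μ, ∑ ν, ∑ l, Z μ * V ν * W l * pd M a (fun q => F q ν l) μ p := by
    have h2 : ∀ ν, der M a p (fun q => (F q).mulVec W ν) Z
        = ∑ l, der M a p (fun q => F q ν l) Z * W l :=
      fun ν => der_dot_const (s := fun q l => F q ν l) hu Z (fun l => hF ν l) W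
    simp only [dotProduct_comm V]
    rw [der_dot_const (s := fun q => (F q).mulVec W) hu Z
      fun ν => DiffAt.dot_const (s := fun q l => F q ν l) (hF ν) W]
    simp only [h2, ← sum_mul_pd, Finset.sum_mul]
    rw [Finset.sum_comm_cycle]
    refine Finset.sum_congr rfl fun μ _ => Finset.sum_congr rfl fun ν _ =>
      Finset.sum_congr rfl fun l _ => by ring
  have h3 : Gam M a p Z V ⬝ᵥ (F p).mulVec W
      = ∑ μ, ∑ ν, ∑ l, Z μ * V ν * W l * ∑ κ, christoffel M a p κ μ ν * F p κ l := by
    simp only [Gam, Matrix.mulVec, dotProduct, Finset.sum_mul, Finset.mul_sum]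
    rw [Finset.sum_congr rfl fun κ _ => Finset.sum_comm_cycle.symm, Finset.sum_comm]
    refine Finset.sum_congr rfl fun μ _ => ?_
    rw [Finset.sum_comm]
    refine Finset.sum_congr rfl fun ν _ => ?_
    rw [Finset.sum_comm]
    refine Finset.sum_congr rfl fun l _ => Finset.sum_congr rfl fun κ _ => by ring
  have h4 : V ⬝ᵥ (F p).mulVec (Gam M a p Z W)
      = ∑ μ, ∑ ν, ∑ l, Z μ * V ν * W l * ∑ κ, christoffel M a p κ μ l * F p ν κ := by
    simp only [Gam, Matrix.mulVec, dotProduct, Finset.mul_sum]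
    have : ∀ ν, (∑ κ, ∑ μ, ∑ l, V ν * (F p ν κ * (Z μ * (W l * christoffel M a p κ μ l))))
        = ∑ μ, ∑ l, ∑ κ, V ν * (F p ν κ * (Z μ * (W l * christoffel M a p κ μ l))) := by
      intro ν
      rw [Finset.sum_comm]
      exact Finset.sum_congr rfl fun μ _ => Finset.sum_comm
    simp only [this]
    rw [Finset.sum_comm]
    refine Finset.sum_congr rfl fun μ _ => Finset.sum_congr rfl fun ν _ =>
      Finset.sum_congr rfl fun l _ => Finset.sum_congr rfl fun κ _ => by ring
  rw [cov₂, h1, h3, h4]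
  simp only [covTwo, mul_sub, Finset.sum_add_distrib, mul_add, Finset.sum_sub_distrib]
  ring

lemma Gam_symm (Z V : Fin 4 → ℝ) : Gam M a p Z V = Gam M a p V Z := by
  have h : ∀ κ μ ν, christoffel M a p κ μ ν = christoffel M a p κ ν μ := by
    intro κ μ ν
    simp only [christoffel]
    congr 1
    refine Finset.sum_congr rfl fun l _ => ?_
    rw [show (fun q => metric M a q μ ν) = fun q => metric M a q ν μ from
      funext fun q => metric_symm q μ ν]
    ring
  funext κ
  rw [Gam, Gam, Finset.sum_comm]
  refine Finset.sum_congr rfl fun μ _ => Finset.sum_congr rfl fun ν _ => ?_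
  rw [h κ]; ring

lemma derMetric_symm (Z V W : Fin 4 → ℝ) : derMetric M a p Z V W = derMetric M a p Z W V := by
  simp only [derMetric, flat_dot_symm]

lemma diffAt_flat (hM : 0 < M) (ha : |a| ≤ M) (hp : p ∈ exterior M a) (V : Fin 4 → ℝ)
    (μ : Fin 4) : DiffAt M a p fun q => flat M a q V μ :=
  DiffAt.dot_const (s := fun q ν => metric M a q μ ν) (diffAt_metric ha hM hp μ) V

lemma diffAt_lower (hM : 0 < M) (ha : |a| ≤ M) (hp : p ∈ exterior M a) {e : Field₁}
    (he : ∀ ν, DiffAt M a p fun q => e q ν) (μ : Fin 4) :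
    DiffAt M a p fun q => lower M a e q μ :=
  DiffAt.sum fun ν _ => (diffAt_metric ha hM hp μ ν).mul (he ν)

lemma derMetric_eq_sum (hM : 0 < M) (ha : |a| ≤ M) (hp : p ∈ exterior M a)
    (Z V W : Fin 4 → ℝ) : derMetric M a p Z V W
      = ∑ l, ∑ ν, ∑ μ, Z μ * V ν * W l * pd M a (fun q => metric M a q l ν) μ p := by
  have hu := uniqueDiffWithinAt_exterior hM hp
  have h2 : ∀ l, der M a p (fun q => flat M a q V l) Z
      = ∑ ν, der M a p (fun q => metric M a q l ν) Z * V ν :=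
    fun l => der_dot_const (s := fun q ν => metric M a q l ν) hu Z (diffAt_metric ha hM hp l) V
  rw [derMetric, der_dot_const hu Z (diffAt_flat hM ha hp V)]
  simp only [h2, ← sum_mul_pd, Finset.sum_mul]
  refine Finset.sum_congr rfl fun μ _ => Finset.sum_congr rfl fun ν _ =>
      Finset.sum_congr rfl fun l _ => by ring

/-- The Koszul formula for coordinate vector fields. -/
lemma flat_dot_Gam (hM : 0 < M) (ha : |a| ≤ M) (hp : p ∈ exterior M a) (Z V W : Fin 4 → ℝ) :
    flat M a p W ⬝ᵥ Gam M a p Z V = 1 / 2 * (derMetric M a p Z V W + derMetric M a p V Z W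
      - derMetric M a p W Z V) := by
  obtain ⟨X, Y, hXY⟩ := exists_isFrame (a := a) (rad_pos hM hp)
  have hinv := (hXY.isNullFrame ha (rad_pos hM hp)).metric_mul_metricInv
  -- Lowering the upper index of Γ cancels the inverse metric, so from here on neither appears
  -- explicitly.
  have h1 : ∀ l μ ν, ∑ κ, metric M a p l κ * christoffel M a p κ μ ν = 1 / 2 *
      (pd M a (fun q => metric M a q l ν) μ p + pd M a (fun q => metric M a q l μ) ν p
        - pd M a (fun q => metric M a q μ ν) l p) := by
    intro l μ ν
    set k : Fin 4 → ℝ := fun l => pd M a (fun q => metric M a q l ν) μ p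
      + pd M a (fun q => metric M a q l μ) ν p - pd M a (fun q => metric M a q μ ν) l p with hk
    have h2 : (metric M a p).mulVec ((metricInv M a p).mulVec k) = k := by
      rw [Matrix.mulVec_mulVec, hinv, Matrix.one_mulVec]
    have h3 := congrFun h2 l
    change _ = 1 / 2 * k l
    rw [← h3]
    simp only [Matrix.mulVec, dotProduct, christoffel, Finset.mul_sum, hk]
    refine Finset.sum_congr rfl fun κ _ => Finset.sum_congr rfl fun i _ => by ring
  have h4 : flat M a p W ⬝ᵥ Gam M a p Z V
      = ∑ l, ∑ ν, ∑ μ, Z μ * V ν * W l * ∑ κ, metric M a p l κ * christoffel M a p κ μ ν := by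
    rw [flat_dot_symm, dotProduct_comm]
    simp only [flat, Matrix.mulVec, dotProduct, Gam, Finset.mul_sum]
    refine Finset.sum_congr rfl fun l _ => ?_
    rw [Finset.sum_comm_cycle]
    refine Finset.sum_congr rfl fun ν _ => ?_
    rw [Finset.sum_comm]
    refine Finset.sum_congr rfl fun μ _ => Finset.sum_congr rfl fun κ _ => by ring
  have h5 : derMetric M a p V Z W
      = ∑ l, ∑ ν, ∑ μ, Z μ * V ν * W l * pd M a (fun q => metric M a q l μ) ν p := by
    rw [derMetric_eq_sum hM ha hp]
    refine Finset.sum_congr rfl fun l _ => ?_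
    rw [Finset.sum_comm]
    refine Finset.sum_congr rfl fun ν _ => Finset.sum_congr rfl fun μ _ => by ring
  have h6 : derMetric M a p W Z V
      = ∑ l, ∑ ν, ∑ μ, Z μ * V ν * W l * pd M a (fun q => metric M a q μ ν) l p := by
    rw [derMetric_symm, derMetric_eq_sum hM ha hp, Finset.sum_comm_cycle]
    refine Finset.sum_congr rfl fun l _ => ?_
    rw [Finset.sum_comm]
    refine Finset.sum_congr rfl fun ν _ => Finset.sum_congr rfl fun μ _ => by ring
  rw [h4, h5, h6, derMetric_eq_sum hM ha hp]
  simp only [h1, mul_sub, mul_add, Finset.sum_add_distrib, Finset.sum_sub_distrib, Finset.mul_sum]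
  congr 1
  · congr 1
    all_goals
      refine Finset.sum_congr rfl fun l _ => Finset.sum_congr rfl fun ν _ =>
        Finset.sum_congr rfl fun μ _ => by ring
  · refine Finset.sum_congr rfl fun l _ => Finset.sum_congr rfl fun ν _ =>
      Finset.sum_congr rfl fun μ _ => by ring

variable {e' : Field₁}

/-! ### Consequences of torsion-freeness and metric compatibility. -/

lemma conn_eq (hM : 0 < M) (ha : |a| ≤ M) (hp : p ∈ exterior M a) (Z V : Fin 4 → ℝ) :
    conn M a p e Z V = flat M a p V ⬝ᵥ derField M a p e Z
      + 1 / 2 * (derMetric M a p Z (e p) V + derMetric M a p (e p) Z V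
        - derMetric M a p V Z (e p)) := by
  rw [conn, nab, dotProduct_add, flat_dot_Gam hM ha hp]

/-- The covariant derivative commutes with lowering an index. -/
lemma cov₁_lower (hM : 0 < M) (ha : |a| ≤ M) (hp : p ∈ exterior M a)
    (he : ∀ ν, DiffAt M a p fun q => e q ν) (Z V : Fin 4 → ℝ) :
    cov₁ M a p (lower M a e) Z V = conn M a p e Z V := by
  have hu := uniqueDiffWithinAt_exterior hM hp
  have h1 : der M a p (fun q => lower M a e q ⬝ᵥ V) Z
      = derMetric M a p Z V (e p) + flat M a p V ⬝ᵥ derField M a p e Z := by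
    simp only [← flat_eq_lower]
    rw [show (fun q => flat M a q (e q) ⬝ᵥ V) = fun q => flat M a q V ⬝ᵥ e q from
      funext fun q => flat_dot_symm _ _, der_dot hu Z (diffAt_flat hM ha hp V) he]
    rfl
  rw [cov₁, h1, ← flat_eq_lower, flat_dot_Gam hM ha hp, conn_eq hM ha hp,
    derMetric_symm Z V, derMetric_symm V Z]
  ring

/-- Antisymmetrising removes the Christoffel symbols, so the antisymmetric part of g(∇_Z e, V) is
the exterior derivative of the lowered field. Here Z and V have constant components. -/
lemma conn_sub_conn (hM : 0 < M) (ha : |a| ≤ M) (hp : p ∈ exterior M a)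
    (he : ∀ ν, DiffAt M a p fun q => e q ν) (Z V : Fin 4 → ℝ) :
    conn M a p e Z V - conn M a p e V Z = der M a p (fun q => lower M a e q ⬝ᵥ V) Z
      - der M a p (fun q => lower M a e q ⬝ᵥ Z) V := by
  rw [← cov₁_lower hM ha hp he, ← cov₁_lower hM ha hp he, cov₁, cov₁, Gam_symm]
  ring

/-- The symmetric part of ∇e is given by the Lie derivative of g along e; the right side is its
coordinate expression. -/
lemma conn_add_conn (hM : 0 < M) (ha : |a| ≤ M) (hp : p ∈ exterior M a) (Z V : Fin 4 → ℝ) :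
    conn M a p e Z V + conn M a p e V Z = derMetric M a p (e p) Z V
      + flat M a p V ⬝ᵥ derField M a p e Z + flat M a p Z ⬝ᵥ derField M a p e V := by
  rw [conn_eq hM ha hp, conn_eq hM ha hp, derMetric_symm Z (e p), derMetric_symm V (e p),
    derMetric_symm (e p) V]
  ring

/-- Torsion-freeness: ∇_e e' - ∇_{e'} e is the bracket [e, e'], computed here from plain derivatives
of components. -/
lemma conn_bracket (V : Fin 4 → ℝ) :
    conn M a p e' (e p) V - conn M a p e (e' p) V
      = flat M a p V ⬝ᵥ (derField M a p e' (e p) - derField M a p e (e' p)) := by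
  rw [conn, conn, nab, nab, Gam_symm (e' p), ← dotProduct_sub]
  congr 1
  abel

/-- If the one-form `s` annihilates `e`, then `(∇_Z s)(e) = -s(∇_Z e)`. More generally this holds
when `s(e)` is constant. -/
lemma cov₁_of_dot_const (hu : UniqueDiffWithinAt ℝ (exterior M a) p) (hp : p ∈ exterior M a)
    (hs : ∀ ν, DiffAt M a p fun q => s q ν) (he : ∀ ν, DiffAt M a p fun q => e q ν)
    {c : ℝ} (h : ∀ q ∈ exterior M a, s q ⬝ᵥ e q = c) (Z : Fin 4 → ℝ) :
    cov₁ M a p s Z (e p) = -(s p ⬝ᵥ nab M a p e Z) := by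
  have h1 := der_dot hu Z hs he
  rw [der_congr h hp, der_const] at h1
  rw [cov₁, nab, dotProduct_add]
  change 0 = _ + s p ⬝ᵥ derField M a p e Z at h1
  linarith

lemma conn_of_dot_const (hM : 0 < M) (ha : |a| ≤ M) (hp : p ∈ exterior M a)
    (he : ∀ ν, DiffAt M a p fun q => e q ν) (he' : ∀ ν, DiffAt M a p fun q => e' q ν)
    {c : ℝ} (h : ∀ q ∈ exterior M a, flat M a q (e q) ⬝ᵥ e' q = c) (Z : Fin 4 → ℝ) :
    conn M a p e Z (e' p) = -conn M a p e' Z (e p) := by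
  have hu := uniqueDiffWithinAt_exterior hM hp
  rw [← cov₁_lower hM ha hp he, cov₁_of_dot_const hu hp (diffAt_lower hM ha hp he) he' h,
    conn, flat_eq_lower]

/-! ### Exterior derivatives of the one-forms `lower e₃` and `lower e₄` -/

/-- The exterior derivative of the one-form `sin² θ dφ̄`. -/
noncomputable def dSin (p : Point) (Z V : Fin 4 → ℝ) : ℝ :=
  2 * (Z 1 * V 2 - Z 2 * V 1) / rad p ^ 2
    - 2 / rad p * ((dr p ⬝ᵥ Z) * (sinSqdφ p ⬝ᵥ V) - (dr p ⬝ᵥ V) * (sinSqdφ p ⬝ᵥ Z))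

lemma der_sinSqdφ_dot (hu : UniqueDiffWithinAt ℝ (exterior M a) p) (hr : 0 < rad p)
    (Z V : Fin 4 → ℝ) : der M a p (fun q => sinSqdφ q ⬝ᵥ V) Z
      = (Z 1 * V 2 - Z 2 * V 1) / rad p ^ 2 - 2 / rad p * (dr p ⬝ᵥ Z) * (sinSqdφ p ⬝ᵥ V) := by
  have h1 : DiffAt M a p fun q => q 1 * V 2 := (diffAt_coord 1).mul (diffAt_const _)
  have h2 : DiffAt M a p fun q => q 2 * V 1 := (diffAt_coord 2).mul (diffAt_const _)
  simp only [sinSqdφ_dot]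
  rw [der_div hu Z (h1.sub h2) ((diffAt_rad hr).pow 2) (by positivity), der_sub hu Z h1 h2,
    der_mul hu Z (diffAt_coord 1) (diffAt_const _), der_mul hu Z (diffAt_coord 2) (diffAt_const _),
    der_const, der_const, der_coord hu, der_coord hu, der_sq hu Z (diffAt_rad hr), der_rad hu hr]
  field_simp
  ring

lemma der_theta_dot (hu : UniqueDiffWithinAt ℝ (exterior M a) p) (hr : 0 < rad p)
    (Z V : Fin 4 → ℝ) : der M a p (fun q => theta a q ⬝ᵥ V) Z
      = -a * der M a p (fun q => sinSqdφ q ⬝ᵥ V) Z := by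
  have hs := DiffAt.dot_const (M := M) (a := a) (diffAt_sinSqdφ hr) V
  simp only [theta_dot]
  rw [der_sub hu Z (diffAt_const _) ((diffAt_const a).mul hs), der_const,
    der_const_mul hu Z a hs]
  ring

lemma der_dr (hu : UniqueDiffWithinAt ℝ (exterior M a) p) (hr : 0 < rad p)
    (Z : Fin 4 → ℝ) (ν : Fin 4) : der M a p (fun q => dr q ν) Z
      = (spatial Z ν - dr p ν * (dr p ⬝ᵥ Z)) / rad p := by
  have key : ∀ i, der M a p (fun q => q i / rad q) Z =
      (Z i - p i / rad p * (dr p ⬝ᵥ Z)) / rad p := by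
    intro i
    rw [der_div hu Z (diffAt_coord i) (diffAt_rad hr) hr.ne', der_coord hu, der_rad hu hr]
    field_simp
  fin_cases ν
  · simp [dr, spatial, der_const]
  · exact key 1
  · exact key 2
  · exact key 3

lemma der_dr_dot (hu : UniqueDiffWithinAt ℝ (exterior M a) p) (hr : 0 < rad p)
    (Z V : Fin 4 → ℝ) : der M a p (fun q => dr q ⬝ᵥ V) Z
      = (Z 1 * V 1 + Z 2 * V 2 + Z 3 * V 3 - (dr p ⬝ᵥ Z) * (dr p ⬝ᵥ V)) / rad p := by
  rw [der_dot_const hu Z (diffAt_dr hr)]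
  simp only [der_dr hu hr]
  simp only [dotProduct, Fin.sum_univ_four, spatial, Matrix.cons_val]
  simp [dr]
  ring

/-- The lowered e₃ is -dt̄ + a sin² θ dφ̄, and dt̄ is closed. -/
lemma d_lower_e3 (hM : 0 < M) (ha : |a| ≤ M) (hp : p ∈ exterior M a) (Z V : Fin 4 → ℝ) :
    der M a p (fun q => lower M a e3 q ⬝ᵥ V) Z - der M a p (fun q => lower M a e3 q ⬝ᵥ Z) V
      = a * dSin p Z V := by
  have hr := rad_pos hM hp
  have hu := uniqueDiffWithinAt_exterior hM hp
  have key : ∀ Z V, der M a p (fun q => lower M a e3 q ⬝ᵥ V) Z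
      = a * der M a p (fun q => sinSqdφ q ⬝ᵥ V) Z := by
    intro Z V
    rw [der_congr (f := fun q => lower M a e3 q ⬝ᵥ V) (g := fun q => -(theta a q ⬝ᵥ V))
        (fun q hq => flat_e3_dot ha (rad_pos hM hq) V) hp,
      der_neg hu, der_theta_dot hu hr]
    ring
  rw [key, key, der_sinSqdφ_dot hu hr, der_sinSqdφ_dot hu hr, dSin]
  ring

/-- The lowered e₄ is 2dr - (Δ/Σ)(dt̄ - a sin² θ dφ̄), and dr is closed. -/
lemma d_lower_e4 (hM : 0 < M) (ha : |a| ≤ M) (hp : p ∈ exterior M a) (Z V : Fin 4 → ℝ) :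
    der M a p (fun q => lower M a (e4 M a) q ⬝ᵥ V) Z
        - der M a p (fun q => lower M a (e4 M a) q ⬝ᵥ Z) V
      = quot M a p * a * dSin p Z V - (der M a p (quot M a) Z * (theta a p ⬝ᵥ V)
        - der M a p (quot M a) V * (theta a p ⬝ᵥ Z)) := by
  have hr := rad_pos hM hp
  have hu := uniqueDiffWithinAt_exterior hM hp
  have key : ∀ Z V, der M a p (fun q => lower M a (e4 M a) q ⬝ᵥ V) Z
      = 2 * der M a p (fun q => dr q ⬝ᵥ V) Z
        + quot M a p * a * der M a p (fun q => sinSqdφ q ⬝ᵥ V) Z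
        - der M a p (quot M a) Z * (theta a p ⬝ᵥ V) := by
    intro Z V
    have h1 := DiffAt.dot_const (M := M) (a := a) (diffAt_theta hr) V
    have h2 := DiffAt.dot_const (M := M) (a := a) (diffAt_dr hr) V
    rw [der_congr (f := fun q => lower M a (e4 M a) q ⬝ᵥ V)
        (g := fun q => 2 * (dr q ⬝ᵥ V) - quot M a q * (theta a q ⬝ᵥ V))
        (fun q hq => flat_e4_dot ha (rad_pos hM hq) V) hp,
      der_sub hu Z ((diffAt_const 2).mul h2) ((diffAt_quot hr).mul h1), der_const_mul hu Z 2 h2,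
      der_mul hu Z (diffAt_quot hr) h1, der_theta_dot hu hr]
    ring
  rw [key, key, der_sinSqdφ_dot hu hr, der_sinSqdφ_dot hu hr, der_dr_dot hu hr, der_dr_dot hu hr,
    dSin]
  ring

lemma dSin_symm (Z V : Fin 4 → ℝ) : dSin p Z V = -dSin p V Z := by
  unfold dSin; ring

/-- The form sin² θ dφ̄ is pulled back from the sphere, so its exterior derivative annihilates the
radial direction. -/
lemma dSin_e3 (hr : 0 < rad p) (V : Fin 4 → ℝ) : dSin p (e3 p) V = 0 := by
  rw [dSin, dr_dot_e3 hr, sinSqdφ_dot_e3, sinSqdφ_dot]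
  simp only [e3, Matrix.cons_val]
  field_simp
  ring

/-- A vector at `p` orthogonal to `e₃` and `e₄`. -/
structure IsHor (a : ℝ) (p : Point) (U : Fin 4 → ℝ) : Prop where
  theta_dot : theta a p ⬝ᵥ U = 0
  dr_dot : dr p ⬝ᵥ U = 0

lemma IsFrame.hor_X (h : IsFrame a p X Y) : IsHor a p X := ⟨h.theta_X, h.dr_X⟩

lemma IsFrame.hor_Y (h : IsFrame a p X Y) : IsHor a p Y := ⟨h.theta_Y, h.dr_Y⟩

lemma IsHor.coords (h : IsHor a p U) (hr : 0 < rad p) : p 1 * U 1 + p 2 * U 2 + p 3 * U 3 = 0 := by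
  have := h.dr_dot
  rwa [Kerr.dr_dot, div_eq_zero_iff, or_iff_left hr.ne'] at this

lemma dSin_hor (hU : IsHor a p U) (hV : IsHor a p V) :
    dSin p U V = 2 * (U 1 * V 2 - U 2 * V 1) / rad p ^ 2 := by
  rw [dSin, hU.dr_dot, hV.dr_dot]; ring

/-- The exterior derivative is -2 cos θ d cos θ ∧ dφ̄, and e₄ has φ̄-component 2a/Σ and is
annihilated by d cos θ. -/
lemma dSin_e4_hor (hr : 0 < rad p) (hU : IsHor a p U) :
    dSin p (e4 M a p) U = 4 * a * cosθ p / Sig a p * (U 3 / rad p) := by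
  have hS := (Sig_pos a hr).ne'
  have h1 := hU.coords hr
  rw [dSin, dr_dot_e4 hr, hU.dr_dot, sinSqdφ_dot]
  simp only [e4_eq, dt, dr, axial, Matrix.cons_val, cosθ]
  field_simp
  linear_combination -4 * a * rad p * h1

/-! ### Derivatives of the null vectors and of the metric -/

/-- The rotation `∂_φ̄` around the axis, as a linear map. -/
def spin (V : Fin 4 → ℝ) : Fin 4 → ℝ := ![0, -V 2, V 1, 0]

lemma derField_e3 (hu : UniqueDiffWithinAt ℝ (exterior M a) p) (hr : 0 < rad p)
    (Z : Fin 4 → ℝ) : derField M a p e3 Z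
      = (-1 / rad p) • spatial Z + ((dr p ⬝ᵥ Z) / rad p) • dr p := by
  funext ν
  simp only [derField, e3_eq]
  rw [der_neg hu, der_dr hu hr]
  simp only [Pi.add_apply, Pi.smul_apply, smul_eq_mul]
  ring

/-- The function `2 a / Σ`, the component of `e₄` along `∂_φ̄`. -/
noncomputable def angular (a : ℝ) (p : Point) : ℝ := 2 * a / Sig a p

lemma diffAt_angular (hr : 0 < rad p) : DiffAt M a p (angular a) :=
  (diffAt_const _).div (diffAt_Sig hr) (Sig_pos a hr).ne'

lemma der_angular (hu : UniqueDiffWithinAt ℝ (exterior M a) p) (hr : 0 < rad p)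
    (Z : Fin 4 → ℝ) : der M a p (angular a) Z = -(2 * a * der M a p (Sig a) Z / Sig a p ^ 2) := by
  unfold angular
  rw [der_div hu Z (diffAt_const _) (diffAt_Sig hr) (Sig_pos a hr).ne', der_const]
  ring

/-- The time component is rewritten through `theta a p ⬝ᵥ e4 M a p = 2`, so that differentiating e₄
involves only Δ/Σ, 2a/Σ, cos θ and the coordinate fields. -/
lemma e4_eq_angular (hr : 0 < rad p) (μ : Fin 4) : e4 M a p μ =
    (2 + a * (angular a p * (1 - cosθ p ^ 2))) * dt p μ + quot M a p * dr p μ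
      + angular a p * axial p μ := by
  have hS := (Sig_pos a hr).ne'
  have : 2 * (rad p ^ 2 + a ^ 2) / Sig a p = 2 + a * (angular a p * (1 - cosθ p ^ 2)) := by
    rw [angular]
    field_simp
    rw [Sig]; ring
  rw [e4_eq, this, angular]

lemma derField_e4 (hM : 0 < M) (hp : p ∈ exterior M a)
    (Z : Fin 4 → ℝ) : derField M a p (e4 M a) Z
      = (a * (der M a p (angular a) Z * (1 - cosθ p ^ 2)
          - angular a p * (2 * cosθ p * (dcos p ⬝ᵥ Z)))) • dt p
        + (der M a p (quot M a) Z - quot M a p * (dr p ⬝ᵥ Z) / rad p) • dr p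
        + (quot M a p / rad p) • spatial Z
        + der M a p (angular a) Z • axial p + angular a p • spin Z := by
  have hr := rad_pos hM hp
  have hu := uniqueDiffWithinAt_exterior hM hp
  have hb := diffAt_angular (M := M) (a := a) hr
  have hc : DiffAt M a p fun q => 1 - cosθ q ^ 2 := (diffAt_const 1).sub ((diffAt_cosθ hr).pow 2)
  have hT : DiffAt M a p fun q => 2 + a * (angular a q * (1 - cosθ q ^ 2)) :=
    (diffAt_const 2).add ((diffAt_const a).mul (hb.mul hc))
  have hax : ∀ ν, der M a p (fun q => axial q ν) Z = spin Z ν := by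
    intro ν
    fin_cases ν
    · exact der_const Z 0
    · exact (der_neg hu Z).trans (congrArg Neg.neg (der_coord hu Z 2))
    · exact der_coord hu Z 1
    · exact der_const Z 0
  funext ν
  have hdt : der M a p (fun q => dt q ν) Z = 0 := der_const Z _
  rw [derField, der_congr (fun q hq => e4_eq_angular (rad_pos hM hq) ν) hp,
    der_add hu Z ((hT.mul (diffAt_dt ν)).add ((diffAt_quot hr).mul (diffAt_dr hr ν)))
      (hb.mul (diffAt_axial ν)),
    der_add hu Z (hT.mul (diffAt_dt ν)) ((diffAt_quot hr).mul (diffAt_dr hr ν)),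
    der_mul hu Z hT (diffAt_dt ν), der_mul hu Z (diffAt_quot hr) (diffAt_dr hr ν),
    der_mul hu Z hb (diffAt_axial ν), hax, hdt, der_dr hu hr,
    der_add hu Z (diffAt_const 2) ((diffAt_const a).mul (hb.mul hc)), der_const,
    der_const_mul hu Z a (hb.mul hc), der_mul hu Z hb hc,
    der_sub hu Z (diffAt_const 1) ((diffAt_cosθ hr).pow 2), der_const,
    der_sq hu Z (diffAt_cosθ hr), der_cosθ hu hr]
  simp only [Pi.add_apply, Pi.smul_apply, smul_eq_mul]
  ring

lemma flat_hor_dot (ha : |a| ≤ M) (hr : 0 < rad p) (hU : IsHor a p U) (V : Fin 4 → ℝ) :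
    flat M a p U ⬝ᵥ V = Sig a p / rad p ^ 2 * (U 1 * V 1 + U 2 * V 2 + U 3 * V 3)
      - a * (sinSqdφ p ⬝ᵥ U) * (V 0 - a * (sinSqdφ p ⬝ᵥ V)) := by
  rw [flat_horizontal_dot ha hr hU.theta_dot hU.dr_dot, Kerr.theta_dot]

lemma flat_hor_dot_dt (ha : |a| ≤ M) (hr : 0 < rad p) (hU : IsHor a p U) :
    flat M a p U ⬝ᵥ dt p = -a * (sinSqdφ p ⬝ᵥ U) := by
  rw [flat_hor_dot ha hr hU, sinSqdφ_dot (dt p)]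
  simp [dt]

lemma flat_hor_dot_dr (ha : |a| ≤ M) (hr : 0 < rad p) (hU : IsHor a p U) :
    flat M a p U ⬝ᵥ dr p = 0 := by
  rw [flat_hor_dot ha hr hU, sinSqdφ_dot_dr]
  simp only [dr, Matrix.cons_val]
  have h1 := hU.coords hr
  field_simp
  linear_combination Sig a p * h1

lemma flat_hor_dot_spatial (ha : |a| ≤ M) (hr : 0 < rad p) (hU : IsHor a p U) (V : Fin 4 → ℝ) :
    flat M a p U ⬝ᵥ spatial V = Sig a p / rad p ^ 2 * (U 1 * V 1 + U 2 * V 2 + U 3 * V 3)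
      + a ^ 2 * (sinSqdφ p ⬝ᵥ U) * (sinSqdφ p ⬝ᵥ V) := by
  rw [flat_hor_dot ha hr hU, sinSqdφ_dot (spatial V), sinSqdφ_dot V]
  simp only [spatial, Matrix.cons_val]
  ring

lemma flat_hor_dot_axial (ha : |a| ≤ M) (hr : 0 < rad p) (hU : IsHor a p U) :
    flat M a p U ⬝ᵥ axial p
      = (Sig a p + a ^ 2 * (1 - cosθ p ^ 2)) * (sinSqdφ p ⬝ᵥ U) := by
  rw [flat_hor_dot ha hr hU, sinSqdφ_dot (axial p), ← sin_sq_eq hr, sinSqdφ_dot U]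
  simp only [axial, Matrix.cons_val]
  ring

lemma flat_hor_dot_spin (ha : |a| ≤ M) (hr : 0 < rad p) (hU : IsHor a p U) (hV : IsHor a p V) :
    flat M a p U ⬝ᵥ spin V = Sig a p / rad p ^ 2 * (U 2 * V 1 - U 1 * V 2)
      - a ^ 2 * (sinSqdφ p ⬝ᵥ U) * (cosθ p * (V 3 / rad p)) := by
  have h1 := hV.coords hr
  have h2 : sinSqdφ p ⬝ᵥ spin V = -(cosθ p * (V 3 / rad p)) := by
    rw [sinSqdφ_dot, cosθ]
    simp only [spin, Matrix.cons_val]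
    field_simp
    linear_combination h1
  rw [flat_hor_dot ha hr hU, h2]
  simp only [spin, Matrix.cons_val]
  ring

/-- U and V are constant vectors, horizontal at p only. In the adapted form of the metric, products
of two factors among `theta` and `dr` vanish at p together with their first derivatives. The mixed
terms with `sinSqdφ` survive through the derivative of `theta`, which is -a times that of `sinSqdφ`.
-/
lemma derMetric_hor (hM : 0 < M) (ha : |a| ≤ M) (hp : p ∈ exterior M a)
    (hU : IsHor a p U) (hV : IsHor a p V) (Z : Fin 4 → ℝ) : derMetric M a p Z U V
      = (der M a p (Sig a) Z - 2 * Sig a p / rad p * (dr p ⬝ᵥ Z)) / rad p ^ 2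
          * (U 1 * V 1 + U 2 * V 2 + U 3 * V 3)
        + a ^ 2 * ((sinSqdφ p ⬝ᵥ U) * der M a p (fun q => sinSqdφ q ⬝ᵥ V) Z
          + (sinSqdφ p ⬝ᵥ V) * der M a p (fun q => sinSqdφ q ⬝ᵥ U) Z) := by
  have hr := rad_pos hM hp
  have hu := uniqueDiffWithinAt_exterior hM hp
  have hS1 := diffAt_Sig (M := M) (a := a) hr
  have hS := (Sig_pos a hr).ne'
  have ht := fun W => DiffAt.dot_const (M := M) (a := a) (diffAt_theta hr) W
  have hd := fun W => DiffAt.dot_const (M := M) (a := a) (diffAt_dr hr) W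
  have hs := fun W => DiffAt.dot_const (M := M) (a := a) (diffAt_sinSqdφ hr) W
  have hc : DiffAt M a p fun q => a ^ 2 * (1 - cosθ q ^ 2) / Sig a q - quot M a q :=
    (((diffAt_const (a ^ 2)).mul ((diffAt_const 1).sub ((diffAt_cosθ hr).pow 2))).div hS1 hS).sub
      (diffAt_quot hr)
  have hQ : DiffAt M a p fun q => Sig a q / rad q ^ 2 :=
    hS1.div ((diffAt_rad hr).pow 2) (by positivity)
  -- The coefficient of `theta` ⊗ `theta` is made opaque: its derivative is multiplied by zero.
  obtain ⟨k, hk⟩ : ∃ k : Point → ℝ, k = fun q => a ^ 2 * (1 - cosθ q ^ 2) / Sig a q - quot M a q :=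
    ⟨_, rfl⟩
  rw [← hk] at hc
  have h1 : ∀ q ∈ exterior M a, flat M a q U ⬝ᵥ V
      = Sig a q / rad q ^ 2
          * ((U 1 * V 1 + U 2 * V 2 + U 3 * V 3) - (dr q ⬝ᵥ U) * (dr q ⬝ᵥ V))
        - a * ((sinSqdφ q ⬝ᵥ V) * (theta a q ⬝ᵥ U) + (sinSqdφ q ⬝ᵥ U) * (theta a q ⬝ᵥ V))
        + k q * ((theta a q ⬝ᵥ U) * (theta a q ⬝ᵥ V))
        + ((dr q ⬝ᵥ U) * (theta a q ⬝ᵥ V) + (dr q ⬝ᵥ V) * (theta a q ⬝ᵥ U)) := by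
    intro q hq
    have h2 : flat M a q U = (Sig a q / rad q ^ 2) • spatial U
        - (Sig a q / rad q ^ 2 * (dr q ⬝ᵥ U)) • dr q
        - (a * (theta a q ⬝ᵥ U)) • sinSqdφ q - (a * (sinSqdφ q ⬝ᵥ U)) • theta a q
        + (k q * (theta a q ⬝ᵥ U)) • theta a q + (dr q ⬝ᵥ U) • theta a q
        + (theta a q ⬝ᵥ U) • dr q := by
      funext μ
      rw [flat, metric_mulVec ha (rad_pos hM hq), hk]
      simp only [Pi.sub_apply, Pi.add_apply, Pi.smul_apply, smul_eq_mul]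
      ring
    have h3 : spatial U ⬝ᵥ V = U 1 * V 1 + U 2 * V 2 + U 3 * V 3 := by
      simp [spatial, dotProduct, Fin.sum_univ_four]
    rw [h2]
    simp only [sub_dotProduct, add_dotProduct, smul_dotProduct, smul_eq_mul, h3]
    ring
  have hA := (diffAt_const (M := M) (a := a) (p := p) (U 1 * V 1 + U 2 * V 2 + U 3 * V 3)).sub
    ((hd U).mul (hd V))
  have hB := ((hs V).mul (ht U)).add ((hs U).mul (ht V))
  have hC := (ht U).mul (ht V)
  have hD := ((hd U).mul (ht V)).add ((hd V).mul (ht U))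
  rw [derMetric, der_congr h1 hp,
    der_add hu Z (((hQ.mul hA).sub ((diffAt_const a).mul hB)).add (hc.mul hC)) hD,
    der_add hu Z ((hQ.mul hA).sub ((diffAt_const a).mul hB)) (hc.mul hC),
    der_sub hu Z (hQ.mul hA) ((diffAt_const a).mul hB), der_mul hu Z hQ hA,
    der_const_mul hu Z a hB, der_mul hu Z hc hC, der_mul hu Z (ht U) (ht V),
    der_add hu Z ((hs V).mul (ht U)) ((hs U).mul (ht V)),
    der_add hu Z ((hd U).mul (ht V)) ((hd V).mul (ht U)),
    der_mul hu Z (hs V) (ht U), der_mul hu Z (hs U) (ht V), der_mul hu Z (hd U) (ht V),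
    der_mul hu Z (hd V) (ht U), der_sub hu Z (diffAt_const _) ((hd U).mul (hd V)), der_const,
    der_mul hu Z (hd U) (hd V), der_theta_dot hu hr, der_theta_dot hu hr,
    hU.theta_dot, hU.dr_dot, hV.theta_dot, hV.dr_dot,
    der_div hu Z hS1 ((diffAt_rad hr).pow 2) (by positivity), der_sq hu Z (diffAt_rad hr),
    der_rad hu hr]
  field_simp
  ring

/-! ### The connection coefficients of the null frame -/

lemma diffAt_e3_of_mem (hM : 0 < M) (hp : p ∈ exterior M a) (ν : Fin 4) :
    DiffAt M a p fun q => e3 q ν := diffAt_e3 (rad_pos hM hp) ν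

lemma diffAt_e4_of_mem (hM : 0 < M) (hp : p ∈ exterior M a) (ν : Fin 4) :
    DiffAt M a p fun q => e4 M a q ν := diffAt_e4 (rad_pos hM hp) ν

lemma conn_e3_to_e3 (hM : 0 < M) (ha : |a| ≤ M) (hp : p ∈ exterior M a) (Z : Fin 4 → ℝ) :
    conn M a p e3 Z (e3 p) = 0 := by
  have h := conn_of_dot_const hM ha hp (diffAt_e3_of_mem hM hp) (diffAt_e3_of_mem hM hp)
    (c := 0) (fun q hq => by rw [flat_e3_dot ha (rad_pos hM hq), theta_dot_e3, neg_zero]) Z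
  linarith

lemma conn_e4_to_e4 (hM : 0 < M) (ha : |a| ≤ M) (hp : p ∈ exterior M a) (Z : Fin 4 → ℝ) :
    conn M a p (e4 M a) Z (e4 M a p) = 0 := by
  have h := conn_of_dot_const hM ha hp (diffAt_e4_of_mem hM hp) (diffAt_e4_of_mem hM hp)
    (c := 0) (fun q hq => by
      rw [flat_e4_dot ha (rad_pos hM hq), theta_dot_e4 (rad_pos hM hq),
        dr_dot_e4 (rad_pos hM hq)]
      ring) Z
  linarith

lemma conn_e4_to_e3 (hM : 0 < M) (ha : |a| ≤ M) (hp : p ∈ exterior M a) (Z : Fin 4 → ℝ) :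
    conn M a p (e4 M a) Z (e3 p) = -conn M a p e3 Z (e4 M a p) :=
  conn_of_dot_const hM ha hp (diffAt_e4_of_mem hM hp) (diffAt_e3_of_mem hM hp)
    (c := -2) (fun q hq => by
      rw [flat_dot_symm, flat_e3_dot ha (rad_pos hM hq), theta_dot_e4 (rad_pos hM hq)]) Z

/-- The integral curves of e₃ are affinely parametrised null geodesics: e₃ has constant length and
contracts to zero with the exterior derivative of its own lowered form. -/
lemma conn_e3_along_e3 (hM : 0 < M) (ha : |a| ≤ M) (hp : p ∈ exterior M a) (V : Fin 4 → ℝ) :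
    conn M a p e3 (e3 p) V = 0 := by
  have h := conn_sub_conn hM ha hp (diffAt_e3_of_mem hM hp) (e3 p) V
  rw [d_lower_e3 hM ha hp, dSin_e3 (rad_pos hM hp), conn_e3_to_e3 hM ha hp] at h
  linarith

/-- Evaluate the exterior derivative of the lowered e₄ on e₄ and e₃; only the radial derivative of
Δ/Σ is left. -/
lemma conn_e3_e4_e4 (hM : 0 < M) (ha : |a| ≤ M) (hp : p ∈ exterior M a) :
    conn M a p e3 (e4 M a p) (e4 M a p) = 2 * quotR M a p := by
  have hr := rad_pos hM hp
  have hu := uniqueDiffWithinAt_exterior hM hp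
  have h := conn_sub_conn hM ha hp (diffAt_e4_of_mem hM hp) (e4 M a p) (e3 p)
  rw [d_lower_e4 hM ha hp, dSin_symm, dSin_e3 hr, conn_e4_to_e4 hM ha hp, conn_e4_to_e3 hM ha hp,
    theta_dot_e3, theta_dot_e4 hr, der_quot hu hr (e3 p), dcos_dot_e3 hr, dr_dot_e3 hr] at h
  linarith

/-- So e₄ is geodesic up to parametrisation: the contribution of d(sin² θ dφ̄) cancels that of the
horizontal derivative of Δ/Σ. -/
lemma conn_e4_e4_hor (hM : 0 < M) (ha : |a| ≤ M) (hp : p ∈ exterior M a) (hU : IsHor a p U) :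
    conn M a p (e4 M a) (e4 M a p) U = 0 := by
  have hr := rad_pos hM hp
  have hu := uniqueDiffWithinAt_exterior hM hp
  have h := conn_sub_conn hM ha hp (diffAt_e4_of_mem hM hp) (e4 M a p) U
  have hc : dcos p ⬝ᵥ U = U 3 / rad p := by rw [dcos_dot hr, hU.dr_dot]; ring
  rw [d_lower_e4 hM ha hp, dSin_e4_hor hr hU, conn_e4_to_e4 hM ha hp,
    hU.theta_dot, theta_dot_e4 hr, der_quot hu hr U, hc, hU.dr_dot] at h
  linear_combination h

/-- Half the sum of the symmetric part, from the Lie derivative of g, and the antisymmetric part,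
from `d_lower_e3`. There is no trace-free symmetric part, which means that the null congruence is
shear-free. -/
lemma conn_e3_hor_hor (hM : 0 < M) (ha : |a| ≤ M) (hp : p ∈ exterior M a) (hU : IsHor a p U)
    (hV : IsHor a p V) : conn M a p e3 U V
      = -(U 1 * V 1 + U 2 * V 2 + U 3 * V 3) / rad p
        + a * (U 1 * V 2 - U 2 * V 1) / rad p ^ 2 := by
  have hr := rad_pos hM hp
  have hu := uniqueDiffWithinAt_exterior hM hp
  have h1 := conn_sub_conn hM ha hp (diffAt_e3_of_mem hM hp) U V
  have h2 := conn_add_conn (e := e3) hM ha hp U V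
  -- The vanishing of the exterior derivative on e₃ already determines this derivative along e₃.
  have hs : ∀ W, der M a p (fun q => sinSqdφ q ⬝ᵥ W) (e3 p) = (sinSqdφ p ⬝ᵥ W) / rad p := by
    intro W
    have := dSin_e3 hr W
    rw [dSin, sinSqdφ_dot_e3, dr_dot_e3 hr] at this
    rw [der_sinSqdφ_dot hu hr, dr_dot_e3 hr]
    linear_combination 1 / 2 * this
  rw [d_lower_e3 hM ha hp, dSin_hor hU hV] at h1
  rw [derMetric_hor hM ha hp hU hV, hs, hs, der_Sig hu hr, dr_dot_e3 hr, dcos_dot_e3 hr,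
    derField_e3 hu hr, derField_e3 hu hr, hU.dr_dot, hV.dr_dot, dotProduct_add, dotProduct_add,
    dotProduct_smul, dotProduct_smul, dotProduct_smul, dotProduct_smul,
    flat_hor_dot_spatial ha hr hU, flat_hor_dot_spatial ha hr hV] at h2
  simp only [smul_eq_mul] at h2
  field_simp at h1 h2 ⊢
  refine mul_left_cancel₀ hr.ne' ?_
  linear_combination rad p / 2 * h1 + 1 / 2 * h2

/-- The second congruence is shear-free as well; the terms from the angular part of e₄ cancel
between its component derivatives and the derivative of the metric along e₄. -/
lemma conn_e4_hor_hor (hM : 0 < M) (ha : |a| ≤ M) (hp : p ∈ exterior M a) (hU : IsHor a p U)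
    (hV : IsHor a p V) : conn M a p (e4 M a) U V
      = quot M a p * (U 1 * V 1 + U 2 * V 2 + U 3 * V 3) / rad p
        + quot M a p * a * (U 1 * V 2 - U 2 * V 1) / rad p ^ 2 := by
  have hr := rad_pos hM hp
  have hu := uniqueDiffWithinAt_exterior hM hp
  have hS := (Sig_pos a hr).ne'
  have h1 := conn_sub_conn hM ha hp (diffAt_e4_of_mem hM hp) U V
  have h2 := conn_add_conn (e := e4 M a) hM ha hp U V
  have hc : ∀ {W}, IsHor a p W → dcos p ⬝ᵥ W = W 3 / rad p := fun hW => by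
    rw [dcos_dot hr, hW.dr_dot]; ring
  have hs : ∀ {W}, IsHor a p W → der M a p (fun q => sinSqdφ q ⬝ᵥ W) (e4 M a p)
      = -(quot M a p * (sinSqdφ p ⬝ᵥ W)) / rad p
        + 2 * a * cosθ p / Sig a p * (W 3 / rad p) := by
    intro W hW
    have := dSin_e4_hor (M := M) hr hW
    rw [dSin, dr_dot_e4 hr, hW.dr_dot] at this
    rw [der_sinSqdφ_dot hu hr, dr_dot_e4 hr]
    linear_combination 1 / 2 * this
  rw [d_lower_e4 hM ha hp, dSin_hor hU hV, hU.theta_dot, hV.theta_dot] at h1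
  rw [derMetric_hor hM ha hp hU hV, hs hU, hs hV, der_Sig hu hr, dr_dot_e4 hr, dcos_dot_e4 hr,
    derField_e4 hM hp, derField_e4 hM hp, der_angular hu hr, der_angular hu hr, der_Sig hu hr,
    der_Sig hu hr, hU.dr_dot, hV.dr_dot, hc hU, hc hV] at h2
  simp only [dotProduct_add, dotProduct_smul, smul_eq_mul, flat_hor_dot_spatial ha hr hU,
    flat_hor_dot_spatial ha hr hV, flat_hor_dot_dt ha hr hU, flat_hor_dot_dt ha hr hV,
    flat_hor_dot_dr ha hr hU, flat_hor_dot_dr ha hr hV, flat_hor_dot_axial ha hr hU,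
    flat_hor_dot_axial ha hr hV, flat_hor_dot_spin ha hr hU hV, flat_hor_dot_spin ha hr hV hU,
    angular] at h2
  field_simp at h1 h2 ⊢
  refine mul_left_cancel₀ (mul_ne_zero hr.ne' (pow_ne_zero 2 hS)) ?_
  linear_combination rad p * Sig a p ^ 2 / 2 * h1 + 1 / 2 * h2

lemma conn_e4_hor_e3 (hM : 0 < M) (ha : |a| ≤ M) (hp : p ∈ exterior M a) (hU : IsHor a p U) :
    conn M a p (e4 M a) (e3 p) U = -conn M a p e3 U (e4 M a p) := by
  have hr := rad_pos hM hp
  have h := conn_sub_conn hM ha hp (diffAt_e4_of_mem hM hp) (e3 p) U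
  rw [d_lower_e4 hM ha hp, dSin_e3 hr, conn_e4_to_e3 hM ha hp, hU.theta_dot, theta_dot_e3] at h
  linarith

lemma conn_e3_e4_hor (hM : 0 < M) (ha : |a| ≤ M) (hp : p ∈ exterior M a) (hU : IsHor a p U) :
    conn M a p e3 (e4 M a p) U = conn M a p e3 U (e4 M a p)
      + 4 * a ^ 2 * cosθ p / Sig a p * (U 3 / rad p) := by
  have hr := rad_pos hM hp
  have h := conn_sub_conn hM ha hp (diffAt_e3_of_mem hM hp) (e4 M a p) U
  rw [d_lower_e3 hM ha hp, dSin_e4_hor hr hU] at h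
  linear_combination h

/-- The exterior derivatives of the two lowered null vectors express g(∇₃e₄, U) and g(∇₄e₃, U)
through this coefficient. The horizontal part of [e₃, e₄] is their difference and determines it. -/
lemma conn_e3_hor_e4 (hM : 0 < M) (ha : |a| ≤ M) (hp : p ∈ exterior M a) (hU : IsHor a p U) :
    conn M a p e3 U (e4 M a p) = -(2 * a ^ 2 * cosθ p / Sig a p * (U 3 / rad p))
      - 2 * a * rad p / Sig a p * (sinSqdφ p ⬝ᵥ U) := by
  have hr := rad_pos hM hp
  have hu := uniqueDiffWithinAt_exterior hM hp
  have hS := (Sig_pos a hr).ne'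
  have h := conn_bracket (M := M) (a := a) (p := p) (e := e3) (e' := e4 M a) U
  have h3 : spatial (e3 p) = -dr p := by
    funext μ; fin_cases μ <;> simp [spatial, e3, dr]
  have h4 : spatial (e4 M a p) = quot M a p • dr p + angular a p • axial p := by
    funext μ; fin_cases μ <;> simp [spatial, e4_eq, dr, dt, axial, angular]
  have h5 : spin (e3 p) = -(1 / rad p) • axial p := by
    funext μ; fin_cases μ <;> simp [spin, e3, axial] <;> ring
  rw [conn_e4_hor_e3 hM ha hp hU, conn_e3_e4_hor hM ha hp hU, derField_e4 hM hp,
    derField_e3 hu hr, h3, h4, h5, der_angular hu hr, der_Sig hu hr, dr_dot_e3 hr,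
    dcos_dot_e3 hr] at h
  simp only [dotProduct_sub, dotProduct_add, dotProduct_smul, smul_eq_mul, dotProduct_neg,
    smul_add, flat_hor_dot_dt ha hr hU, flat_hor_dot_dr ha hr hU, flat_hor_dot_axial ha hr hU,
    angular] at h
  field_simp at h ⊢
  refine mul_left_cancel₀ hS ?_
  linear_combination -1 / 2 * h

/-! ### Differentiability of the horizontal tensors -/

lemma diffAt_det {A : Field₂} (hA : ∀ μ ν, DiffAt M a p fun q => A q μ ν) :
    DiffAt M a p fun q => (A q).det := by
  simp only [Matrix.det_apply']
  exact DiffAt.sum fun g _ => (diffAt_const _).mul (DiffAt.prod fun i _ => hA _ _)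

lemma exists_frame (hM : 0 < M) (ha : |a| ≤ M) (hp : p ∈ exterior M a) :
    ∃ X Y, IsFrame a p X Y ∧ IsNullFrame M a p X Y := by
  obtain ⟨X, Y, h⟩ := exists_isFrame (a := a) (rad_pos hM hp)
  exact ⟨X, Y, h, h.isNullFrame ha (rad_pos hM hp)⟩

lemma det_metric_ne_zero (hM : 0 < M) (ha : |a| ≤ M) (hp : p ∈ exterior M a) :
    (metric M a p).det ≠ 0 := by
  obtain ⟨X, Y, -, hN⟩ := exists_frame hM ha hp
  intro h
  have := hN.det_metric
  rw [h] at this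
  norm_num at this

lemma diffAt_metricInv (hM : 0 < M) (ha : |a| ≤ M) (hp : p ∈ exterior M a) (μ ν : Fin 4) :
    DiffAt M a p fun q => metricInv M a q μ ν := by
  have h0 := det_metric_ne_zero hM ha hp
  -- Cramer's rule writes each entry of the inverse as a quotient of determinants.
  have h1 : ∀ q, metricInv M a q μ ν
      = ((metric M a q).updateRow ν (Pi.single μ 1)).det / (metric M a q).det := by
    intro q
    rw [metricInv, Matrix.inv_def, Matrix.smul_apply, Matrix.adjugate_apply, Ring.inverse_eq_inv',
      smul_eq_mul]
    ring
  simp only [h1]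
  refine DiffAt.div (diffAt_det (A := fun q => (metric M a q).updateRow ν (Pi.single μ 1))
    fun i j => ?_) (diffAt_det (diffAt_metric ha hM hp)) h0
  simp only [Matrix.updateRow_apply]
  split_ifs
  · exact diffAt_const _
  · exact diffAt_metric ha hM hp i j

lemma diffAt_hInv (hM : 0 < M) (ha : |a| ≤ M) (hp : p ∈ exterior M a) (μ ν : Fin 4) :
    DiffAt M a p fun q => hInv M a q μ ν :=
  (diffAt_metricInv hM ha hp μ ν).add ((diffAt_const _).mul
    (((diffAt_e3_of_mem hM hp μ).mul (diffAt_e4_of_mem hM hp ν)).add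
      ((diffAt_e4_of_mem hM hp μ).mul (diffAt_e3_of_mem hM hp ν))))

lemma diffAt_hVol (hM : 0 < M) (ha : |a| ≤ M) (hp : p ∈ exterior M a) (μ ν : Fin 4) :
    DiffAt M a p fun q => hVol M a q μ ν := by
  have h0 := det_metric_ne_zero hM ha hp
  have h1 : DiffAt M a p fun q => √|(metric M a q).det| :=
    DifferentiableWithinAt.sqrt (DifferentiableWithinAt.abs
      (diffAt_det (diffAt_metric ha hM hp)) h0) (abs_ne_zero.2 h0)
  refine (diffAt_const _).mul (h1.mul (diffAt_det
    (A := fun q => Matrix.of ![Pi.single μ 1, Pi.single ν 1, e3 q, e4 M a q]) fun i j => ?_))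
  fin_cases i
  · exact diffAt_const _
  · exact diffAt_const _
  · exact diffAt_e3_of_mem hM hp j
  · exact diffAt_e4_of_mem hM hp j

lemma diffAt_proj (hM : 0 < M) (ha : |a| ≤ M) (hp : p ∈ exterior M a) (μ ν : Fin 4) :
    DiffAt M a p fun q => proj M a q μ ν := by
  have h3 := diffAt_e3_of_mem (M := M) (a := a) hM hp
  have h4 := diffAt_e4_of_mem (M := M) (a := a) hM hp
  exact (diffAt_const _).add ((diffAt_const _).mul
    (((h3 μ).mul (diffAt_lower hM ha hp h4 ν)).add ((h4 μ).mul (diffAt_lower hM ha hp h3 ν))))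

lemma IsTwoForm.diffAt (hF : IsTwoForm M a F) (hp : p ∈ exterior M a) (μ ν : Fin 4) :
    DiffAt M a p fun q => F q μ ν :=
  ((hF.1 μ ν).differentiableOn (by simp)) p hp

lemma diffAt_alpha (hM : 0 < M) (ha : |a| ≤ M) (hF : IsTwoForm M a F) (hp : p ∈ exterior M a)
    (ν : Fin 4) : DiffAt M a p fun q => alpha M a F q ν :=
  DiffAt.sum fun μ _ => DiffAt.sum fun l _ =>
    ((diffAt_proj hM ha hp μ ν).mul (hF.diffAt hp μ l)).mul (diffAt_e4_of_mem hM hp l)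

lemma diffAt_alphaBar (hM : 0 < M) (ha : |a| ≤ M) (hF : IsTwoForm M a F) (hp : p ∈ exterior M a)
    (ν : Fin 4) : DiffAt M a p fun q => alphaBar M a F q ν :=
  DiffAt.sum fun μ _ => DiffAt.sum fun l _ =>
    ((diffAt_proj hM ha hp μ ν).mul (hF.diffAt hp μ l)).mul (diffAt_e3_of_mem hM hp l)

lemma diffAt_rho (hM : 0 < M) (hF : IsTwoForm M a F) (hp : p ∈ exterior M a) :
    DiffAt M a p (rho M a F) :=
  (diffAt_const _).mul (DiffAt.sum fun μ _ => DiffAt.sum fun ν _ =>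
    ((hF.diffAt hp μ ν).mul (diffAt_e3_of_mem hM hp μ)).mul (diffAt_e4_of_mem hM hp ν))

lemma diffAt_hVolUp (hM : 0 < M) (ha : |a| ≤ M) (hp : p ∈ exterior M a) (μ ν : Fin 4) :
    DiffAt M a p fun q => hVolUp M a q μ ν := by
  simp only [hVolUp, Matrix.of_apply]
  exact DiffAt.sum fun κ _ => DiffAt.sum fun l _ => ((diffAt_hInv hM ha hp μ κ).mul
    (diffAt_hInv hM ha hp ν l)).mul (diffAt_hVol hM ha hp κ l)

lemma diffAt_sigma (hM : 0 < M) (ha : |a| ≤ M) (hF : IsTwoForm M a F) (hp : p ∈ exterior M a) :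
    DiffAt M a p (sigma M a F) :=
  (diffAt_const _).mul (DiffAt.sum fun μ _ => DiffAt.sum fun ν _ =>
    (diffAt_hVolUp hM ha hp μ ν).mul (hF.diffAt hp μ ν))

/-! ### Null components of a two-form -/

lemma dot_mulVec_eq_sum (A : Matrix (Fin 4) (Fin 4) ℝ) (V W : Fin 4 → ℝ) :
    V ⬝ᵥ A.mulVec W = ∑ μ, ∑ ν, V μ * A μ ν * W ν := by
  simp only [dotProduct, Matrix.mulVec, Finset.mul_sum, mul_assoc]

lemma IsTwoForm.skew (hF : IsTwoForm M a F) (hp : p ∈ exterior M a) (V W : Fin 4 → ℝ) :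
    V ⬝ᵥ (F p).mulVec W = -(W ⬝ᵥ (F p).mulVec V) := by
  rw [dot_mulVec_eq_sum, dot_mulVec_eq_sum, Finset.sum_comm, ← Finset.sum_neg_distrib]
  refine Finset.sum_congr rfl fun μ _ => ?_
  rw [← Finset.sum_neg_distrib]
  refine Finset.sum_congr rfl fun ν _ => ?_
  rw [hF.2 p hp]; ring

lemma IsNullFrame.alpha_apply (h : IsNullFrame M a p X Y) (ν : Fin 4) : alpha M a F p ν =
    (X ⬝ᵥ (F p).mulVec (e4 M a p)) * flat M a p X ν
      + (Y ⬝ᵥ (F p).mulVec (e4 M a p)) * flat M a p Y ν := by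
  rw [dot_mulVec_eq_sum, dot_mulVec_eq_sum, alpha]
  simp only [h.proj_apply, Finset.sum_mul, ← Finset.sum_add_distrib]
  refine Finset.sum_congr rfl fun μ _ => Finset.sum_congr rfl fun l _ => by ring

lemma IsNullFrame.alphaBar_apply (h : IsNullFrame M a p X Y) (ν : Fin 4) : alphaBar M a F p ν =
    (X ⬝ᵥ (F p).mulVec (e3 p)) * flat M a p X ν
      + (Y ⬝ᵥ (F p).mulVec (e3 p)) * flat M a p Y ν := by
  rw [dot_mulVec_eq_sum, dot_mulVec_eq_sum, alphaBar]
  simp only [h.proj_apply, Finset.sum_mul, ← Finset.sum_add_distrib]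
  refine Finset.sum_congr rfl fun μ _ => Finset.sum_congr rfl fun l _ => by ring

lemma IsNullFrame.alpha_dot (h : IsNullFrame M a p X Y) (V : Fin 4 → ℝ) : alpha M a F p ⬝ᵥ V =
    (X ⬝ᵥ (F p).mulVec (e4 M a p)) * (flat M a p X ⬝ᵥ V)
      + (Y ⬝ᵥ (F p).mulVec (e4 M a p)) * (flat M a p Y ⬝ᵥ V) := by
  have h1 : alpha M a F p = (X ⬝ᵥ (F p).mulVec (e4 M a p)) • flat M a p X
      + (Y ⬝ᵥ (F p).mulVec (e4 M a p)) • flat M a p Y := funext h.alpha_apply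
  rw [h1, add_dotProduct, smul_dotProduct, smul_dotProduct, smul_eq_mul, smul_eq_mul]

lemma IsNullFrame.alphaBar_dot (h : IsNullFrame M a p X Y) (V : Fin 4 → ℝ) :
    alphaBar M a F p ⬝ᵥ V = (X ⬝ᵥ (F p).mulVec (e3 p)) * (flat M a p X ⬝ᵥ V)
      + (Y ⬝ᵥ (F p).mulVec (e3 p)) * (flat M a p Y ⬝ᵥ V) := by
  have h1 : alphaBar M a F p = (X ⬝ᵥ (F p).mulVec (e3 p)) • flat M a p X
      + (Y ⬝ᵥ (F p).mulVec (e3 p)) • flat M a p Y := funext h.alphaBar_apply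
  rw [h1, add_dotProduct, smul_dotProduct, smul_dotProduct, smul_eq_mul, smul_eq_mul]

lemma rho_eq : rho M a F p = 1 / 2 * (e3 p ⬝ᵥ (F p).mulVec (e4 M a p)) := by
  rw [dot_mulVec_eq_sum, rho]
  congr 1
  refine Finset.sum_congr rfl fun μ _ => Finset.sum_congr rfl fun ν _ => by ring

lemma IsNullFrame.sum_hInv_flat (h : IsNullFrame M a p X Y) (V : Fin 4 → ℝ) (μ : Fin 4) :
    ∑ κ, hInv M a p μ κ * flat M a p V κ
      = X μ * (flat M a p V ⬝ᵥ X) + Y μ * (flat M a p V ⬝ᵥ Y) := by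
  simp only [h.hInv_apply, dotProduct, Fin.sum_univ_four]
  ring

lemma IsFrame.hVolUp_apply (h : IsFrame a p X Y) (hM : 0 < M) (ha : |a| ≤ M)
    (hp : p ∈ exterior M a) (μ ν : Fin 4) : hVolUp M a p μ ν = X μ * Y ν - Y μ * X ν := by
  have hr := rad_pos hM hp
  have hN := h.isNullFrame ha hr
  have h1 : hVolUp M a p μ ν
      = (∑ κ, hInv M a p μ κ * flat M a p X κ) * (∑ l, hInv M a p ν l * flat M a p Y l)
        - (∑ κ, hInv M a p μ κ * flat M a p Y κ) * (∑ l, hInv M a p ν l * flat M a p X l) := by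
    rw [hVolUp, Matrix.of_apply]
    simp only [h.hVol_apply ha hr, Finset.sum_mul_sum, ← Finset.sum_sub_distrib]
    refine Finset.sum_congr rfl fun κ _ => Finset.sum_congr rfl fun l _ => by ring
  rw [h1]
  simp only [hN.sum_hInv_flat, hN.fXX, hN.fXY, hN.fYX, hN.fYY]
  ring

lemma IsFrame.hAtr_eq (h : IsFrame a p X Y) (hM : 0 < M) (ha : |a| ≤ M) (hp : p ∈ exterior M a)
    (T : Field₂) : hAtr M a T p = X ⬝ᵥ (T p).mulVec Y - Y ⬝ᵥ (T p).mulVec X := by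
  rw [dot_mulVec_eq_sum, dot_mulVec_eq_sum, hAtr]
  simp only [h.hVolUp_apply hM ha hp, ← Finset.sum_sub_distrib]
  refine Finset.sum_congr rfl fun κ _ => Finset.sum_congr rfl fun l _ => by ring

lemma IsNullFrame.hTr_eq (h : IsNullFrame M a p X Y) (T : Field₂) :
    hTr M a T p = X ⬝ᵥ (T p).mulVec X + Y ⬝ᵥ (T p).mulVec Y := by
  rw [dot_mulVec_eq_sum, dot_mulVec_eq_sum, hTr]
  simp only [h.hInv_apply, ← Finset.sum_add_distrib]
  refine Finset.sum_congr rfl fun κ _ => Finset.sum_congr rfl fun l _ => by ring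

lemma IsFrame.sigma_eq (h : IsFrame a p X Y) (hM : 0 < M) (ha : |a| ≤ M) (hF : IsTwoForm M a F)
    (hp : p ∈ exterior M a) : sigma M a F p = X ⬝ᵥ (F p).mulVec Y := by
  rw [sigma, h.hAtr_eq hM ha hp, hF.skew hp Y X]; ring

lemma IsFrame.hVol_dot (h : IsFrame a p X Y) (ha : |a| ≤ M) (hr : 0 < rad p)
    (V W : Fin 4 → ℝ) : V ⬝ᵥ (hVol M a p).mulVec W
      = (flat M a p X ⬝ᵥ V) * (flat M a p Y ⬝ᵥ W) - (flat M a p X ⬝ᵥ W) * (flat M a p Y ⬝ᵥ V) := by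
  rw [dot_mulVec_eq_sum]
  simp only [h.hVol_apply ha hr, dotProduct, Finset.sum_mul_sum]
  rw [Finset.sum_comm (f := fun i j => flat M a p X i * W i * (flat M a p Y j * V j)),
    ← Finset.sum_sub_distrib]
  refine Finset.sum_congr rfl fun μ _ => ?_
  rw [← Finset.sum_sub_distrib]
  refine Finset.sum_congr rfl fun ν _ => by ring

/-- Reconstruction of a two-form from its null components. -/
lemma IsTwoForm.decompose (hF : IsTwoForm M a F) (hM : 0 < M) (ha : |a| ≤ M)
    (hp : p ∈ exterior M a) (V W : Fin 4 → ℝ) : V ⬝ᵥ (F p).mulVec W =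
      1 / 2 * (rho M a F p * ((lower M a (e4 M a) p ⬝ᵥ V) * (lower M a e3 p ⬝ᵥ W)
        - (lower M a (e4 M a) p ⬝ᵥ W) * (lower M a e3 p ⬝ᵥ V)))
      - 1 / 2 * ((alpha M a F p ⬝ᵥ V) * (lower M a e3 p ⬝ᵥ W)
        - (alpha M a F p ⬝ᵥ W) * (lower M a e3 p ⬝ᵥ V))
      - 1 / 2 * ((alphaBar M a F p ⬝ᵥ V) * (lower M a (e4 M a) p ⬝ᵥ W)
        - (alphaBar M a F p ⬝ᵥ W) * (lower M a (e4 M a) p ⬝ᵥ V))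
      + sigma M a F p * (V ⬝ᵥ (hVol M a p).mulVec W) := by
  have hr := rad_pos hM hp
  obtain ⟨X, Y, h, hN⟩ := exists_frame hM ha hp
  rw [h.hVol_dot ha hr, hN.alpha_dot, hN.alpha_dot, hN.alphaBar_dot, hN.alphaBar_dot, rho_eq,
    h.sigma_eq hM ha hF hp, ← flat_eq_lower, ← flat_eq_lower]
  have hself : ∀ V, V ⬝ᵥ (F p).mulVec V = 0 := fun V => by linarith [hF.skew hp V V]
  -- Bilinear expansion in the null frame; skew-symmetry leaves six components, namely those
  -- collected in ρ, σ, α and α̲.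
  conv_lhs => rw [hN.vector_expand V, hN.vector_expand W]
  simp only [Matrix.mulVec_add, Matrix.mulVec_smul, add_dotProduct, dotProduct_add, smul_dotProduct,
    dotProduct_smul, smul_eq_mul, hself]
  rw [hF.skew hp Y X, hF.skew hp (e3 p) X, hF.skew hp (e3 p) Y, hF.skew hp (e4 M a p) X,
    hF.skew hp (e4 M a p) Y, hF.skew hp (e4 M a p) (e3 p)]
  ring

/-! ### Covariant derivatives in a null frame -/

lemma diffAt_dot_mulVec {A : Field₂} (hA : ∀ μ ν, DiffAt M a p fun q => A q μ ν)
    (V W : Fin 4 → ℝ) : DiffAt M a p fun q => V ⬝ᵥ (A q).mulVec W := by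
  simp only [dot_mulVec_eq_sum]
  exact DiffAt.sum fun μ _ => DiffAt.sum fun ν _ =>
    ((diffAt_const _).mul (hA μ ν)).mul (diffAt_const _)

/-- Differentiating ε(V, e) = 0 gives (∇_Z ε)(V, e) = -ε(V, ∇_Z e), so only connection coefficients
of e are needed. -/
lemma IsFrame.cov₂_hVol_e (h : IsFrame a p X Y) (hM : 0 < M) (ha : |a| ≤ M)
    (hp : p ∈ exterior M a) {e : Field₁} (he : ∀ ν, DiffAt M a p fun q => e q ν)
    (h0 : ∀ q ∈ exterior M a, ∀ V, V ⬝ᵥ (hVol M a q).mulVec (e q) = 0) (Z V : Fin 4 → ℝ) :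
    cov₂ M a p (hVol M a) Z V (e p) = (flat M a p Y ⬝ᵥ V) * conn M a p e Z X
      - (flat M a p X ⬝ᵥ V) * conn M a p e Z Y := by
  have hu := uniqueDiffWithinAt_exterior hM hp
  have hr := rad_pos hM hp
  have hs : ∀ ν, DiffAt M a p fun q => (Matrix.vecMul V (hVol M a q)) ν := by
    intro ν
    simp only [Matrix.vecMul, dotProduct]
    exact DiffAt.sum fun μ _ => (diffAt_const (V μ)).mul (diffAt_hVol hM ha hp μ ν)
  have h1 := der_dot hu Z hs he
  simp only [← Matrix.dotProduct_mulVec] at h1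
  rw [der_congr (g := fun _ => 0) (fun q hq => h0 q hq V) hp, der_const] at h1
  have h2 : V ⬝ᵥ (hVol M a p).mulVec (nab M a p e Z)
      = V ⬝ᵥ (hVol M a p).mulVec (derField M a p e Z)
        + V ⬝ᵥ (hVol M a p).mulVec (Gam M a p Z (e p)) := by
    rw [nab, Matrix.mulVec_add, dotProduct_add]
  rw [h.hVol_dot ha hr] at h2
  change 0 = _ + V ⬝ᵥ (hVol M a p).mulVec (derField M a p e Z) at h1
  rw [cov₂, h0 p hp, conn, conn]
  linarith

lemma hVol_dot_e3 (hM : 0 < M) (ha : |a| ≤ M) (hp : p ∈ exterior M a) (V : Fin 4 → ℝ) :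
    V ⬝ᵥ (hVol M a p).mulVec (e3 p) = 0 := by
  obtain ⟨X, Y, h, hN⟩ := exists_frame hM ha hp
  rw [h.hVol_dot ha (rad_pos hM hp), hN.fX3, hN.fY3]; ring

lemma hVol_dot_e4 (hM : 0 < M) (ha : |a| ≤ M) (hp : p ∈ exterior M a) (V : Fin 4 → ℝ) :
    V ⬝ᵥ (hVol M a p).mulVec (e4 M a p) = 0 := by
  obtain ⟨X, Y, h, hN⟩ := exists_frame hM ha hp
  rw [h.hVol_dot ha (rad_pos hM hp), hN.fX4, hN.fY4]; ring

lemma hVol_dot_skew (hM : 0 < M) (ha : |a| ≤ M) (hp : p ∈ exterior M a) (V W : Fin 4 → ℝ) :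
    V ⬝ᵥ (hVol M a p).mulVec W = -(W ⬝ᵥ (hVol M a p).mulVec V) := by
  obtain ⟨X, Y, h, hN⟩ := exists_frame hM ha hp
  rw [h.hVol_dot ha (rad_pos hM hp), h.hVol_dot ha (rad_pos hM hp)]; ring

lemma cov₂_skew {A : Field₂} (hM : 0 < M) (hp : p ∈ exterior M a)
    (hA : ∀ q ∈ exterior M a, ∀ V W, V ⬝ᵥ (A q).mulVec W = -(W ⬝ᵥ (A q).mulVec V))
    (Z V W : Fin 4 → ℝ) : cov₂ M a p A Z V W = -cov₂ M a p A Z W V := by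
  have hu := uniqueDiffWithinAt_exterior hM hp
  rw [cov₂, cov₂, der_congr (fun q hq => hA q hq V W) hp, der_neg hu, hA p hp (Gam M a p Z V),
    hA p hp V]
  ring

/-- The Gram determinant of two vectors, projected to the horizontal space. -/
lemma hVol_sq (hM : 0 < M) (ha : |a| ≤ M) (hp : p ∈ exterior M a) (V W : Fin 4 → ℝ) :
    (V ⬝ᵥ (hVol M a p).mulVec W) ^ 2 =
      (flat M a p V ⬝ᵥ V + (lower M a e3 p ⬝ᵥ V) * (lower M a (e4 M a) p ⬝ᵥ V))
        * (flat M a p W ⬝ᵥ W + (lower M a e3 p ⬝ᵥ W) * (lower M a (e4 M a) p ⬝ᵥ W))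
      - (flat M a p V ⬝ᵥ W + 1 / 2 * ((lower M a e3 p ⬝ᵥ V) * (lower M a (e4 M a) p ⬝ᵥ W)
        + (lower M a e3 p ⬝ᵥ W) * (lower M a (e4 M a) p ⬝ᵥ V))) ^ 2 := by
  obtain ⟨X, Y, h, hN⟩ := exists_frame hM ha hp
  -- The left side is the product of the horizontal parts of V and W; the claim then reduces to
  -- Lagrange's identity in the plane.
  have key : ∀ V W, flat M a p V ⬝ᵥ W
      + 1 / 2 * ((lower M a e3 p ⬝ᵥ V) * (lower M a (e4 M a) p ⬝ᵥ W)
        + (lower M a e3 p ⬝ᵥ W) * (lower M a (e4 M a) p ⬝ᵥ V))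
      = (flat M a p X ⬝ᵥ V) * (flat M a p X ⬝ᵥ W) + (flat M a p Y ⬝ᵥ V) * (flat M a p Y ⬝ᵥ W) := by
    intro V W
    conv_lhs => enter [1, 2]; rw [hN.vector_expand W]
    simp only [dotProduct_add, dotProduct_smul, smul_eq_mul]
    simp only [flat_dot_symm V, ← flat_eq_lower]
    ring
  rw [h.hVol_dot ha (rad_pos hM hp), key V W]
  have h1 := key V V
  have h2 := key W W
  have h1' : flat M a p V ⬝ᵥ V + (lower M a e3 p ⬝ᵥ V) * (lower M a (e4 M a) p ⬝ᵥ V)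
      = (flat M a p X ⬝ᵥ V) ^ 2 + (flat M a p Y ⬝ᵥ V) ^ 2 := by linear_combination h1
  have h2' : flat M a p W ⬝ᵥ W + (lower M a e3 p ⬝ᵥ W) * (lower M a (e4 M a) p ⬝ᵥ W)
      = (flat M a p X ⬝ᵥ W) ^ 2 + (flat M a p Y ⬝ᵥ W) ^ 2 := by linear_combination h2
  rw [h1', h2']
  ring

/-- The horizontal volume form is parallel along the horizontal distribution. -/
lemma IsFrame.cov₂_hVol_XY (h : IsFrame a p X Y) (hM : 0 < M) (ha : |a| ≤ M)
    (hp : p ∈ exterior M a) (Z : Fin 4 → ℝ) : cov₂ M a p (hVol M a) Z X Y = 0 := by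
  have hu := uniqueDiffWithinAt_exterior hM hp
  have hr := rad_pos hM hp
  have hN := h.isNullFrame ha hr
  have hl3 := fun W => DiffAt.dot_const (diffAt_lower hM ha hp (diffAt_e3_of_mem hM hp)) W
  have hl4 := fun W => DiffAt.dot_const (diffAt_lower hM ha hp (diffAt_e4_of_mem hM hp)) W
  have hg := fun V W => DiffAt.dot_const (s := fun q => flat M a q V) (diffAt_flat hM ha hp V) W
  have hE := diffAt_dot_mulVec (diffAt_hVol hM ha hp) X Y
  have hA := fun V => (hg V V).add ((hl3 V).mul (hl4 V))
  have hB := (hg X Y).add ((diffAt_const (1 / 2)).mul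
    (((hl3 X).mul (hl4 Y)).add ((hl3 Y).mul (hl4 X))))
  have f3X : lower M a e3 p ⬝ᵥ X = 0 := hN.f3X
  have f3Y : lower M a e3 p ⬝ᵥ Y = 0 := hN.f3Y
  have f4X : lower M a (e4 M a) p ⬝ᵥ X = 0 := hN.f4X
  have f4Y : lower M a (e4 M a) p ⬝ᵥ Y = 0 := hN.f4Y
  have hXY : X ⬝ᵥ (hVol M a p).mulVec Y = 1 := by
    rw [h.hVol_dot ha hr, hN.fXX, hN.fYY, hN.fXY]; ring
  -- Squaring avoids differentiating √|det g|. At p, where ε(X, Y) = 1, the terms with lowered e₃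
  -- and e₄ vanish to first order, so twice the derivative of ε(X, Y) is the sum of those of g(X, X)
  -- and g(Y, Y). The Christoffel terms below cancel exactly this.
  have h1 := der_congr (fun q hq => hVol_sq hM ha hq X Y) hp Z
  rw [der_sq hu Z hE, der_sub hu Z ((hA X).mul (hA Y)) (hB.pow 2), der_mul hu Z (hA X) (hA Y),
    der_sq hu Z hB, der_add hu Z (hg X X) ((hl3 X).mul (hl4 X)),
    der_add hu Z (hg Y Y) ((hl3 Y).mul (hl4 Y)), der_mul hu Z (hl3 X) (hl4 X),
    der_mul hu Z (hl3 Y) (hl4 Y), f3X, f3Y, f4X, f4Y, hN.fXX, hN.fYY, hN.fXY, hXY] at h1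
  have hX := flat_dot_Gam hM ha hp Z X X
  have hY := flat_dot_Gam hM ha hp Z Y Y
  rw [derMetric_symm X Z X] at hX
  rw [derMetric_symm Y Z Y] at hY
  unfold derMetric at hX hY
  rw [cov₂, h.hVol_dot ha hr, h.hVol_dot ha hr, hN.fXX, hN.fYY, hN.fXY, hN.fYX]
  linarith

/-- The covariant derivative of a two-form in terms of its null components. -/
lemma IsTwoForm.cov₂_eq (hF : IsTwoForm M a F) (hM : 0 < M) (ha : |a| ≤ M)
    (hp : p ∈ exterior M a) (Z V W : Fin 4 → ℝ) : cov₂ M a p F Z V W =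
      1 / 2 * (der M a p (rho M a F) Z * ((lower M a (e4 M a) p ⬝ᵥ V) * (lower M a e3 p ⬝ᵥ W)
        - (lower M a (e4 M a) p ⬝ᵥ W) * (lower M a e3 p ⬝ᵥ V)))
      + 1 / 2 * (rho M a F p * (conn M a p (e4 M a) Z V * (lower M a e3 p ⬝ᵥ W)
        + (lower M a (e4 M a) p ⬝ᵥ V) * conn M a p e3 Z W
        - conn M a p (e4 M a) Z W * (lower M a e3 p ⬝ᵥ V)
        - (lower M a (e4 M a) p ⬝ᵥ W) * conn M a p e3 Z V))
      - 1 / 2 * (cov₁ M a p (alpha M a F) Z V * (lower M a e3 p ⬝ᵥ W)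
        + (alpha M a F p ⬝ᵥ V) * conn M a p e3 Z W
        - cov₁ M a p (alpha M a F) Z W * (lower M a e3 p ⬝ᵥ V)
        - (alpha M a F p ⬝ᵥ W) * conn M a p e3 Z V)
      - 1 / 2 * (cov₁ M a p (alphaBar M a F) Z V * (lower M a (e4 M a) p ⬝ᵥ W)
        + (alphaBar M a F p ⬝ᵥ V) * conn M a p (e4 M a) Z W
        - cov₁ M a p (alphaBar M a F) Z W * (lower M a (e4 M a) p ⬝ᵥ V)
        - (alphaBar M a F p ⬝ᵥ W) * conn M a p (e4 M a) Z V)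
      + der M a p (sigma M a F) Z * (V ⬝ᵥ (hVol M a p).mulVec W)
      + sigma M a F p * cov₂ M a p (hVol M a) Z V W := by
  have hu := uniqueDiffWithinAt_exterior hM hp
  have he3 := diffAt_e3_of_mem (M := M) (a := a) hM hp
  have he4 := diffAt_e4_of_mem (M := M) (a := a) hM hp
  have h3 := fun W => DiffAt.dot_const (diffAt_lower hM ha hp he3) W
  have h4 := fun W => DiffAt.dot_const (diffAt_lower hM ha hp he4) W
  have hα := fun W => DiffAt.dot_const (diffAt_alpha hM ha hF hp) W
  have hβ := fun W => DiffAt.dot_const (diffAt_alphaBar hM ha hF hp) W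
  have hρ := diffAt_rho hM hF hp
  have hσ := diffAt_sigma hM ha hF hp
  have hε := diffAt_dot_mulVec (diffAt_hVol hM ha hp) V W
  have hR := ((h4 V).mul (h3 W)).sub ((h4 W).mul (h3 V))
  have hA := ((hα V).mul (h3 W)).sub ((hα W).mul (h3 V))
  have hB := ((hβ V).mul (h4 W)).sub ((hβ W).mul (h4 V))
  -- Covariant derivatives of the lowered null vectors are connection coefficients, which turns the
  -- Leibniz rule for `decompose` into the stated form.
  have c3 := fun V => cov₁_lower hM ha hp he3 Z V
  have c4 := fun V => cov₁_lower hM ha hp he4 Z V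
  rw [cov₂, der_congr (fun q hq => hF.decompose hM ha hq V W) hp,
    der_add hu Z (((((diffAt_const _).mul (hρ.mul hR)).sub ((diffAt_const _).mul hA)).sub
      ((diffAt_const _).mul hB))) (hσ.mul hε),
    der_sub hu Z (((diffAt_const _).mul (hρ.mul hR)).sub ((diffAt_const _).mul hA))
      ((diffAt_const _).mul hB),
    der_sub hu Z ((diffAt_const _).mul (hρ.mul hR)) ((diffAt_const _).mul hA),
    der_const_mul hu Z _ (hρ.mul hR), der_const_mul hu Z _ hA, der_const_mul hu Z _ hB,
    der_mul hu Z hρ hR, der_mul hu Z hσ hε,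
    der_sub hu Z ((h4 V).mul (h3 W)) ((h4 W).mul (h3 V)),
    der_sub hu Z ((hα V).mul (h3 W)) ((hα W).mul (h3 V)),
    der_sub hu Z ((hβ V).mul (h4 W)) ((hβ W).mul (h4 V)),
    der_mul hu Z (h4 V) (h3 W), der_mul hu Z (h4 W) (h3 V), der_mul hu Z (hα V) (h3 W),
    der_mul hu Z (hα W) (h3 V), der_mul hu Z (hβ V) (h4 W), der_mul hu Z (hβ W) (h4 V),
    hF.decompose hM ha hp (Gam M a p Z V) W, hF.decompose hM ha hp V (Gam M a p Z W),
    ← c3, ← c3, ← c4, ← c4]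
  simp only [cov₁, cov₂]
  ring

/-! ### Horizontal operators in a null frame -/

lemma along_eq (e : Field₁) (f : Point → ℝ) : along M a e f p = der M a p f (e p) :=
  sum_mul_pd f (e p)

lemma IsNullFrame.hGrad_apply (h : IsNullFrame M a p X Y) (f : Point → ℝ) (ν : Fin 4) :
    hGrad M a f p ν = der M a p f X * flat M a p X ν + der M a p f Y * flat M a p Y ν := by
  rw [hGrad, ← sum_mul_pd, ← sum_mul_pd]
  simp only [h.proj_apply, Finset.sum_mul, ← Finset.sum_add_distrib]
  refine Finset.sum_congr rfl fun μ _ => by ring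

lemma sum_mul_hCov (hu : UniqueDiffWithinAt ℝ (exterior M a) p)
    (h : IsNullFrame M a p X Y) (hs : ∀ ν, DiffAt M a p fun q => s q ν) (Z : Fin 4 → ℝ)
    (ν : Fin 4) : ∑ μ, Z μ * hCov M a s p μ ν
      = cov₁ M a p s Z X * flat M a p X ν + cov₁ M a p s Z Y * flat M a p Y ν := by
  rw [← sum_mul_covForm hu hs, ← sum_mul_covForm hu hs]
  simp only [hCov, Matrix.of_apply, h.proj_apply, Finset.mul_sum, Finset.sum_mul,
    ← Finset.sum_add_distrib]
  refine Finset.sum_congr rfl fun μ _ => Finset.sum_congr rfl fun l _ => by ring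

lemma hCov_dot (hu : UniqueDiffWithinAt ℝ (exterior M a) p)
    (h : IsNullFrame M a p X Y) (hs : ∀ ν, DiffAt M a p fun q => s q ν) (Z V : Fin 4 → ℝ) :
    Z ⬝ᵥ (hCov M a s p).mulVec V
      = cov₁ M a p s Z X * (flat M a p X ⬝ᵥ V) + cov₁ M a p s Z Y * (flat M a p Y ⬝ᵥ V) := by
  rw [dot_mulVec_eq_sum, Finset.sum_comm]
  simp only [← Finset.sum_mul, sum_mul_hCov hu h hs, dotProduct, Finset.mul_sum,
    ← Finset.sum_add_distrib]
  refine Finset.sum_congr rfl fun ν _ => by ring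

lemma IsNullFrame.hDiv_eq (h : IsNullFrame M a p X Y)
    (hu : UniqueDiffWithinAt ℝ (exterior M a) p) (hs : ∀ ν, DiffAt M a p fun q => s q ν) :
    hDiv M a s p = cov₁ M a p s X X + cov₁ M a p s Y Y := by
  rw [hDiv, h.hTr_eq, hCov_dot hu h hs, hCov_dot hu h hs, h.fXX, h.fXY, h.fYX, h.fYY]
  ring

lemma IsFrame.hCurl_eq (h : IsFrame a p X Y) (hM : 0 < M) (ha : |a| ≤ M) (hp : p ∈ exterior M a)
    (hs : ∀ ν, DiffAt M a p fun q => s q ν) :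
    hCurl M a s p = cov₁ M a p s X Y - cov₁ M a p s Y X := by
  have hu := uniqueDiffWithinAt_exterior hM hp
  have hN := h.isNullFrame ha (rad_pos hM hp)
  rw [hCurl, h.hAtr_eq hM ha hp, hCov_dot hu hN hs, hCov_dot hu hN hs, hN.fXX, hN.fXY, hN.fYX,
    hN.fYY]
  ring

lemma IsNullFrame.secondForm_apply (h : IsNullFrame M a p X Y) (e : Field₁) (μ ν : Fin 4) :
    secondForm M a e p μ ν =
      (conn M a p e X X * flat M a p X ν + conn M a p e X Y * flat M a p Y ν) * flat M a p X μ
      + (conn M a p e Y X * flat M a p X ν + conn M a p e Y Y * flat M a p Y ν)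
        * flat M a p Y μ := by
  have key : ∀ A B, conn M a p e A B
      = ∑ κ, ∑ l, ∑ i, A κ * B l * metric M a p l i * covVector M a e p κ i := by
    intro A B
    rw [conn, flat_dot_symm, dotProduct_comm, flat, dot_mulVec_eq_sum]
    simp only [← sum_mul_covVector, Finset.mul_sum]
    rw [Finset.sum_comm_cycle]
    refine Finset.sum_congr rfl fun κ _ => Finset.sum_congr rfl fun l _ =>
      Finset.sum_congr rfl fun i _ => by ring
  simp only [key, secondForm, Matrix.of_apply, h.proj_apply, Finset.sum_mul,
    ← Finset.sum_add_distrib]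
  refine Finset.sum_congr rfl fun κ _ => Finset.sum_congr rfl fun l _ =>
      Finset.sum_congr rfl fun i _ => by ring

lemma IsNullFrame.secondForm_dot (h : IsNullFrame M a p X Y) (e : Field₁) (V W : Fin 4 → ℝ) :
    V ⬝ᵥ (secondForm M a e p).mulVec W =
      (conn M a p e X X * (flat M a p X ⬝ᵥ W) + conn M a p e X Y * (flat M a p Y ⬝ᵥ W))
        * (flat M a p X ⬝ᵥ V)
      + (conn M a p e Y X * (flat M a p X ⬝ᵥ W) + conn M a p e Y Y * (flat M a p Y ⬝ᵥ W))
        * (flat M a p Y ⬝ᵥ V) := by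
  rw [dot_mulVec_eq_sum]
  simp only [h.secondForm_apply, dotProduct, Fin.sum_univ_four]
  ring

lemma IsNullFrame.sharpDot_apply (h : IsNullFrame M a p X Y) (e s : Field₁) (μ : Fin 4) :
    sharpDot M a (secondForm M a e) s p μ =
      (conn M a p e X X * (s p ⬝ᵥ X) + conn M a p e X Y * (s p ⬝ᵥ Y)) * flat M a p X μ
      + (conn M a p e Y X * (s p ⬝ᵥ X) + conn M a p e Y Y * (s p ⬝ᵥ Y)) * flat M a p Y μ := by
  have h1 : sharpDot M a (secondForm M a e) s p μ
      = (secondForm M a e p μ ⬝ᵥ X) * (s p ⬝ᵥ X) + (secondForm M a e p μ ⬝ᵥ Y) * (s p ⬝ᵥ Y) := by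
    simp only [sharpDot, h.hInv_apply, dotProduct, Fin.sum_univ_four]
    ring
  have h2 : ∀ W, secondForm M a e p μ ⬝ᵥ W =
      (conn M a p e X X * (flat M a p X ⬝ᵥ W) + conn M a p e X Y * (flat M a p Y ⬝ᵥ W))
        * flat M a p X μ
      + (conn M a p e Y X * (flat M a p X ⬝ᵥ W) + conn M a p e Y Y * (flat M a p Y ⬝ᵥ W))
        * flat M a p Y μ := by
    intro W
    simp only [dotProduct, h.secondForm_apply, Fin.sum_univ_four]
    ring
  rw [h1, h2, h2, h.fXX, h.fXY, h.fYX, h.fYY]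
  ring

lemma IsNullFrame.hTr_secondForm (h : IsNullFrame M a p X Y) (e : Field₁) :
    hTr M a (secondForm M a e) p = conn M a p e X X + conn M a p e Y Y := by
  rw [h.hTr_eq, h.secondForm_dot, h.secondForm_dot, h.fXX, h.fXY, h.fYX, h.fYY]
  ring

lemma IsFrame.hAtr_secondForm (h : IsFrame a p X Y) (hM : 0 < M) (ha : |a| ≤ M)
    (hp : p ∈ exterior M a) (e : Field₁) :
    hAtr M a (secondForm M a e) p = conn M a p e X Y - conn M a p e Y X := by
  have hN := h.isNullFrame ha (rad_pos hM hp)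
  rw [h.hAtr_eq hM ha hp, hN.secondForm_dot, hN.secondForm_dot, hN.fXX, hN.fXY, hN.fYX, hN.fYY]
  ring

lemma omegaHat_eq (hM : 0 < M) (ha : |a| ≤ M) (hp : p ∈ exterior M a) :
    omegaHat M a p = quotR M a p := by
  have h : omegaHat M a p = 1 / 2 * conn M a p e3 (e4 M a p) (e4 M a p) := by
    rw [omegaHat, conn, flat_eq_lower, dotProduct_comm]
    simp only [dotProduct, ← sum_mul_covVector, Finset.sum_mul]
    rw [Finset.sum_comm]
  rw [h, conn_e3_e4_e4 hM ha hp]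
  ring

lemma IsFrame.hStar_apply (h : IsFrame a p X Y) (hM : 0 < M) (ha : |a| ≤ M)
    (hp : p ∈ exterior M a) (s : Field₁) (ν : Fin 4) :
    hStar M a s p ν = (s p ⬝ᵥ Y) * flat M a p X ν - (s p ⬝ᵥ X) * flat M a p Y ν := by
  have hr := rad_pos hM hp
  have hN := h.isNullFrame ha hr
  have h1 : hStar M a s p ν
      = flat M a p X ν * ((flat M a p Y ⬝ᵥ X) * (s p ⬝ᵥ X) + (flat M a p Y ⬝ᵥ Y) * (s p ⬝ᵥ Y))
        - flat M a p Y ν * ((flat M a p X ⬝ᵥ X) * (s p ⬝ᵥ X)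
          + (flat M a p X ⬝ᵥ Y) * (s p ⬝ᵥ Y)) := by
    simp only [hStar, h.hVol_apply ha hr, hN.hInv_apply, dotProduct, Fin.sum_univ_four]
    ring
  rw [h1, hN.fXX, hN.fXY, hN.fYX, hN.fYY]
  ring

lemma IsNullFrame.frakT_apply (h : IsNullFrame M a p X Y)
    (hu : UniqueDiffWithinAt ℝ (exterior M a) p) (hs : ∀ ν, DiffAt M a p fun q => s q ν)
    (ν : Fin 4) : frakT M a s p ν =
      1 / 2 * Sig a p * (cov₁ M a p s (e3 p) X + conn M a p e3 X X * (s p ⬝ᵥ X)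
        + conn M a p e3 X Y * (s p ⬝ᵥ Y)) * flat M a p X ν
      + 1 / 2 * Sig a p * (cov₁ M a p s (e3 p) Y + conn M a p e3 Y X * (s p ⬝ᵥ X)
        + conn M a p e3 Y Y * (s p ⬝ᵥ Y)) * flat M a p Y ν := by
  rw [frakT, chiBar, h.sharpDot_apply, hCovAlong, sum_mul_hCov hu h hs]
  ring

/-- Unlike the two other summands, ω̂ s is not projected, so s must be assumed horizontal at p. -/
lemma IsNullFrame.frakTBar_apply (h : IsNullFrame M a p X Y)
    (hu : UniqueDiffWithinAt ℝ (exterior M a) p) (hs : ∀ ν, DiffAt M a p fun q => s q ν)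
    (hsp : ∀ ν, s p ν = (s p ⬝ᵥ X) * flat M a p X ν + (s p ⬝ᵥ Y) * flat M a p Y ν)
    (ν : Fin 4) : frakTBar M a s p ν =
      1 / 2 * Sig a p * (cov₁ M a p s (e4 M a p) X + conn M a p (e4 M a) X X * (s p ⬝ᵥ X)
        + conn M a p (e4 M a) X Y * (s p ⬝ᵥ Y) + omegaHat M a p * (s p ⬝ᵥ X)) * flat M a p X ν
      + 1 / 2 * Sig a p * (cov₁ M a p s (e4 M a p) Y + conn M a p (e4 M a) Y X * (s p ⬝ᵥ X)
        + conn M a p (e4 M a) Y Y * (s p ⬝ᵥ Y) + omegaHat M a p * (s p ⬝ᵥ Y))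
        * flat M a p Y ν := by
  rw [frakTBar, chi, h.sharpDot_apply, hCovAlong, sum_mul_hCov hu h hs]
  linear_combination 1 / 2 * Sig a p * omegaHat M a p * hsp ν

lemma cov₁_smul (hu : UniqueDiffWithinAt ℝ (exterior M a) p) {f : Point → ℝ}
    (hf : DiffAt M a p f) (hs : ∀ ν, DiffAt M a p fun q => s q ν) (Z V : Fin 4 → ℝ) :
    cov₁ M a p (fun q ν => f q * s q ν) Z V
      = f p * cov₁ M a p s Z V + der M a p f Z * (s p ⬝ᵥ V) := by
  have h1 : ∀ q W, (fun ν => f q * s q ν) ⬝ᵥ W = f q * (s q ⬝ᵥ W) := by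
    intro q W
    simp only [dotProduct, Finset.mul_sum, mul_assoc]
  simp only [cov₁, h1]
  rw [der_mul hu Z hf (DiffAt.dot_const hs V)]
  ring

/-! ### The Maxwell equations in a null frame -/

/-- A one-form vanishing on a null frame vanishes. -/
lemma IsNullFrame.form_eq_zero (h : IsNullFrame M a p X Y) {s : Fin 4 → ℝ}
    (hs : ∀ i, s ⬝ᵥ (![X, Y, e3 p, e4 M a p] i) = 0) (ν : Fin 4) : s ν = 0 := by
  have hX : s ⬝ᵥ X = 0 := hs 0
  have hY : s ⬝ᵥ Y = 0 := hs 1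
  have h3 : s ⬝ᵥ e3 p = 0 := hs 2
  have h4 : s ⬝ᵥ e4 M a p = 0 := hs 3
  rw [h.form_expand s ν, hX, hY, h3, h4]
  ring

/-- The listed sign changes link every triple of indices to its sorted version, and force vanishing
when an index repeats. -/
lemma alternating_eq_zero {C : Fin 4 → Fin 4 → Fin 4 → ℝ} (h1 : ∀ i j k, C i j k = -C j i k)
    (h2 : ∀ i j k, C i j k = -C i k j) (h012 : C 0 1 2 = 0) (h013 : C 0 1 3 = 0)
    (h023 : C 0 2 3 = 0) (h123 : C 1 2 3 = 0) (i j k : Fin 4) : C i j k = 0 := by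
  have a1 := h1 i j k
  have a2 := h2 i j k
  have a3 := h2 j i k
  have a4 := h1 i k j
  have a5 := h1 j k i
  fin_cases i <;> fin_cases j <;> fin_cases k <;>
    simp only [Fin.zero_eta, Fin.mk_one, Fin.reduceFinMk] at * <;> linarith

/-- A trilinear form vanishing on a null frame vanishes. -/
lemma IsNullFrame.trilinear_eq_zero (h : IsNullFrame M a p X Y) {c : Fin 4 → Fin 4 → Fin 4 → ℝ}
    (hc : ∀ i j k, ∑ μ, ∑ ν, ∑ l, (![X, Y, e3 p, e4 M a p] i) μ * (![X, Y, e3 p, e4 M a p] j) ν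
      * (![X, Y, e3 p, e4 M a p] k) l * c μ ν l = 0) (μ ν l : Fin 4) : c μ ν l = 0 := by
  have h1 : ∀ i j l, ∑ μ, ∑ ν, (![X, Y, e3 p, e4 M a p] i) μ * (![X, Y, e3 p, e4 M a p] j) ν
      * c μ ν l = 0 := by
    intro i j
    refine h.form_eq_zero (s := fun l => ∑ μ, ∑ ν, (![X, Y, e3 p, e4 M a p] i) μ
      * (![X, Y, e3 p, e4 M a p] j) ν * c μ ν l) fun k => ?_
    rw [← hc i j k]
    simp only [dotProduct, Finset.sum_mul]
    rw [← Finset.sum_comm_cycle]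
    refine Finset.sum_congr rfl fun μ _ => Finset.sum_congr rfl fun ν _ =>
      Finset.sum_congr rfl fun l _ => by ring
  have h2 : ∀ i ν l, ∑ μ, (![X, Y, e3 p, e4 M a p] i) μ * c μ ν l = 0 := by
    intro i ν l
    refine h.form_eq_zero (s := fun ν => ∑ μ, (![X, Y, e3 p, e4 M a p] i) μ * c μ ν l)
      (fun j => ?_) ν
    rw [← h1 i j l]
    simp only [dotProduct, Finset.sum_mul]
    rw [Finset.sum_comm]
    refine Finset.sum_congr rfl fun μ _ => Finset.sum_congr rfl fun ν _ => by ring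
  refine h.form_eq_zero (s := fun μ => c μ ν l) (fun i => ?_) μ
  rw [← h2 i ν l]
  simp only [dotProduct]
  refine Finset.sum_congr rfl fun μ _ => by ring

/-- The cyclic sum of the covariant derivative of a two-form, evaluated on three vectors. -/
noncomputable def cyc (M a : ℝ) (p : Point) (F : Field₂) (U V W : Fin 4 → ℝ) : ℝ :=
  cov₂ M a p F U V W + cov₂ M a p F V W U + cov₂ M a p F W U V

/-- The divergence of a two-form in a null frame. -/
noncomputable def frameDiv (M a : ℝ) (p : Point) (F : Field₂) (X Y W : Fin 4 → ℝ) : ℝ :=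
  cov₂ M a p F X X W + cov₂ M a p F Y Y W
    - 1 / 2 * (cov₂ M a p F (e3 p) (e4 M a p) W + cov₂ M a p F (e4 M a p) (e3 p) W)

lemma sum_mul_cyc (hu : UniqueDiffWithinAt ℝ (exterior M a) p)
    (hF : ∀ μ ν, DiffAt M a p fun q => F q μ ν) (U V W : Fin 4 → ℝ) :
    ∑ μ, ∑ ν, ∑ l, U μ * V ν * W l *
      (covTwo M a F p μ ν l + covTwo M a F p ν l μ + covTwo M a F p l μ ν) = cyc M a p F U V W := by
  rw [cyc, ← sum_mul_covTwo hu hF, ← sum_mul_covTwo hu hF, ← sum_mul_covTwo hu hF]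
  simp only [mul_add, Finset.sum_add_distrib]
  congr 1
  · congr 1
    rw [Finset.sum_comm_cycle (f := fun ν l μ => V ν * W l * U μ * covTwo M a F p ν l μ)]
    refine Finset.sum_congr rfl fun μ _ => Finset.sum_congr rfl fun ν _ =>
      Finset.sum_congr rfl fun l _ => by ring
  · rw [← Finset.sum_comm_cycle (f := fun μ ν l => W l * U μ * V ν * covTwo M a F p l μ ν)]
    refine Finset.sum_congr rfl fun μ _ => Finset.sum_congr rfl fun ν _ =>
      Finset.sum_congr rfl fun l _ => by ring

lemma sum_mul_divergence (hu : UniqueDiffWithinAt ℝ (exterior M a) p)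
    (h : IsNullFrame M a p X Y) (hF : ∀ μ ν, DiffAt M a p fun q => F q μ ν) (W : Fin 4 → ℝ) :
    (fun i => ∑ j, ∑ k, metricInv M a p j k * covTwo M a F p j k i) ⬝ᵥ W
      = frameDiv M a p F X Y W := by
  simp only [frameDiv, ← sum_mul_covTwo hu hF, dotProduct, Finset.sum_mul, h.metricInv_apply,
    Finset.mul_sum, mul_add, ← Finset.sum_add_distrib, ← Finset.sum_sub_distrib]
  rw [← Finset.sum_comm_cycle]
  refine Finset.sum_congr rfl fun μ _ => Finset.sum_congr rfl fun ν _ =>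
      Finset.sum_congr rfl fun l _ => by ring

lemma IsTwoForm.cov₂_skew (hF : IsTwoForm M a F) (hM : 0 < M) (hp : p ∈ exterior M a)
    (Z V W : Fin 4 → ℝ) : cov₂ M a p F Z V W = -cov₂ M a p F Z W V :=
  Kerr.cov₂_skew hM hp (fun _ hq V W => hF.skew hq V W) Z V W

/-- At a point, the Maxwell equations are eight scalar equations in a null frame. -/
lemma IsTwoForm.maxwell_iff (hF : IsTwoForm M a F) (hM : 0 < M) (hp : p ∈ exterior M a)
    (h : IsNullFrame M a p X Y) :
    ((∀ i j k, covTwo M a F p i j k + covTwo M a F p j k i + covTwo M a F p k i j = 0) ∧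
      ∀ i, ∑ j, ∑ k, metricInv M a p j k * covTwo M a F p j k i = 0) ↔
    (cyc M a p F (e3 p) X Y = 0 ∧ frameDiv M a p F X Y (e3 p) = 0) ∧
    (cyc M a p F (e4 M a p) X Y = 0 ∧ frameDiv M a p F X Y (e4 M a p) = 0) ∧
    -- The cyclic equation with X is paired with the divergence component along Y: these contain the
    -- derivatives of ρ and σ along the same vector X.
    (cyc M a p F (e3 p) (e4 M a p) X = 0 ∧ frameDiv M a p F X Y Y = 0) ∧
    (cyc M a p F (e3 p) (e4 M a p) Y = 0 ∧ frameDiv M a p F X Y X = 0) := by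
  have hu := uniqueDiffWithinAt_exterior hM hp
  have hd := hF.diffAt hp
  have hrot : ∀ U V W, cyc M a p F U V W = cyc M a p F V W U := by
    intro U V W; unfold cyc; ring
  have hskew : ∀ U V W, cyc M a p F U V W = -cyc M a p F V U W := by
    intro U V W
    unfold cyc
    rw [hF.cov₂_skew hM hp U V W, hF.cov₂_skew hM hp V W U, hF.cov₂_skew hM hp W U V]
    ring
  constructor
  · rintro ⟨h1, h2⟩
    have hc : ∀ U V W, cyc M a p F U V W = 0 := by
      intro U V W
      rw [← sum_mul_cyc hu hd]
      simp [h1]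
    have hD : ∀ W, frameDiv M a p F X Y W = 0 := by
      intro W
      rw [← sum_mul_divergence hu h hd]
      simp [h2, dotProduct]
    exact ⟨⟨hc _ _ _, hD _⟩, ⟨hc _ _ _, hD _⟩, ⟨hc _ _ _, hD _⟩, ⟨hc _ _ _, hD _⟩⟩
  · rintro ⟨⟨c1, d1⟩, ⟨c2, d2⟩, ⟨c3, d3⟩, ⟨c4, d4⟩⟩
    constructor
    -- It suffices to test on frame vectors, and there the cyclic sum is totally antisymmetric, so
    -- four values decide.
    · refine fun i j k => h.trilinear_eq_zero (c := fun μ ν l => covTwo M a F p μ ν l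
        + covTwo M a F p ν l μ + covTwo M a F p l μ ν) (fun i j k => ?_) i j k
      rw [sum_mul_cyc hu hd]
      refine alternating_eq_zero (C := fun i j k => cyc M a p F (![X, Y, e3 p, e4 M a p] i)
        (![X, Y, e3 p, e4 M a p] j) (![X, Y, e3 p, e4 M a p] k)) (fun i j k => hskew _ _ _)
        (fun i j k => ?_) ?_ ?_ ?_ ?_ i j k
      · rw [hrot, hskew, hrot, hrot]
      · exact (hrot _ _ _).symm.trans c1
      · exact (hrot _ _ _).symm.trans c2
      · exact (hrot _ _ _).trans c3
      · exact (hrot _ _ _).trans c4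
    · refine h.form_eq_zero (s := fun i => ∑ j, ∑ k, metricInv M a p j k * covTwo M a F p j k i)
        fun i => ?_
      rw [sum_mul_divergence hu h hd]
      fin_cases i
      · exact d4
      · exact d3
      · exact d1
      · exact d2

/-! ### Connection coefficients and null components in an adapted frame -/

/-- The Ricci rotation coefficients of the Kerr metric in the frame `e₃, e₄, X, Y`. -/
structure IsConnTable (M a : ℝ) (p : Point) (X Y : Fin 4 → ℝ) : Prop where
  e3_to_e3 : ∀ Z, conn M a p e3 Z (e3 p) = 0
  e3_along_e3 : ∀ V, conn M a p e3 (e3 p) V = 0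
  e4_to_e4 : ∀ Z, conn M a p (e4 M a) Z (e4 M a p) = 0
  e4_to_e3 : ∀ Z, conn M a p (e4 M a) Z (e3 p) = -conn M a p e3 Z (e4 M a p)
  e3_44 : conn M a p e3 (e4 M a p) (e4 M a p) = 2 * quotR M a p
  e3_XX : conn M a p e3 X X = -(rad p / Sig a p)
  e3_YY : conn M a p e3 Y Y = -(rad p / Sig a p)
  e3_XY : conn M a p e3 X Y = a * cosθ p / Sig a p
  e3_YX : conn M a p e3 Y X = -(a * cosθ p / Sig a p)
  e3_X4 : conn M a p e3 X (e4 M a p) = -(2 * a ^ 2 * cosθ p / Sig a p * (X 3 / rad p))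
      - 2 * a * rad p / Sig a p * (Y 3 / rad p)
  e3_Y4 : conn M a p e3 Y (e4 M a p) = -(2 * a ^ 2 * cosθ p / Sig a p * (Y 3 / rad p))
      + 2 * a * rad p / Sig a p * (X 3 / rad p)
  e3_4X : conn M a p e3 (e4 M a p) X = 2 * a ^ 2 * cosθ p / Sig a p * (X 3 / rad p)
      - 2 * a * rad p / Sig a p * (Y 3 / rad p)
  e3_4Y : conn M a p e3 (e4 M a p) Y = 2 * a ^ 2 * cosθ p / Sig a p * (Y 3 / rad p)
      + 2 * a * rad p / Sig a p * (X 3 / rad p)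
  e4_4X : conn M a p (e4 M a) (e4 M a p) X = 0
  e4_4Y : conn M a p (e4 M a) (e4 M a p) Y = 0
  e4_3X : conn M a p (e4 M a) (e3 p) X = 2 * a ^ 2 * cosθ p / Sig a p * (X 3 / rad p)
      + 2 * a * rad p / Sig a p * (Y 3 / rad p)
  e4_3Y : conn M a p (e4 M a) (e3 p) Y = 2 * a ^ 2 * cosθ p / Sig a p * (Y 3 / rad p)
      - 2 * a * rad p / Sig a p * (X 3 / rad p)
  e4_XX : conn M a p (e4 M a) X X = quot M a p * rad p / Sig a p
  e4_YY : conn M a p (e4 M a) Y Y = quot M a p * rad p / Sig a p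
  e4_XY : conn M a p (e4 M a) X Y = quot M a p * a * cosθ p / Sig a p
  e4_YX : conn M a p (e4 M a) Y X = -(quot M a p * a * cosθ p / Sig a p)

lemma IsFrame.isConnTable (h : IsFrame a p X Y) (hM : 0 < M) (ha : |a| ≤ M)
    (hp : p ∈ exterior M a) : IsConnTable M a p X Y := by
  have hr := rad_pos hM hp
  have hS := (Sig_pos a hr).ne'
  have hX := h.hor_X
  have hY := h.hor_Y
  have hXX : X 1 * X 1 + X 2 * X 2 + X 3 * X 3 = rad p ^ 2 / Sig a p := by
    linear_combination h.norm_X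
  have hYY : Y 1 * Y 1 + Y 2 * Y 2 + Y 3 * Y 3 = rad p ^ 2 / Sig a p := by
    linear_combination h.norm_Y
  have hYX : Y 1 * X 1 + Y 2 * X 2 + Y 3 * X 3 = 0 := by linear_combination h.inner_XY
  have hc : X 1 * Y 2 - X 2 * Y 1 = rad p ^ 2 / Sig a p * cosθ p := by
    rw [h.cross_three, ← cosθ_mul_rad hr]; ring
  have hc' : Y 1 * X 2 - Y 2 * X 1 = -(rad p ^ 2 / Sig a p * cosθ p) := by
    linear_combination -hc
  have hX4 : conn M a p e3 X (e4 M a p) = -(2 * a ^ 2 * cosθ p / Sig a p * (X 3 / rad p))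
      - 2 * a * rad p / Sig a p * (Y 3 / rad p) := by
    rw [conn_e3_hor_e4 hM ha hp hX, h.sinSqdφ_X]
  have hY4 : conn M a p e3 Y (e4 M a p) = -(2 * a ^ 2 * cosθ p / Sig a p * (Y 3 / rad p))
      + 2 * a * rad p / Sig a p * (X 3 / rad p) := by
    rw [conn_e3_hor_e4 hM ha hp hY, h.sinSqdφ_Y]; ring
  exact
  { e3_to_e3 := conn_e3_to_e3 hM ha hp
    e3_along_e3 := conn_e3_along_e3 hM ha hp
    e4_to_e4 := conn_e4_to_e4 hM ha hp
    e4_to_e3 := conn_e4_to_e3 hM ha hp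
    e3_44 := conn_e3_e4_e4 hM ha hp
    e3_XX := by
      rw [conn_e3_hor_hor hM ha hp hX hX, hXX]; field_simp; ring
    e3_YY := by
      rw [conn_e3_hor_hor hM ha hp hY hY, hYY]; field_simp; ring
    e3_XY := by
      rw [conn_e3_hor_hor hM ha hp hX hY, h.inner_XY, hc]; field_simp; ring
    e3_YX := by
      rw [conn_e3_hor_hor hM ha hp hY hX, hYX, hc']; field_simp; ring
    e3_X4 := hX4
    e3_Y4 := hY4
    e3_4X := by rw [conn_e3_e4_hor hM ha hp hX, hX4]; ring
    e3_4Y := by rw [conn_e3_e4_hor hM ha hp hY, hY4]; ring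
    e4_4X := conn_e4_e4_hor hM ha hp hX
    e4_4Y := conn_e4_e4_hor hM ha hp hY
    e4_3X := by rw [conn_e4_hor_e3 hM ha hp hX, hX4]; ring
    e4_3Y := by rw [conn_e4_hor_e3 hM ha hp hY, hY4]; ring
    e4_XX := by
      rw [conn_e4_hor_hor hM ha hp hX hX, hXX]; field_simp; ring
    e4_YY := by
      rw [conn_e4_hor_hor hM ha hp hY hY, hYY]; field_simp; ring
    e4_XY := by
      rw [conn_e4_hor_hor hM ha hp hX hY, h.inner_XY, hc]; field_simp; ring
    e4_YX := by
      rw [conn_e4_hor_hor hM ha hp hY hX, hYX, hc']; field_simp; ring }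

/-! ### The scalars of χ̲ and the square of r + i a cos θ. -/

lemma trChiBar_eq (hM : 0 < M) (ha : |a| ≤ M) (hp : p ∈ exterior M a) :
    trChiBar M a p = -(2 * rad p / Sig a p) := by
  obtain ⟨X, Y, h, hN⟩ := exists_frame hM ha hp
  have hT := h.isConnTable hM ha hp
  rw [trChiBar, chiBar, hN.hTr_secondForm, hT.e3_XX, hT.e3_YY]
  ring

lemma atrChiBar_eq (hM : 0 < M) (ha : |a| ≤ M) (hp : p ∈ exterior M a) :
    atrChiBar M a p = 2 * a * cosθ p / Sig a p := by
  obtain ⟨X, Y, h, hN⟩ := exists_frame hM ha hp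
  have hT := h.isConnTable hM ha hp
  rw [atrChiBar, chiBar, h.hAtr_secondForm hM ha hp, hT.e3_XY, hT.e3_YX]
  ring

/-- The function `Re (r + i a cos θ)² = r² - a² cos² θ`. -/
noncomputable def reSq (a : ℝ) (p : Point) : ℝ := rad p ^ 2 - a ^ 2 * cosθ p ^ 2

/-- The function `Im (r + i a cos θ)² = 2 a r cos θ`. -/
noncomputable def imSq (a : ℝ) (p : Point) : ℝ := 2 * a * rad p * cosθ p

lemma reSq_sq_add_imSq_sq (p : Point) : reSq a p ^ 2 + imSq a p ^ 2 = Sig a p ^ 2 := by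
  unfold reSq imSq Sig; ring

/-- With `atrChiBar_mul` this is the single complex identity ¼Σ²(tr χ̲ - i ε·χ̲)² = (r + i a cos
θ)². -/
lemma trChiBar_sq_sub (hM : 0 < M) (ha : |a| ≤ M) (hp : p ∈ exterior M a) :
    trChiBar M a p ^ 2 - atrChiBar M a p ^ 2 = 4 * reSq a p / Sig a p ^ 2 := by
  rw [trChiBar_eq hM ha hp, atrChiBar_eq hM ha hp, reSq]; ring

lemma atrChiBar_mul (hM : 0 < M) (ha : |a| ≤ M) (hp : p ∈ exterior M a) :
    atrChiBar M a p * trChiBar M a p = -(2 * imSq a p / Sig a p ^ 2) := by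
  rw [trChiBar_eq hM ha hp, atrChiBar_eq hM ha hp, imSq]; ring

lemma der_reSq (hu : UniqueDiffWithinAt ℝ (exterior M a) p) (hr : 0 < rad p) (Z : Fin 4 → ℝ) :
    der M a p (reSq a) Z
      = 2 * rad p * (dr p ⬝ᵥ Z) - 2 * a ^ 2 * cosθ p * (dcos p ⬝ᵥ Z) := by
  have hc := (diffAt_cosθ (M := M) (a := a) hr).pow 2
  unfold reSq
  rw [der_sub hu Z ((diffAt_rad hr).pow 2) ((diffAt_const _).mul hc),
    der_const_mul hu Z _ hc, der_sq hu Z (diffAt_rad hr), der_sq hu Z (diffAt_cosθ hr),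
    der_rad hu hr, der_cosθ hu hr]
  ring

lemma der_imSq (hu : UniqueDiffWithinAt ℝ (exterior M a) p) (hr : 0 < rad p) (Z : Fin 4 → ℝ) :
    der M a p (imSq a) Z
      = 2 * a * (cosθ p * (dr p ⬝ᵥ Z) + rad p * (dcos p ⬝ᵥ Z)) := by
  have h1 := (diffAt_const (M := M) (a := a) (p := p) (2 * a)).mul (diffAt_rad hr)
  unfold imSq
  rw [der_mul hu Z h1 (diffAt_cosθ hr), der_const_mul hu Z _ (diffAt_rad hr), der_rad hu hr,
    der_cosθ hu hr]
  ring

lemma diffAt_reSq (hr : 0 < rad p) : DiffAt M a p (reSq a) :=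
  ((diffAt_rad hr).pow 2).sub ((diffAt_const _).mul ((diffAt_cosθ hr).pow 2))

lemma diffAt_imSq (hr : 0 < rad p) : DiffAt M a p (imSq a) :=
  ((diffAt_const _).mul (diffAt_rad hr)).mul (diffAt_cosθ hr)

lemma der_rhoHat (hF : IsTwoForm M a F) (hM : 0 < M) (ha : |a| ≤ M) (hp : p ∈ exterior M a)
    (Z : Fin 4 → ℝ) : der M a p (rhoHat M a F) Z
      = reSq a p * der M a p (rho M a F) Z + rho M a F p * der M a p (reSq a) Z
        - (imSq a p * der M a p (sigma M a F) Z + sigma M a F p * der M a p (imSq a) Z) := by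
  have hr := rad_pos hM hp
  have hu := uniqueDiffWithinAt_exterior hM hp
  have hA := diffAt_reSq (M := M) (a := a) hr
  have hB := diffAt_imSq (M := M) (a := a) hr
  have hρ := diffAt_rho hM hF hp
  have hσ := diffAt_sigma hM ha hF hp
  rw [show rhoHat M a F = fun q => reSq a q * rho M a F q - imSq a q * sigma M a F q from rfl,
    der_sub hu Z (hA.mul hρ) (hB.mul hσ), der_mul hu Z hA hρ, der_mul hu Z hB hσ]

lemma der_sigmaHat (hF : IsTwoForm M a F) (hM : 0 < M) (ha : |a| ≤ M) (hp : p ∈ exterior M a)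
    (Z : Fin 4 → ℝ) : der M a p (sigmaHat M a F) Z
      = imSq a p * der M a p (rho M a F) Z + rho M a F p * der M a p (imSq a) Z
        + (reSq a p * der M a p (sigma M a F) Z + sigma M a F p * der M a p (reSq a) Z) := by
  have hr := rad_pos hM hp
  have hu := uniqueDiffWithinAt_exterior hM hp
  have hA := diffAt_reSq (M := M) (a := a) hr
  have hB := diffAt_imSq (M := M) (a := a) hr
  have hρ := diffAt_rho hM hF hp
  have hσ := diffAt_sigma hM ha hF hp
  rw [show sigmaHat M a F = fun q => imSq a q * rho M a F q + reSq a q * sigma M a F q from rfl,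
    der_add hu Z (hB.mul hρ) (hA.mul hσ), der_mul hu Z hA hσ, der_mul hu Z hB hρ]

/-- The covariant derivatives of the horizontal volume form in an adapted frame. -/
lemma IsFrame.cov₂_hVol (h : IsFrame a p X Y) (hM : 0 < M) (ha : |a| ≤ M)
    (hp : p ∈ exterior M a) (Z : Fin 4 → ℝ) :
    (cov₂ M a p (hVol M a) Z X Y = 0 ∧ cov₂ M a p (hVol M a) Z Y X = 0) ∧
    (∀ V, cov₂ M a p (hVol M a) Z V (e3 p) = (flat M a p Y ⬝ᵥ V) * conn M a p e3 Z X
      - (flat M a p X ⬝ᵥ V) * conn M a p e3 Z Y) ∧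
    (∀ V, cov₂ M a p (hVol M a) Z (e3 p) V = -((flat M a p Y ⬝ᵥ V) * conn M a p e3 Z X
      - (flat M a p X ⬝ᵥ V) * conn M a p e3 Z Y)) ∧
    (∀ V, cov₂ M a p (hVol M a) Z V (e4 M a p) = (flat M a p Y ⬝ᵥ V) * conn M a p (e4 M a) Z X
      - (flat M a p X ⬝ᵥ V) * conn M a p (e4 M a) Z Y) ∧
    (∀ V, cov₂ M a p (hVol M a) Z (e4 M a p) V = -((flat M a p Y ⬝ᵥ V)
      * conn M a p (e4 M a) Z X - (flat M a p X ⬝ᵥ V) * conn M a p (e4 M a) Z Y)) ∧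
    ∀ V, cov₂ M a p (hVol M a) Z V V = 0 := by
  have hsk := Kerr.cov₂_skew (A := hVol M a) hM hp (fun q hq => hVol_dot_skew hM ha hq) Z
  have h3 := h.cov₂_hVol_e hM ha hp (diffAt_e3_of_mem hM hp) (fun q hq => hVol_dot_e3 hM ha hq) Z
  have h4 := h.cov₂_hVol_e hM ha hp (diffAt_e4_of_mem hM hp) (fun q hq => hVol_dot_e4 hM ha hq) Z
  have h0 := h.cov₂_hVol_XY hM ha hp Z
  refine ⟨⟨h0, by rw [hsk, h0, neg_zero]⟩, h3, fun V => by rw [hsk, h3], h4,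
    fun V => by rw [hsk, h4], fun V => by linarith [hsk V V]⟩

/-- Since α annihilates e₃ and e₄ throughout, derivatives of α in these slots reduce to
undifferentiated α and connection coefficients. -/
lemma cov₁_alpha (hF : IsTwoForm M a F) (hM : 0 < M) (ha : |a| ≤ M) (hp : p ∈ exterior M a)
    (h : IsNullFrame M a p X Y) (Z : Fin 4 → ℝ) :
    cov₁ M a p (alpha M a F) Z (e3 p)
        = -((alpha M a F p ⬝ᵥ X) * conn M a p e3 Z X + (alpha M a F p ⬝ᵥ Y) * conn M a p e3 Z Y) ∧
    cov₁ M a p (alpha M a F) Z (e4 M a p) = -((alpha M a F p ⬝ᵥ X) * conn M a p (e4 M a) Z X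
        + (alpha M a F p ⬝ᵥ Y) * conn M a p (e4 M a) Z Y) := by
  have hu := uniqueDiffWithinAt_exterior hM hp
  have hα := diffAt_alpha hM ha hF hp
  have key : ∀ V, alpha M a F p ⬝ᵥ V = (alpha M a F p ⬝ᵥ X) * (flat M a p X ⬝ᵥ V)
      + (alpha M a F p ⬝ᵥ Y) * (flat M a p Y ⬝ᵥ V) := by
    intro V
    rw [h.alpha_dot V, h.alpha_dot X, h.alpha_dot Y, h.fXX, h.fXY, h.fYX, h.fYY]
    ring
  constructor
  · rw [cov₁_of_dot_const hu hp hα (diffAt_e3_of_mem hM hp) (c := 0), key (nab M a p e3 Z)]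
    · rfl
    · intro q hq
      obtain ⟨X', Y', -, hN⟩ := exists_frame hM ha hq
      rw [hN.alpha_dot, hN.fX3, hN.fY3]; ring
  · rw [cov₁_of_dot_const hu hp hα (diffAt_e4_of_mem hM hp) (c := 0), key (nab M a p (e4 M a) Z)]
    · rfl
    · intro q hq
      obtain ⟨X', Y', -, hN⟩ := exists_frame hM ha hq
      rw [hN.alpha_dot, hN.fX4, hN.fY4]; ring

lemma cov₁_alphaBar (hF : IsTwoForm M a F) (hM : 0 < M) (ha : |a| ≤ M) (hp : p ∈ exterior M a)
    (h : IsNullFrame M a p X Y) (Z : Fin 4 → ℝ) :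
    cov₁ M a p (alphaBar M a F) Z (e3 p) = -((alphaBar M a F p ⬝ᵥ X) * conn M a p e3 Z X
        + (alphaBar M a F p ⬝ᵥ Y) * conn M a p e3 Z Y) ∧
    cov₁ M a p (alphaBar M a F) Z (e4 M a p)
        = -((alphaBar M a F p ⬝ᵥ X) * conn M a p (e4 M a) Z X
        + (alphaBar M a F p ⬝ᵥ Y) * conn M a p (e4 M a) Z Y) := by
  have hu := uniqueDiffWithinAt_exterior hM hp
  have hα := diffAt_alphaBar hM ha hF hp
  have key : ∀ V, alphaBar M a F p ⬝ᵥ V = (alphaBar M a F p ⬝ᵥ X) * (flat M a p X ⬝ᵥ V)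
      + (alphaBar M a F p ⬝ᵥ Y) * (flat M a p Y ⬝ᵥ V) := by
    intro V
    rw [h.alphaBar_dot V, h.alphaBar_dot X, h.alphaBar_dot Y, h.fXX, h.fXY, h.fYX, h.fYY]
    ring
  constructor
  · rw [cov₁_of_dot_const hu hp hα (diffAt_e3_of_mem hM hp) (c := 0), key (nab M a p e3 Z)]
    · rfl
    · intro q hq
      obtain ⟨X', Y', -, hN⟩ := exists_frame hM ha hq
      rw [hN.alphaBar_dot, hN.fX3, hN.fY3]; ring
  · rw [cov₁_of_dot_const hu hp hα (diffAt_e4_of_mem hM hp) (c := 0), key (nab M a p (e4 M a) Z)]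
    · rfl
    · intro q hq
      obtain ⟨X', Y', -, hN⟩ := exists_frame hM ha hq
      rw [hN.alphaBar_dot, hN.fX4, hN.fY4]; ring

lemma IsNullFrame.hor_dot (h : IsNullFrame M a p X Y) {s : Fin 4 → ℝ} {x y : ℝ}
    (hs : ∀ ν, s ν = x * flat M a p X ν + y * flat M a p Y ν) : s ⬝ᵥ X = x ∧ s ⬝ᵥ Y = y := by
  have key : ∀ V, s ⬝ᵥ V = x * (flat M a p X ⬝ᵥ V) + y * (flat M a p Y ⬝ᵥ V) := by
    intro V
    simp only [dotProduct, hs, Finset.mul_sum, ← Finset.sum_add_distrib]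
    exact Finset.sum_congr rfl fun ν _ => by ring
  rw [key, key, h.fXX, h.fXY, h.fYX, h.fYY]
  constructor <;> ring

lemma alphaBar_expand (h : IsNullFrame M a p X Y) (ν : Fin 4) :
    alphaBar M a F p ν = (alphaBar M a F p ⬝ᵥ X) * flat M a p X ν
      + (alphaBar M a F p ⬝ᵥ Y) * flat M a p Y ν := by
  obtain ⟨h1, h2⟩ := h.hor_dot (fun ν => h.alphaBar_apply (F := F) ν)
  rw [h1, h2, h.alphaBar_apply]

lemma IsNullFrame.frakT_dot (h : IsNullFrame M a p X Y)
    (hu : UniqueDiffWithinAt ℝ (exterior M a) p) (hs : ∀ ν, DiffAt M a p fun q => s q ν) :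
    frakT M a s p ⬝ᵥ X = 1 / 2 * Sig a p * (cov₁ M a p s (e3 p) X
      + conn M a p e3 X X * (s p ⬝ᵥ X) + conn M a p e3 X Y * (s p ⬝ᵥ Y)) ∧
    frakT M a s p ⬝ᵥ Y = 1 / 2 * Sig a p * (cov₁ M a p s (e3 p) Y
      + conn M a p e3 Y X * (s p ⬝ᵥ X) + conn M a p e3 Y Y * (s p ⬝ᵥ Y)) :=
  h.hor_dot (h.frakT_apply hu hs)

lemma IsNullFrame.frakTBar_dot (h : IsNullFrame M a p X Y)
    (hu : UniqueDiffWithinAt ℝ (exterior M a) p) (hs : ∀ ν, DiffAt M a p fun q => s q ν)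
    (hsp : ∀ ν, s p ν = (s p ⬝ᵥ X) * flat M a p X ν + (s p ⬝ᵥ Y) * flat M a p Y ν) :
    frakTBar M a s p ⬝ᵥ X = 1 / 2 * Sig a p * (cov₁ M a p s (e4 M a p) X
      + conn M a p (e4 M a) X X * (s p ⬝ᵥ X) + conn M a p (e4 M a) X Y * (s p ⬝ᵥ Y)
      + omegaHat M a p * (s p ⬝ᵥ X)) ∧
    frakTBar M a s p ⬝ᵥ Y = 1 / 2 * Sig a p * (cov₁ M a p s (e4 M a p) Y
      + conn M a p (e4 M a) Y X * (s p ⬝ᵥ X) + conn M a p (e4 M a) Y Y * (s p ⬝ᵥ Y)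
      + omegaHat M a p * (s p ⬝ᵥ Y)) :=
  h.hor_dot (h.frakTBar_apply hu hs hsp)

set_option linter.unusedSimpArgs false in
/-- The null components of the Maxwell equations in an adapted frame. -/
lemma IsFrame.maxwell_components (h : IsFrame a p X Y) (hF : IsTwoForm M a F) (hM : 0 < M)
    (ha : |a| ≤ M) (hp : p ∈ exterior M a) :
    cyc M a p F (e3 p) X Y = der M a p (sigma M a F) (e3 p) + hCurl M a (alphaBar M a F) p
      + 2 * (a * cosθ p * rho M a F p - rad p * sigma M a F p) / Sig a p ∧
    frameDiv M a p F X Y (e3 p) = der M a p (rho M a F) (e3 p) + hDiv M a (alphaBar M a F) p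
      - 2 * (rad p * rho M a F p + a * cosθ p * sigma M a F p) / Sig a p ∧
    cyc M a p F (e4 M a p) X Y = der M a p (sigma M a F) (e4 M a p)
      + hCurl M a (fun q ν => Sig a q * alpha M a F q ν) p / Sig a p
      - 2 * quot M a p * (a * cosθ p * rho M a F p - rad p * sigma M a F p) / Sig a p ∧
    frameDiv M a p F X Y (e4 M a p) = -der M a p (rho M a F) (e4 M a p)
      + hDiv M a (fun q ν => Sig a q * alpha M a F q ν) p / Sig a p
      - 2 * quot M a p * (rad p * rho M a F p + a * cosθ p * sigma M a F p) / Sig a p ∧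
    cyc M a p F (e3 p) (e4 M a p) X = 2 * der M a p (rho M a F) X
      - 2 * (frakT M a (alpha M a F) p ⬝ᵥ X - frakTBar M a (alphaBar M a F) p ⬝ᵥ X) / Sig a p
      + 4 * a * (a * cosθ p * rho M a F p - rad p * sigma M a F p) / Sig a p * (X 3 / rad p) ∧
    frameDiv M a p F X Y Y = der M a p (sigma M a F) X
      + (frakT M a (alpha M a F) p ⬝ᵥ Y + frakTBar M a (alphaBar M a F) p ⬝ᵥ Y) / Sig a p
      + 2 * a * (rad p * rho M a F p + a * cosθ p * sigma M a F p) / Sig a p * (X 3 / rad p) ∧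
    cyc M a p F (e3 p) (e4 M a p) Y = 2 * der M a p (rho M a F) Y
      - 2 * (frakT M a (alpha M a F) p ⬝ᵥ Y - frakTBar M a (alphaBar M a F) p ⬝ᵥ Y) / Sig a p
      + 4 * a * (a * cosθ p * rho M a F p - rad p * sigma M a F p) / Sig a p * (Y 3 / rad p) ∧
    frameDiv M a p F X Y X = -der M a p (sigma M a F) Y
      + (frakT M a (alpha M a F) p ⬝ᵥ X + frakTBar M a (alphaBar M a F) p ⬝ᵥ X) / Sig a p
      - 2 * a * (rad p * rho M a F p + a * cosθ p * sigma M a F p) / Sig a p * (Y 3 / rad p) := by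
  have hr := rad_pos hM hp
  have hN := h.isNullFrame ha hr
  have hT := h.isConnTable hM ha hp
  have hε := fun V W => h.hVol_dot (M := M) ha hr V W
  have hdε := h.cov₂_hVol hM ha hp
  have dXY := fun Z => (hdε Z).1.1
  have dYX := fun Z => (hdε Z).1.2
  have dV3 := fun Z => (hdε Z).2.1
  have d3V := fun Z => (hdε Z).2.2.1
  have dV4 := fun Z => (hdε Z).2.2.2.1
  have d4V := fun Z => (hdε Z).2.2.2.2.1
  have dVV := fun Z => (hdε Z).2.2.2.2.2
  have hα := fun Z => cov₁_alpha hF hM ha hp hN Z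
  have hβ := fun Z => cov₁_alphaBar hF hM ha hp hN Z
  have α3 : alpha M a F p ⬝ᵥ e3 p = 0 := by rw [hN.alpha_dot, hN.fX3, hN.fY3]; ring
  have α4 : alpha M a F p ⬝ᵥ e4 M a p = 0 := by rw [hN.alpha_dot, hN.fX4, hN.fY4]; ring
  have β3 : alphaBar M a F p ⬝ᵥ e3 p = 0 := by rw [hN.alphaBar_dot, hN.fX3, hN.fY3]; ring
  have β4 : alphaBar M a F p ⬝ᵥ e4 M a p = 0 := by rw [hN.alphaBar_dot, hN.fX4, hN.fY4]; ring
  have hu := uniqueDiffWithinAt_exterior hM hp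
  have dα := diffAt_alpha hM ha hF hp
  have dβ := diffAt_alphaBar hM ha hF hp
  have dS := diffAt_Sig (M := M) (a := a) hr
  have dSα : ∀ ν, DiffAt M a p fun q => Sig a q * alpha M a F q ν := fun ν => dS.mul (dα ν)
  have hS := (Sig_pos a hr).ne'
  have hSX : der M a p (Sig a) X = 2 * a ^ 2 * cosθ p * (X 3 / rad p) := by
    rw [der_Sig hu hr, h.dr_X, h.dcos_X hr]; ring
  have hSY : der M a p (Sig a) Y = 2 * a ^ 2 * cosθ p * (Y 3 / rad p) := by
    rw [der_Sig hu hr, h.dr_Y, h.dcos_Y hr]; ring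
  -- The right sides are opened into covariant derivatives of α and α̲ on the frame. The derivative
  -- of Σ in div(Σα) and curl(Σα) absorbs the torsion-like terms multiplying α.
  rw [(hN.frakT_dot hu dα).1, (hN.frakT_dot hu dα).2,
    (hN.frakTBar_dot hu dβ (alphaBar_expand hN)).1, (hN.frakTBar_dot hu dβ (alphaBar_expand hN)).2,
    hN.hDiv_eq hu dβ, h.hCurl_eq hM ha hp dβ, hN.hDiv_eq hu dSα, h.hCurl_eq hM ha hp dSα,
    cov₁_smul hu dS dα, cov₁_smul hu dS dα, cov₁_smul hu dS dα, cov₁_smul hu dS dα, hSX, hSY,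
    omegaHat_eq hM ha hp]
  simp only [cyc, frameDiv, hF.cov₂_eq hM ha hp, ← flat_eq_lower, hN.f33, hN.f34, hN.f3X, hN.f3Y,
    hN.f43, hN.f44, hN.f4X, hN.f4Y, hε, hN.fX3, hN.fX4, hN.fXX, hN.fXY, hN.fY3, hN.fY4, hN.fYX,
    hN.fYY, dXY, dYX, dV3, d3V, dV4, d4V, dVV, (hα _).1, (hα _).2, (hβ _).1, (hβ _).2,
    α3, α4, β3, β4, hT.e3_to_e3, hT.e3_along_e3, hT.e4_to_e4, hT.e4_to_e3, hT.e3_44, hT.e3_XX,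
    hT.e3_YY, hT.e3_XY, hT.e3_YX, hT.e3_X4, hT.e3_Y4, hT.e3_4X, hT.e3_4Y, hT.e4_4X, hT.e4_4Y,
    hT.e4_3X, hT.e4_3Y, hT.e4_XX, hT.e4_YY, hT.e4_XY, hT.e4_YX]
  refine ⟨?_, ?_, ?_, ?_, ?_, ?_, ?_, ?_⟩ <;> field_simp <;> ring

/-- Multiplication by `x + i y ≠ 0` is injective. -/
lemma rotation_eq_zero {x y : ℝ} (hxy : x ^ 2 + y ^ 2 ≠ 0) (u v : ℝ) :
    (x * u + y * v = 0 ∧ x * v - y * u = 0) ↔ (u = 0 ∧ v = 0) := by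
  constructor
  · rintro ⟨h1, h2⟩
    refine ⟨(mul_eq_zero.1 (?_ : (x ^ 2 + y ^ 2) * u = 0)).resolve_left hxy,
      (mul_eq_zero.1 (?_ : (x ^ 2 + y ^ 2) * v = 0)).resolve_left hxy⟩
    · linear_combination x * h1 - y * h2
    · linear_combination y * h1 + x * h2
  · rintro ⟨rfl, rfl⟩
    constructor <;> ring

/-- Two horizontal one-forms agree as soon as they agree on an orthonormal horizontal frame. -/
lemma IsNullFrame.hor_ext_iff (h : IsNullFrame M a p X Y) {s t : Fin 4 → ℝ} {x y x' y' : ℝ}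
    (hs : ∀ ν, s ν = x * flat M a p X ν + y * flat M a p Y ν)
    (ht : ∀ ν, t ν = x' * flat M a p X ν + y' * flat M a p Y ν) :
    (∀ ν, s ν = t ν) ↔ (x - x' = 0 ∧ y - y' = 0) := by
  constructor
  · intro hst
    obtain ⟨h1, h2⟩ := h.hor_dot hs
    obtain ⟨h3, h4⟩ := h.hor_dot ht
    have : s = t := funext hst
    rw [← h1, ← h2, ← h3, ← h4, this]
    simp
  · rintro ⟨h1, h2⟩ ν
    rw [hs, ht, sub_eq_zero.1 h1, sub_eq_zero.1 h2]

/-! ### The modified Maxwell equations -/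

lemma eq_iff_of_sub_eq {x y z : ℝ} (h : x - y = z) : x = y ↔ z = 0 := by
  rw [← h, sub_eq_zero]

lemma reSq_sq_add_imSq_sq_ne_zero (hr : 0 < rad p) : reSq a p ^ 2 + imSq a p ^ 2 ≠ 0 := by
  rw [reSq_sq_add_imSq_sq]
  exact pow_ne_zero 2 (Sig_pos a hr).ne'

/-- With ζ = r + i a cos θ one has e₃ζ = -1. The defects of the two identities, σ̂ and ρ̂ in this
order, are the imaginary and real parts of ζ² times (divergence + i cyclic sum). -/
lemma IsFrame.along_e3_iff (h : IsFrame a p X Y) (hF : IsTwoForm M a F) (hM : 0 < M)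
    (ha : |a| ≤ M) (hp : p ∈ exterior M a) :
    (along M a e3 (sigmaHat M a F) p =
        1 / 2 * Sig a p ^ 2 * (atrChiBar M a p * trChiBar M a p) * hDiv M a (alphaBar M a F) p
        - 1 / 4 * Sig a p ^ 2 * (trChiBar M a p ^ 2 - atrChiBar M a p ^ 2)
          * hCurl M a (alphaBar M a F) p ∧
      along M a e3 (rhoHat M a F) p =
        -(1 / 4) * Sig a p ^ 2 * (trChiBar M a p ^ 2 - atrChiBar M a p ^ 2)
          * hDiv M a (alphaBar M a F) p
        - 1 / 2 * Sig a p ^ 2 * (atrChiBar M a p * trChiBar M a p)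
          * hCurl M a (alphaBar M a F) p) ↔
    (cyc M a p F (e3 p) X Y = 0 ∧ frameDiv M a p F X Y (e3 p) = 0) := by
  have hr := rad_pos hM hp
  have hu := uniqueDiffWithinAt_exterior hM hp
  have hS := (Sig_pos a hr).ne'
  obtain ⟨h1, h2, -⟩ := h.maxwell_components hF hM ha hp
  rw [← rotation_eq_zero (reSq_sq_add_imSq_sq_ne_zero (a := a) hr), trChiBar_sq_sub hM ha hp,
    atrChiBar_mul hM ha hp, along_eq, along_eq, der_sigmaHat hF hM ha hp, der_rhoHat hF hM ha hp,
    der_reSq hu hr, der_imSq hu hr, dr_dot_e3 hr, dcos_dot_e3 hr, h1, h2]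
  refine and_congr (eq_iff_of_sub_eq ?_) (eq_iff_of_sub_eq ?_) <;> field_simp <;>
    unfold reSq imSq Sig <;> ring

lemma IsFrame.along_e4_iff (h : IsFrame a p X Y) (hF : IsTwoForm M a F) (hM : 0 < M)
    (ha : |a| ≤ M) (hp : p ∈ exterior M a) :
    (along M a (e4 M a) (sigmaHat M a F) p =
        -(1 / 2) * Sig a p * (atrChiBar M a p * trChiBar M a p)
          * hDiv M a (fun q ν => Sig a q * alpha M a F q ν) p
        - 1 / 4 * Sig a p * (trChiBar M a p ^ 2 - atrChiBar M a p ^ 2)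
          * hCurl M a (fun q ν => Sig a q * alpha M a F q ν) p ∧
      along M a (e4 M a) (rhoHat M a F) p =
        1 / 4 * Sig a p * (trChiBar M a p ^ 2 - atrChiBar M a p ^ 2)
          * hDiv M a (fun q ν => Sig a q * alpha M a F q ν) p
        - 1 / 2 * Sig a p * (atrChiBar M a p * trChiBar M a p)
          * hCurl M a (fun q ν => Sig a q * alpha M a F q ν) p) ↔
    (cyc M a p F (e4 M a p) X Y = 0 ∧ frameDiv M a p F X Y (e4 M a p) = 0) := by
  have hr := rad_pos hM hp
  have hu := uniqueDiffWithinAt_exterior hM hp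
  have hS := (Sig_pos a hr).ne'
  obtain ⟨-, -, h1, h2, -⟩ := h.maxwell_components hF hM ha hp
  -- The divergence component along e₄ contains -e₄(ρ), hence the change of sign before rotating by
  -- ζ²; now e₄ζ = Δ/Σ.
  rw [← neg_eq_zero (a := frameDiv M a p F X Y (e4 M a p)),
    ← rotation_eq_zero (reSq_sq_add_imSq_sq_ne_zero (a := a) hr), trChiBar_sq_sub hM ha hp,
    atrChiBar_mul hM ha hp, along_eq, along_eq, der_sigmaHat hF hM ha hp, der_rhoHat hF hM ha hp,
    der_reSq hu hr, der_imSq hu hr, dr_dot_e4 hr, dcos_dot_e4 hr, h1, h2]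
  refine and_congr (eq_iff_of_sub_eq ?_) (eq_iff_of_sub_eq ?_) <;> field_simp <;>
    unfold reSq imSq Sig <;> ring

/-- Same mechanism along X and Y, where dr vanishes and ζ changes only through i a d cos θ. -/
lemma IsFrame.hGrad_iff (h : IsFrame a p X Y) (hF : IsTwoForm M a F) (hM : 0 < M)
    (ha : |a| ≤ M) (hp : p ∈ exterior M a) :
    ((∀ ν, hGrad M a (sigmaHat M a F) p ν =
        -(1 / 2) * Sig a p * (atrChiBar M a p * trChiBar M a p)
          * (frakT M a (alpha M a F) p ν - frakTBar M a (alphaBar M a F) p ν)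
        - 1 / 4 * Sig a p * (trChiBar M a p ^ 2 - atrChiBar M a p ^ 2)
          * (hStar M a (frakT M a (alpha M a F)) p ν
            + hStar M a (frakTBar M a (alphaBar M a F)) p ν)) ∧
      ∀ ν, hGrad M a (rhoHat M a F) p ν =
        1 / 4 * Sig a p * (trChiBar M a p ^ 2 - atrChiBar M a p ^ 2)
          * (frakT M a (alpha M a F) p ν - frakTBar M a (alphaBar M a F) p ν)
        - 1 / 2 * Sig a p * (atrChiBar M a p * trChiBar M a p)
          * (hStar M a (frakT M a (alpha M a F)) p ν
            + hStar M a (frakTBar M a (alphaBar M a F)) p ν)) ↔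
    (cyc M a p F (e3 p) (e4 M a p) X = 0 ∧ frameDiv M a p F X Y Y = 0) ∧
    (cyc M a p F (e3 p) (e4 M a p) Y = 0 ∧ frameDiv M a p F X Y X = 0) := by
  have hr := rad_pos hM hp
  have hr' := hr.ne'
  have hu := uniqueDiffWithinAt_exterior hM hp
  have hS := (Sig_pos a hr).ne'
  have hN := h.isNullFrame ha hr
  obtain ⟨-, -, -, -, h1, h2, h3, h4⟩ := h.maxwell_components hF hM ha hp
  have hT : ∀ ν, frakT M a (alpha M a F) p ν = (frakT M a (alpha M a F) p ⬝ᵥ X) * flat M a p X ν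
      + (frakT M a (alpha M a F) p ⬝ᵥ Y) * flat M a p Y ν := by
    intro ν
    have hα := diffAt_alpha hM ha hF hp
    rw [(hN.frakT_dot hu hα).1, (hN.frakT_dot hu hα).2, hN.frakT_apply hu hα]
  have hT' : ∀ ν, frakTBar M a (alphaBar M a F) p ν
      = (frakTBar M a (alphaBar M a F) p ⬝ᵥ X) * flat M a p X ν
      + (frakTBar M a (alphaBar M a F) p ⬝ᵥ Y) * flat M a p Y ν := by
    intro ν
    have hβ := diffAt_alphaBar hM ha hF hp
    rw [(hN.frakTBar_dot hu hβ (alphaBar_expand hN)).1,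
      (hN.frakTBar_dot hu hβ (alphaBar_expand hN)).2,
      hN.frakTBar_apply hu hβ (alphaBar_expand hN)]
  set TX := frakT M a (alpha M a F) p ⬝ᵥ X with hTX
  set TY := frakT M a (alpha M a F) p ⬝ᵥ Y with hTY
  set UX := frakTBar M a (alphaBar M a F) p ⬝ᵥ X with hUX
  set UY := frakTBar M a (alphaBar M a F) p ⬝ᵥ Y with hUY
  have hcomb : ∀ (c d : ℝ) (ν : Fin 4),
      c * (frakT M a (alpha M a F) p ν - frakTBar M a (alphaBar M a F) p ν)
        - d * (hStar M a (frakT M a (alpha M a F)) p ν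
            + hStar M a (frakTBar M a (alphaBar M a F)) p ν)
      = (c * (TX - UX) - d * (TY + UY)) * flat M a p X ν
        + (c * (TY - UY) + d * (TX + UX)) * flat M a p Y ν := by
    intro c d ν
    rw [h.hStar_apply hM ha hp, h.hStar_apply hM ha hp, hT, hT', ← hTX, ← hTY, ← hUX, ← hUY]
    ring
  clear_value TX TY UX UY
  -- Both sides are horizontal, so each identity of one-forms amounts to its two frame components.
  rw [hN.hor_ext_iff (hN.hGrad_apply _) (hcomb _ _), hN.hor_ext_iff (hN.hGrad_apply _) (hcomb _ _)]
  have hne := reSq_sq_add_imSq_sq_ne_zero (a := a) hr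
  have half : ∀ x : ℝ, x = 0 ↔ 1 / 2 * x = 0 := fun x => by simp
  -- Normalisation before rotating: the cyclic sums carry 2ρ-derivatives and are halved, and the
  -- divergence component along X contains the σ-derivative along Y with a minus sign.
  rw [and_comm (a := cyc M a p F (e3 p) (e4 M a p) X = 0),
    and_comm (a := cyc M a p F (e3 p) (e4 M a p) Y = 0),
    half (cyc M a p F (e3 p) (e4 M a p) X), half (cyc M a p F (e3 p) (e4 M a p) Y),
    ← neg_eq_zero (a := frameDiv M a p F X Y X),
    ← rotation_eq_zero hne (frameDiv M a p F X Y Y),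
    ← rotation_eq_zero hne (-frameDiv M a p F X Y X), and_and_and_comm, trChiBar_sq_sub hM ha hp,
    atrChiBar_mul hM ha hp]
  simp only [der_sigmaHat hF hM ha hp, der_rhoHat hF hM ha hp,
    der_reSq hu hr, der_imSq hu hr, h.dr_X, h.dr_Y, h.dcos_X hr, h.dcos_Y hr, h1, h2, h3, h4]
  have eqv : ∀ {x y : ℝ}, x = y → (x = 0 ↔ y = 0) := fun h => by rw [h]
  refine and_congr (and_congr (eqv ?_) (eqv ?_)) (and_congr (eqv ?_) (eqv ?_)) <;>
    field_simp <;> unfold reSq imSq Sig <;> ring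

end Kerr

theorem proposition3p3 (M a : ℝ) (hM : 0 < M) (ha : |a| ≤ M)
    (F : Field₂) (hF : IsTwoForm M a F) :
    (∀ p ∈ exterior M a,
      rhoHat M a F p =
          1 / 4 * Sig a p * (trChiBar M a p ^ 2 - atrChiBar M a p ^ 2) * (Sig a p * rho M a F p)
          + 1 / 2 * Sig a p * (atrChiBar M a p * trChiBar M a p) * (Sig a p * sigma M a F p) ∧
      sigmaHat M a F p =
          -(1 / 2) * Sig a p * (atrChiBar M a p * trChiBar M a p) * (Sig a p * rho M a F p)
          + 1 / 4 * Sig a p * (trChiBar M a p ^ 2 - atrChiBar M a p ^ 2)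
            * (Sig a p * sigma M a F p)) ∧
    (IsMaxwell M a F ↔ ∀ p ∈ exterior M a,
      along M a e3 (sigmaHat M a F) p =
          1 / 2 * Sig a p ^ 2 * (atrChiBar M a p * trChiBar M a p) * hDiv M a (alphaBar M a F) p
          - 1 / 4 * Sig a p ^ 2 * (trChiBar M a p ^ 2 - atrChiBar M a p ^ 2)
            * hCurl M a (alphaBar M a F) p ∧
      along M a e3 (rhoHat M a F) p =
          -(1 / 4) * Sig a p ^ 2 * (trChiBar M a p ^ 2 - atrChiBar M a p ^ 2)
            * hDiv M a (alphaBar M a F) p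
          - 1 / 2 * Sig a p ^ 2 * (atrChiBar M a p * trChiBar M a p)
            * hCurl M a (alphaBar M a F) p ∧
      along M a (e4 M a) (sigmaHat M a F) p =
          -(1 / 2) * Sig a p * (atrChiBar M a p * trChiBar M a p)
            * hDiv M a (fun q ν => Sig a q * alpha M a F q ν) p
          - 1 / 4 * Sig a p * (trChiBar M a p ^ 2 - atrChiBar M a p ^ 2)
            * hCurl M a (fun q ν => Sig a q * alpha M a F q ν) p ∧
      along M a (e4 M a) (rhoHat M a F) p =
          1 / 4 * Sig a p * (trChiBar M a p ^ 2 - atrChiBar M a p ^ 2)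
            * hDiv M a (fun q ν => Sig a q * alpha M a F q ν) p
          - 1 / 2 * Sig a p * (atrChiBar M a p * trChiBar M a p)
            * hCurl M a (fun q ν => Sig a q * alpha M a F q ν) p ∧
      (∀ ν, hGrad M a (sigmaHat M a F) p ν =
          -(1 / 2) * Sig a p * (atrChiBar M a p * trChiBar M a p)
            * (frakT M a (alpha M a F) p ν - frakTBar M a (alphaBar M a F) p ν)
          - 1 / 4 * Sig a p * (trChiBar M a p ^ 2 - atrChiBar M a p ^ 2)
            * (hStar M a (frakT M a (alpha M a F)) p ν
              + hStar M a (frakTBar M a (alphaBar M a F)) p ν)) ∧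
      (∀ ν, hGrad M a (rhoHat M a F) p ν =
          1 / 4 * Sig a p * (trChiBar M a p ^ 2 - atrChiBar M a p ^ 2)
            * (frakT M a (alpha M a F) p ν - frakTBar M a (alphaBar M a F) p ν)
          - 1 / 2 * Sig a p * (atrChiBar M a p * trChiBar M a p)
            * (hStar M a (frakT M a (alpha M a F)) p ν
              + hStar M a (frakTBar M a (alphaBar M a F)) p ν))) := by
  constructor
  · intro p hp
    have hS := (Sig_pos a (rad_pos hM hp)).ne'
    rw [trChiBar_sq_sub hM ha hp, atrChiBar_mul hM ha hp, rhoHat, sigmaHat, reSq, imSq]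
    constructor
    · field_simp
      ring
    · field_simp
  -- The equivalence already holds at each single point, so each point may use a frame of its own.
  · refine forall₂_congr fun p hp => ?_
    obtain ⟨X, Y, h, hN⟩ := exists_frame hM ha hp
    rw [hF.maxwell_iff hM hp hN, ← h.along_e3_iff hF hM ha hp, ← h.along_e4_iff hF hM ha hp,
      ← h.hGrad_iff hF hM ha hp]
    simp only [and_assoc]
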